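/- Fix $k\ge 1$. A $k$-labeled graph is a finite simple graph with a label from $[k]=\{1,\dots,k\}$ on each vertex. A fuse-$k$-expression $\phi$ is a well-formed expression built from the operations: introduce (create a single vertex of label $i$); disjoint union of two $k$-labeled graphs; join $\eta_{i,j}$, $i\ne j$ (add all edges between the vertices of label $i$ and those of label $j$); relabel $\rho_{i\to j}$, $i\neq j$ (every vertex of label $i$ gets label $j$); and fuse $\theta_i$, applied only if label $i$ occurs (replace all vertices of label $i$ by one new vertex of label $i$, adjacent to every remaining vertex that had a neighbor of label $i$). It is an expression of a graph $H$ if the graph it creates is, without its labels and up to isomorphism, $H$; its size $|\phi|$ is the number of nodes of its parse tree. A $k$-expression is a fuse-$k$-expression without fuse operations. In Max Cut one asks for the maximum, over all partitions $(V_1,V_2)$ of $V(H)$, of the number of edges of $H$ between $V_1$ and $V_2$. Theorem. Given a fuse-$k$-expression of a graph $H$ on $n$ vertices, Max Cut on $H$ can be solved in time $n^{\mathcal O(k)}$, where, as usual, the given expression is assumed to have size polynomial in $n$ (and $k$). Precisely: there is one algorithm that, given $k$ and a fuse-$k$-expression $\phi$ of any graph $H$, outputs the maximum size of a cut of $H$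 and for which 1. there is a constant $c$ such that its running time is at most $c\cdot\bigl((|\phi|+k)^{c}+n^{ck}\bigr)$ for all $k$, $\phi$ and $H$; 2. for every $d$ there is a constant $c_d$ such that its running time is at most $n^{c_d k}$ for all $k$, $\phi$ and $H$ with $n\ge 2$ and $|\phi|\le d\,(n+k)^d$. Moreover, lower bounds for clique-width transfer: if a time bound $T(|\phi|,k,n)$ is such that no algorithm solves Max Cut within time $T$ on all graphs given by $k$-expressions, then no algorithm solves Max Cut within time $T$ on all graphs given by fuse-$k$-expressions. (Running times are numbers of steps of WHILE programs over binary trees, a model that is polynomially equivalent to Turing machines and random access machines.) -/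

import Mathlib

/-! ## Labeled graphs and fuse-expressions -/

/-- A `k`-labeled graph: a simple graph with a label from a `k`-element set on every vertex. -/
structure LabeledGraph (k : ℕ) where
  V : Type
  graph : SimpleGraph V
  lab : V → Fin k

namespace LabeledGraph

variable {k : ℕ}

/-- A single vertex with label `i`. -/
def single (i : Fin k) : LabeledGraph k where
  V := Unit
  graph := ⊥
  lab := fun _ => i

/-- Disjoint union; labels are preserved. -/
def union (A B : LabeledGraph k) : LabeledGraph k where
  V := A.V ⊕ B.V
  graph := A.graph ⊕g B.graph
  lab := Sum.elim A.lab B.lab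

/-- Add all edges between the vertices of label `i` and the vertices of label `j`. -/
def join (i j : Fin k) (A : LabeledGraph k) : LabeledGraph k where
  V := A.V
  graph := A.graph ⊔ SimpleGraph.fromRel (fun u v => A.lab u = i ∧ A.lab v = j)
  lab := A.lab

/-- Every vertex of label `i` gets label `j`. -/
def relabel (i j : Fin k) (A : LabeledGraph k) : LabeledGraph k where
  V := A.V
  graph := A.graph
  lab := fun v => if A.lab v = i then j else A.lab v

/-- Adjacency after fusing the vertices of label `i` into one new vertex `Sum.inr ()`. -/
def fuseAdj (i : Fin k) (A : LabeledGraph k) :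
    {v : A.V // A.lab v ≠ i} ⊕ Unit → {v : A.V // A.lab v ≠ i} ⊕ Unit → Prop
  | Sum.inl u, Sum.inl v => A.graph.Adj u v
  | Sum.inl u, Sum.inr _ => ∃ w, A.lab w = i ∧ A.graph.Adj u w
  | Sum.inr _, Sum.inl v => ∃ w, A.lab w = i ∧ A.graph.Adj w v
  | Sum.inr _, Sum.inr _ => False

/-- Replace all vertices of label `i` by one new vertex of label `i` that is adjacent to every
remaining vertex that had a neighbor of label `i`. -/
def fuse (i : Fin k) (A : LabeledGraph k) : LabeledGraph k where
  V := {v : A.V // A.lab v ≠ i} ⊕ Unit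
  graph :=
    { Adj := fuseAdj i A
      symm := by
        constructor
        rintro (u | u) (v | v) h
        · exact SimpleGraph.Adj.symm h
        · obtain ⟨w, hw, h⟩ := h
          exact ⟨w, hw, SimpleGraph.Adj.symm h⟩
        · obtain ⟨w, hw, h⟩ := h
          exact ⟨w, hw, SimpleGraph.Adj.symm h⟩
        · exact h
      loopless := by
        constructor
        rintro (u | u) h
        · exact A.graph.irrefl h
        · exact h }
  lab := Sum.elim (fun v => A.lab v) (fun _ => i)

end LabeledGraph

/-- Parse trees of fuse-expressions with labels in `Fin k`. Distinct introduce-nodes create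
distinct vertices, so no vertex names are recorded. -/
inductive FuseExpr (k : ℕ) : Type
  | intro (i : Fin k) : FuseExpr k
  | union (a b : FuseExpr k) : FuseExpr k
  | join (i j : Fin k) (a : FuseExpr k) : FuseExpr k
  | relabel (i j : Fin k) (a : FuseExpr k) : FuseExpr k
  | fuse (i : Fin k) (a : FuseExpr k) : FuseExpr k

namespace FuseExpr

variable {k : ℕ}

/-- The labeled graph that the expression creates. -/
def eval : FuseExpr k → LabeledGraph k
  | intro i => LabeledGraph.single i
  | union a b => a.eval.union b.eval
  | join i j a => a.eval.join i j
  | relabel i j a => a.eval.relabel i j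
  | fuse i a => a.eval.fuse i

/-- Joins and relabels use two different labels, and a fuse is only applied to a label that
occurs. -/
def WellFormed : FuseExpr k → Prop
  | intro _ => True
  | union a b => a.WellFormed ∧ b.WellFormed
  | join i j a => i ≠ j ∧ a.WellFormed
  | relabel i j a => i ≠ j ∧ a.WellFormed
  | fuse i a => (∃ v, a.eval.lab v = i) ∧ a.WellFormed

/-- No fuse-node occurs: the expression is an ordinary (clique-width) `k`-expression. -/
def FuseFree : FuseExpr k → Prop
  | intro _ => True
  | union a b => a.FuseFree ∧ b.FuseFree
  | join _ _ a => a.FuseFree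
  | relabel _ _ a => a.FuseFree
  | fuse _ _ => False

/-- The number of nodes of the parse tree. -/
def size : FuseExpr k → ℕ
  | intro _ => 1
  | union a b => a.size + b.size + 1
  | join _ _ a => a.size + 1
  | relabel _ _ a => a.size + 1
  | fuse _ a => a.size + 1

/-- `φ` is a fuse-`k`-expression of the (unlabeled) graph `H`. -/
def IsFuseExprOf (φ : FuseExpr k) {V : Type} (H : SimpleGraph V) : Prop :=
  φ.WellFormed ∧ Nonempty (φ.eval.graph ≃g H)

/-- `φ` is a `k`-expression (without fuses) of the (unlabeled) graph `H`. -/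
def IsCliqueExprOf (φ : FuseExpr k) {V : Type} (H : SimpleGraph V) : Prop :=
  φ.FuseFree ∧ φ.IsFuseExprOf H

end FuseExpr

/-! ## Maximum cuts -/

/-- The number of edges of `H` between `S` and its complement. -/
noncomputable def cutSize {V : Type} (H : SimpleGraph V) (S : Set V) : ℕ :=
  Set.ncard {e | e ∈ H.edgeSet ∧ ∃ u ∈ S, ∃ v ∈ Sᶜ, e = s(u, v)}

/-- `r` is the maximum number of edges between the two sides of a partition of the vertex set. -/
def IsMaxCut {V : Type} (H : SimpleGraph V) (r : ℕ) : Prop :=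
  IsGreatest (Set.range (cutSize H)) r

/-! ## The machine model

WHILE programs over binary trees (the language of N. D. Jones, *Computability and Complexity from
a Programming Perspective*). Every elementary operation (reading a variable, forming a pair, taking
a component of a pair, an assignment, a test against `nil`) costs one step. Up to a polynomial, this
is the running time on Turing machines and on random access machines. -/

/-- The data: binary trees. -/
inductive Data : Type
  | nil : Data
  | cons (a b : Data) : Data

namespace Data

/-- First component (`nil` for `nil`). -/
def hd : Data → Data
  | nil => nil
  | cons a _ => a

/-- Second component (`nil` for `nil`). -/
def tl : Data → Data
  | nil => nil
  | cons _ b => b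

/-- The unary numeral of `n`: a list of `n` times `nil`. -/
def ofNat : ℕ → Data
  | 0 => nil
  | n + 1 => cons nil (ofNat n)

end Data

namespace While

/-- Expressions over the variables `0, 1, 2, …`. -/
inductive Expr : Type
  | var (x : ℕ) : Expr
  | nil : Expr
  | cons (e f : Expr) : Expr
  | hd (e : Expr) : Expr
  | tl (e : Expr) : Expr

/-- The contents of all variables. -/
abbrev Store : Type := ℕ → Data

/-- The value of an expression. -/
def Expr.eval (s : Store) : Expr → Data
  | var x => s x
  | nil => Data.nil
  | cons e f => Data.cons (e.eval s) (f.eval s)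
  | hd e => (e.eval s).hd
  | tl e => (e.eval s).tl

/-- The number of elementary operations needed to evaluate an expression. -/
def Expr.cost : Expr → ℕ
  | var _ => 1
  | nil => 1
  | cons e f => e.cost + f.cost + 1
  | hd e => e.cost + 1
  | tl e => e.cost + 1

/-- Programs. A test succeeds if the value of the expression is not `nil`. -/
inductive Program : Type
  | assign (x : ℕ) (e : Expr) : Program
  | seq (p q : Program) : Program
  | ite (e : Expr) (p q : Program) : Program
  | loop (e : Expr) (p : Program) : Program

/-- `Exec p s t s'`: started in the store `s`, the program `p` halts after exactly `t` steps in the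
store `s'`. -/
inductive Exec : Program → Store → ℕ → Store → Prop
  | assign (x : ℕ) (e : Expr) (s : Store) :
      Exec (.assign x e) s (e.cost + 1) (Function.update s x (e.eval s))
  | seq {p q : Program} {s s' s'' : Store} {t t' : ℕ} :
      Exec p s t s' → Exec q s' t' s'' → Exec (.seq p q) s (t + t') s''
  | ite_true {e : Expr} {p q : Program} {s s' : Store} {t : ℕ} :
      e.eval s ≠ Data.nil → Exec p s t s' → Exec (.ite e p q) s (e.cost + 1 + t) s'
  | ite_false {e : Expr} {p q : Program} {s s' : Store} {t : ℕ} :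
      e.eval s = Data.nil → Exec q s t s' → Exec (.ite e p q) s (e.cost + 1 + t) s'
  | loop_done {e : Expr} {p : Program} {s : Store} :
      e.eval s = Data.nil → Exec (.loop e p) s (e.cost + 1) s
  | loop_step {e : Expr} {p : Program} {s s' s'' : Store} {t t' : ℕ} :
      e.eval s ≠ Data.nil → Exec p s t s' → Exec (.loop e p) s' t' s'' →
      Exec (.loop e p) s (e.cost + 1 + t + t') s''

/-- The initial store: the input in variable `0`, `nil` everywhere else. -/
def initStore (d : Data) : Store := fun x => if x = 0 then d else Data.nil

/-- On input `d`, the program halts after exactly `t` steps with output `d'`, which is read off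
variable `0`. -/
def Program.Computes (P : Program) (d : Data) (t : ℕ) (d' : Data) : Prop :=
  ∃ s, Exec P (initStore d) t s ∧ s 0 = d'

end While

/-! ## Max Cut on a given expression -/

/-- An expression as input data: every node is a pair of the number of its operation and its
arguments. All numbers are in unary. -/
def FuseExpr.encode {k : ℕ} : FuseExpr k → Data
  | .intro i => .cons (.ofNat 0) (.ofNat i)
  | .union a b => .cons (.ofNat 1) (.cons a.encode b.encode)
  | .join i j a => .cons (.ofNat 2) (.cons (.cons (.ofNat i) (.ofNat j)) a.encode)
  | .relabel i j a => .cons (.ofNat 3) (.cons (.cons (.ofNat i) (.ofNat j)) a.encode)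
  | .fuse i a => .cons (.ofNat 4) (.cons (.ofNat i) a.encode)

/-- Given `k` and the expression `φ`, the program halts after at most `t` steps and outputs the
maximum size of a cut of `H`. -/
def SolvesMaxCut (P : While.Program) {k : ℕ} (φ : FuseExpr k) {V : Type} (H : SimpleGraph V)
    (t : ℕ) : Prop :=
  ∃ t' ≤ t, ∃ r, P.Computes (.cons (.ofNat k) φ.encode) t' (.ofNat r) ∧ IsMaxCut H r

/-! A fusion identifies vertices that a dynamic program over the expression has long forgotten, so
fusions are removed beforehand. Going down from the root, one carries for every label `l` the name
`δ l` of the vertex into which the present vertices of label `l` will be fused, and `0` if there is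
no such vertex (`FuseExpr.toNamed`). Leaves that end up in the same vertex get the same name. The
result has no fusions, its leaves may repeat names, and its graph on the names is the given graph
(`mem_cls_toNamed`, `eq_of_name_eq`, `mem_pairs_toNamed`). New names exceed all values of `δ`. Hence
at every node the class of a label contains at most the one name `δ l`, or consists of names that
occur under no other label (`name_spec`, `label_unique`), and any two classes that are united or
joined are disjoint or equal singletons (`good_toNamed`).

With repeated names an edge can be created by several joins, and adding up the contributions of all
joins would count it too often. Therefore the instructions are read backwards, and a join is deleted
if all its edges are also created later. This is exact because a join is either entirely redundant
or entirely new: whether a pair of names is joined later depends only on the labels that the two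
names have at the current node (`allOrNone_toNamed`). After the deletion every edge is counted once,
at the last join that creates it (`value_prune`).

A partial solution stores, for every label, one name of the class and the numbers of its members on
the two sides, together with the number of cut edges. A join adds products of these numbers. A union
or a relabel adds the numbers, except when the stored names show that both classes are the same
singleton; then the sides have to agree (`mergeEntry`, `mem_table`). At the root every name has only
one label, so that a partial solution is a cut (`codeMaxCut_spec`).

For `n ≥ 2` vertices there are polynomially many entries per label, hence `n ^ O(k)` partial
solutions. The running time is obtained from closure properties of `PolyTime`, in which time is
polynomial in a measure that may exceed the size of the representation. The measure of an instance
contains `n ^ k`, which pays for the enumeration of the partial solutions (`polyTime_solve`);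
everything else is polynomial in the input. -/

/-! ## Sizes, encodings and polynomial bounds -/

/-- The number of pairs in a binary tree. -/
def Data.size : Data → ℕ
  | .nil => 0
  | .cons a b => a.size + b.size + 1

@[simp] theorem Data.size_ofNat (n : ℕ) : (Data.ofNat n).size = n := by
  induction n with
  | zero => rfl
  | succ n ih => simp [Data.ofNat, Data.size, ih]

/-- A type whose elements are represented by binary trees, together with a measure of the elements
in which running times are expressed. -/
class Enc (α : Type) where
  enc : α → Data
  meas : α → ℕ
  size_le : ∀ a, (enc a).size ≤ meas a

open Enc

section Instances

variable {α β : Type} [Enc α] [Enc β]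

instance : Enc Data := ⟨id, Data.size, fun _ => le_rfl⟩

instance : Enc ℕ := ⟨Data.ofNat, id, fun n => by simp⟩

instance : Enc Bool :=
  ⟨fun b => bif b then .cons .nil .nil else .nil, fun _ => 1, by rintro (_ | _) <;> simp [Data.size]⟩

instance : Enc (α × β) :=
  ⟨fun p => .cons (enc p.1) (enc p.2), fun p => meas p.1 + meas p.2 + 1, fun p => by
    have := size_le p.1
    have := size_le p.2
    simp only [Data.size]
    omega⟩

/-- Lists as right combs. -/
def encList : List α → Data
  | [] => .nil
  | a :: l => .cons (enc a) (encList l)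

/-- The measure of a list. -/
def measList : List α → ℕ
  | [] => 0
  | a :: l => meas a + measList l + 1

instance : Enc (List α) :=
  ⟨encList, measList, fun l => by
    induction l with
    | nil => simp [encList, measList, Data.size]
    | cons a l ih =>
      have := size_le a
      simp only [Data.size, encList, measList]
      omega⟩

@[simp] theorem enc_data (d : Data) : enc d = d := rfl
@[simp] theorem meas_data (d : Data) : meas d = d.size := rfl
@[simp] theorem enc_nat (n : ℕ) : enc n = Data.ofNat n := rfl
@[simp] theorem meas_nat (n : ℕ) : meas n = n := rfl
@[simp] theorem enc_true : enc true = Data.cons .nil .nil := rfl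
@[simp] theorem enc_false : enc false = Data.nil := rfl
@[simp] theorem meas_bool (b : Bool) : meas b = 1 := rfl
@[simp] theorem enc_pair (a : α) (b : β) : enc (a, b) = Data.cons (enc a) (enc b) := rfl
@[simp] theorem meas_pair (a : α) (b : β) : meas (a, b) = meas a + meas b + 1 := rfl
@[simp] theorem enc_nil : enc ([] : List α) = Data.nil := rfl
@[simp] theorem meas_nil : meas ([] : List α) = 0 := rfl
@[simp] theorem enc_cons (a : α) (l : List α) : enc (a :: l) = Data.cons (enc a) (enc l) := rfl
@[simp] theorem meas_cons (a : α) (l : List α) : meas (a :: l) = meas a + meas l + 1 := rfl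

theorem meas_fst_le (p : α × β) : meas p.1 ≤ meas p := by
  obtain ⟨a, b⟩ := p
  simp only [meas_pair]; omega

theorem meas_snd_le (p : α × β) : meas p.2 ≤ meas p := by
  obtain ⟨a, b⟩ := p
  simp only [meas_pair]; omega

theorem length_le_meas (l : List α) : l.length ≤ meas l := by
  induction l with
  | nil => simp
  | cons a l ih => simp only [List.length_cons, meas_cons]; omega

theorem meas_lt_of_mem {a : α} {l : List α} (h : a ∈ l) : meas a < meas l := by
  induction l with
  | nil => simp at h
  | cons b l ih =>
    rcases List.mem_cons.1 h with rfl | h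
    · simp only [meas_cons]; omega
    · have := ih h
      simp only [meas_cons]; omega

theorem meas_append (l m : List α) : meas (l ++ m) = meas l + meas m := by
  induction l with
  | nil => simp
  | cons a l ih => simp only [List.cons_append, meas_cons, ih]; omega

theorem meas_list_le {l : List α} {B : ℕ} (h : ∀ a ∈ l, meas a ≤ B) :
    meas l ≤ l.length * (B + 1) := by
  induction l with
  | nil => simp
  | cons a l ih =>
    have h1 := h a (by simp)
    have h2 := ih fun b hb => h b (by simp [hb])
    simp only [meas_cons, List.length_cons]
    linarith

theorem meas_sublist {l m : List α} (h : l.Sublist m) : meas l ≤ meas m := by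
  induction h with
  | slnil => simp
  | cons a _ ih => simp only [meas_cons]; omega
  | cons_cons a _ ih => simp only [meas_cons]; omega

end Instances

section PolyBound

variable {α β : Type} [Enc α] [Enc β]

/-- `f` is bounded by a polynomial in the measure of its argument. -/
def PolyBound (f : α → ℕ) : Prop := ∃ c, ∀ a, f a ≤ (meas a + 2) ^ c

theorem PolyBound.mono {f g : α → ℕ} (hg : PolyBound g) (h : ∀ a, f a ≤ g a) : PolyBound f := by
  obtain ⟨c, hc⟩ := hg
  exact ⟨c, fun a => (h a).trans (hc a)⟩

theorem PolyBound.meas : PolyBound (fun a : α => meas a) := ⟨1, fun a => by simp⟩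

/-- The base `meas a + 2` is at least `2`, and `n ≤ 2 ^ n`. The same base makes separate
coefficients unnecessary: one more factor absorbs the factor `2` of a sum. -/
theorem PolyBound.const (n : ℕ) : PolyBound (fun _ : α => n) :=
  ⟨n, fun a => (Nat.lt_two_pow_self).le.trans (Nat.pow_le_pow_left (by omega) n)⟩

theorem PolyBound.mul {f g : α → ℕ} (hf : PolyBound f) (hg : PolyBound g) :
    PolyBound (fun a => f a * g a) := by
  obtain ⟨c, hc⟩ := hf
  obtain ⟨d, hd⟩ := hg
  exact ⟨c + d, fun a => (Nat.mul_le_mul (hc a) (hd a)).trans (pow_add _ _ _).ge⟩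

theorem PolyBound.add {f g : α → ℕ} (hf : PolyBound f) (hg : PolyBound g) :
    PolyBound (fun a => f a + g a) := by
  obtain ⟨c, hc⟩ := hf
  obtain ⟨d, hd⟩ := hg
  refine ⟨c + d + 1, fun a => ?_⟩
  have h1 : (Enc.meas a + 2) ^ c ≤ (Enc.meas a + 2) ^ (c + d) :=
    Nat.pow_le_pow_right (by omega) (by omega)
  have h2 : (Enc.meas a + 2) ^ d ≤ (Enc.meas a + 2) ^ (c + d) :=
    Nat.pow_le_pow_right (by omega) (by omega)
  have h3 := hc a
  have h4 := hd a
  have h5 : (Enc.meas a + 2) ^ (c + d) * 2 ≤ (Enc.meas a + 2) ^ (c + d) * (Enc.meas a + 2) :=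
    Nat.mul_le_mul_left _ (by omega)
  rw [pow_succ]
  show f a + g a ≤ _
  omega

theorem PolyBound.pow {f : α → ℕ} (hf : PolyBound f) (n : ℕ) : PolyBound (fun a => f a ^ n) := by
  obtain ⟨c, hc⟩ := hf
  exact ⟨c * n, fun a => (Nat.pow_le_pow_left (hc a) n).trans (pow_mul _ _ _).ge⟩

theorem PolyBound.comp {g : β → ℕ} {f : α → β} (hg : PolyBound g)
    (hf : PolyBound fun a => Enc.meas (f a)) : PolyBound (fun a => g (f a)) := by
  obtain ⟨c, hc⟩ := hg
  exact ((hf.add (.const 2)).pow c).mono fun a => hc (f a)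

end PolyBound

/-! ## Polynomial-time functions -/

namespace While

/-- Started with `x` in variable `0`, the program halts within `T` steps with `y` in variable `0`;
it leaves variable `1`, which serves as a stack, unchanged. -/
def Does (P : Program) (x y : Data) (T : ℕ) : Prop :=
  ∀ s : Store, s 0 = x → ∃ t ≤ T, ∃ s', Exec P s t s' ∧ s' 0 = y ∧ s' 1 = s 1

theorem Does.mono {P : Program} {x y : Data} {T T' : ℕ} (h : Does P x y T) (hT : T ≤ T') :
    Does P x y T' := fun s hs =>
  let ⟨t, ht, h⟩ := h s hs
  ⟨t, ht.trans hT, h⟩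

theorem Does.seq {P Q : Program} {x y z : Data} {T T' : ℕ} (h : Does P x y T)
    (h' : Does Q y z T') : Does (.seq P Q) x z (T + T') := by
  intro s hs
  obtain ⟨t, ht, s', e, h0, h1⟩ := h s hs
  obtain ⟨t', ht', s'', e', h0', h1'⟩ := h' s' h0
  exact ⟨t + t', by omega, s'', e.seq e', h0', h1'.trans h1⟩

theorem does_assign (e : Expr) (x y : Data) (h : ∀ s : Store, s 0 = x → e.eval s = y) :
    Does (.assign 0 e) x y (e.cost + 1) := fun s hs =>
  ⟨_, le_rfl, _, .assign 0 e s, by simp [h s hs], by simp⟩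

/-- Run two programs on the same input and pair their outputs. -/
def pairProgram (P Q : Program) : Program :=
  .seq (.assign 1 (.cons (.var 0) (.var 1))) <| .seq P <|
  .seq (.assign 1 (.cons (.var 0) (.var 1))) <|
  .seq (.assign 0 (.hd (.tl (.var 1)))) <| .seq Q <|
  .seq (.assign 0 (.cons (.hd (.var 1)) (.var 0))) (.assign 1 (.tl (.tl (.var 1))))

/-- The input survives the run of `P` because `Does` preserves the stack in variable `1`; the output
of `P` survives the run of `Q` in the same way. The constant `21` is the cost of the five
assignments. -/
theorem Does.pair {P Q : Program} {x y z : Data} {T T' : ℕ} (h : Does P x y T)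
    (h' : Does Q x z T') : Does (pairProgram P Q) x (.cons y z) (T + T' + 21) := by
  intro s hs
  obtain ⟨t, ht, s1, e1, h10, h11⟩ :=
    h (Function.update s 1 (.cons (s 0) (s 1))) (by simpa using hs)
  obtain ⟨t', ht', s2, e2, h20, h21⟩ :=
    h' (Function.update (Function.update s1 1 (.cons (s1 0) (s1 1))) 0 x) (by simp)
  have h11' : s1 1 = .cons x (s 1) := by simpa [hs] using h11
  have h21' : s2 1 = .cons y (.cons x (s 1)) := by simpa [h10, h11'] using h21
  refine ⟨_, ?_, _, (Exec.assign 1 _ s).seq (e1.seq ((Exec.assign 1 _ s1).seq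
    ((Exec.assign 0 _ _).seq (Exec.seq (s' := s2) (t := t') ?_
      ((Exec.assign 0 _ _).seq (Exec.assign 1 _ _)))))), ?_, ?_⟩
  · simp only [Expr.cost]; omega
  · simpa [Expr.eval, h11', Data.tl, Data.hd] using e2
  · simp [Expr.eval, h21', h20, Data.hd]
  · simp [Expr.eval, h21', Data.tl]

/-- Run a test on the input and then one of two programs on the same input. -/
def iteProgram (C P Q : Program) : Program :=
  .seq (.assign 1 (.cons (.var 0) (.var 1))) <| .seq C <|
  .seq (.assign 2 (.var 0)) <| .seq (.assign 0 (.hd (.var 1))) <|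
  .seq (.assign 1 (.tl (.var 1))) <| .ite (.var 2) P Q

/-- The result of the test is kept in variable `2` while the input and the stack are restored. That
variable needs no protection, since it is read before any other program runs. -/
theorem Does.ite {C P Q : Program} {x c y : Data} {Tc T : ℕ} (hc : Does C x c Tc)
    (hP : c ≠ .nil → Does P x y T) (hQ : c = .nil → Does Q x y T) :
    Does (iteProgram C P Q) x y (Tc + T + 14) := by
  intro s hs
  obtain ⟨t, ht, s1, e1, h10, h11⟩ :=
    hc (Function.update s 1 (.cons (s 0) (s 1))) (by simpa using hs)
  have h11' : s1 1 = .cons x (s 1) := by simpa [hs] using h11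
  set s2 : Store := Function.update (Function.update (Function.update s1 2 c) 0 x) 1 (s 1) with hs2
  have e2 : ∀ {t' s'}, Exec (.ite (.var 2) P Q) s2 t' s' →
      Exec (iteProgram C P Q) s (4 + (t + (2 + (3 + (3 + t'))))) s' := by
    intro t' s' h
    refine (Exec.assign 1 _ s).seq (e1.seq ((Exec.assign 2 _ s1).seq
      ((Exec.assign 0 _ _).seq (Exec.seq (Exec.assign 1 _ _) ?_))))
    simpa [Expr.eval, h11', h10, Data.tl, Data.hd, ← hs2] using h
  have h20 : s2 0 = x := by simp [hs2]
  have h22 : (Expr.var 2).eval s2 = c := by simp [hs2, Expr.eval]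
  have h21 : s2 1 = s 1 := by simp [hs2]
  by_cases hcn : c = .nil
  · obtain ⟨t', ht', s', e, h0, h1⟩ := hQ hcn s2 h20
    refine ⟨_, ?_, s', e2 (.ite_false (h22.trans hcn) e), h0, h1.trans h21⟩
    simp only [Expr.cost]; omega
  · obtain ⟨t', ht', s', e, h0, h1⟩ := hP hcn s2 h20
    refine ⟨_, ?_, s', e2 (.ite_true (by rwa [h22]) e), h0, h1.trans h21⟩
    simp only [Expr.cost]; omega

/-- The loop tests the head of variable `0`, which will be the work list in a pair of a work list
and further data. There are `N + 1` tests of cost `3` each. -/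
theorem does_loop {P : Program} (x : ℕ → Data) {T N : ℕ}
    (hP : ∀ i < N, (x i).hd ≠ .nil ∧ Does P (x i) (x (i + 1)) T) (hN : (x N).hd = .nil) :
    Does (.loop (.hd (.var 0)) P) (x 0) (x N) (N * (T + 3) + 3) := by
  induction N generalizing x with
  | zero =>
    intro s hs
    exact ⟨3, by omega, s, .loop_done (by simpa [Expr.eval, hs] using hN), hs, rfl⟩
  | succ N ih =>
    intro s hs
    obtain ⟨hne, hd⟩ := hP 0 (by omega)
    obtain ⟨t, ht, s1, e1, h0, h1⟩ := hd s hs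
    obtain ⟨t', ht', s2, e2, h0', h1'⟩ :=
      ih (fun i => x (i + 1)) (fun i hi => hP (i + 1) (by omega)) hN s1 h0
    refine ⟨_, ?_, s2, .loop_step (by simpa [Expr.eval, hs] using hne) e1 e2, h0', h1'.trans h1⟩
    simp only [Expr.cost]
    linarith

end While

open While

section PolyTime

variable {α β γ δ σ τ ρ : Type} [Enc α] [Enc β] [Enc γ] [Enc δ] [Enc σ] [Enc τ] [Enc ρ]

/-- `f` is computed by a program within a number of steps that is polynomial in the measure of the
argument, and the measure of the value is polynomial as well. -/
@[fun_prop]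
def PolyTime (f : α → β) : Prop :=
  (∃ P T, PolyBound T ∧ ∀ a, Does P (enc a) (enc (f a)) (T a)) ∧ PolyBound fun a => meas (f a)

theorem PolyTime.of_expr {f : α → β} (e : Expr)
    (he : ∀ (a : α) (s : Store), s 0 = enc a → e.eval s = enc (f a))
    (hm : PolyBound fun a => meas (f a)) : PolyTime f :=
  ⟨⟨_, _, .const _, fun a => does_assign e _ _ (he a)⟩, hm⟩

@[fun_prop]
theorem PolyTime.id : PolyTime fun a : α => a := .of_expr (.var 0) (fun _ _ h => h) .meas

-- This is where the bound on the measure of the value is needed: the time for `g` is polynomial in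
-- the measure of `f a`, which the time for `f` need not control.
@[fun_prop]
theorem PolyTime.comp {g : β → γ} {f : α → β} (hg : PolyTime g) (hf : PolyTime f) : PolyTime fun a => g (f a) := by
  obtain ⟨⟨P, T, hT, hP⟩, hm⟩ := hf
  obtain ⟨⟨Q, T', hT', hQ⟩, hm'⟩ := hg
  exact ⟨⟨_, _, hT.add (hT'.comp hm), fun a => (hP a).seq (hQ (f a))⟩, hm'.comp hm⟩

/-- The expression whose value is `d`. -/
def While.Expr.ofData : Data → Expr
  | .nil => .nil
  | .cons a b => .cons (ofData a) (ofData b)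

theorem While.Expr.eval_ofData (d : Data) (s : Store) : (Expr.ofData d).eval s = d := by
  induction d with
  | nil => rfl
  | cons a b iha ihb => simp [Expr.ofData, Expr.eval, iha, ihb]

@[fun_prop]
theorem PolyTime.const (b : β) : PolyTime fun _ : α => b :=
  .of_expr (.ofData (enc b)) (fun _ _ _ => Expr.eval_ofData _ _) (.const _)

@[fun_prop]
theorem PolyTime.pair {f : α → β} {g : α → γ} (hf : PolyTime f) (hg : PolyTime g) :
    PolyTime fun a => (f a, g a) := by
  obtain ⟨⟨P, T, hT, hP⟩, hm⟩ := hf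
  obtain ⟨⟨Q, T', hT', hQ⟩, hm'⟩ := hg
  exact ⟨⟨_, _, (hT.add hT').add (.const 21), fun a => (hP a).pair (hQ a)⟩,
    (hm.add hm').add (.const 1)⟩

@[fun_prop]
theorem PolyTime.fst {f : α → β × γ} (hf : PolyTime f) : PolyTime fun a => (f a).1 :=
  (PolyTime.of_expr (f := fun p : β × γ => p.1) (.hd (.var 0))
    (fun a s h => by simp [Expr.eval, h, enc, Data.hd])
    (PolyBound.meas.mono meas_fst_le)).comp hf

@[fun_prop]
theorem PolyTime.snd {f : α → β × γ} (hf : PolyTime f) : PolyTime fun a => (f a).2 :=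
  (PolyTime.of_expr (f := fun p : β × γ => p.2) (.tl (.var 0))
    (fun a s h => by simp [Expr.eval, h, enc, Data.tl])
    (PolyBound.meas.mono meas_snd_le)).comp hf

@[fun_prop]
theorem PolyTime.cond {c : α → Bool} {f g : α → β} (hc : PolyTime c) (hf : PolyTime f) (hg : PolyTime g) :
    PolyTime fun a => bif c a then f a else g a := by
  obtain ⟨⟨C, Tc, hTc, hC⟩, -⟩ := hc
  obtain ⟨⟨P, T, hT, hP⟩, hm⟩ := hf
  obtain ⟨⟨Q, T', hT', hQ⟩, hm'⟩ := hg
  refine ⟨⟨_, _, (hTc.add (hT.add hT')).add (.const 14), fun a => (hC a).ite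
    (P := P) (Q := Q) (T := T a + T' a) (fun h => ?_) (fun h => ?_)⟩, (hm.add hm').mono fun a => ?_⟩
  · cases hca : c a
    · simp [hca] at h
    · simpa [hca] using (hP a).mono (Nat.le_add_right (T a) (T' a))
  · cases hca : c a
    · simpa [hca] using (hQ a).mono (Nat.le_add_left (T' a) (T a))
    · simp [hca] at h
  · show meas (bif c a then f a else g a) ≤ meas (f a) + meas (g a)
    cases c a <;> simp

theorem PolyTime.of_eq {f g : α → β} (hf : PolyTime f) (h : ∀ a, f a = g a) : PolyTime g :=
  (funext h : f = g) ▸ hf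

/-! ### Lists, numbers and trees -/

@[fun_prop]
theorem PolyTime.listCons {f : α → β} {g : α → List β} (hf : PolyTime f) (hg : PolyTime g) :
    PolyTime fun a => f a :: g a :=
  (PolyTime.of_expr (f := fun p : β × List β => p.1 :: p.2) (.var 0)
    (fun a s h => by simp [Expr.eval, h, enc, encList])
    (PolyBound.meas.mono fun p => by obtain ⟨a, l⟩ := p; simp)).comp (hf.pair hg)

theorem PolyTime.encode : PolyTime fun a : α => enc a :=
  .of_expr (.var 0) (fun _ _ h => h) (PolyBound.meas.mono size_le)

/-- Is the tree `nil`? -/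
def Data.isNil : Data → Bool
  | .nil => true
  | .cons _ _ => false

@[fun_prop]
theorem PolyTime.isNil {f : α → Data} (hf : PolyTime f) : PolyTime fun a => (f a).isNil := by
  refine PolyTime.comp (g := Data.isNil) ⟨⟨iteProgram (.assign 0 (.var 0)) (.assign 0 .nil)
    (.assign 0 (.cons .nil .nil)), fun _ => 2 + 4 + 14, .const _, fun d => ?_⟩, .const 1⟩ hf
  refine (does_assign (.var 0) _ (enc d) (by simp [Expr.eval])).ite (fun h => ?_) (fun h => ?_)
  · refine (does_assign .nil _ _ fun s _ => ?_).mono (by simp [Expr.cost])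
    cases d
    · simp at h
    · simp [Expr.eval, Data.isNil]
  · refine (does_assign _ _ _ fun s _ => ?_).mono (by simp [Expr.cost])
    cases d
    · simp [Expr.eval, Data.isNil]
    · simp at h

@[fun_prop]
theorem PolyTime.dataHd {f : α → Data} (hf : PolyTime f) : PolyTime fun a => (f a).hd :=
  (PolyTime.of_expr (f := Data.hd) (.hd (.var 0)) (fun a s h => by simp [Expr.eval, h])
    (PolyBound.meas.mono fun d => by cases d <;> simp [Data.hd, Data.size]; omega)).comp hf

@[fun_prop]
theorem PolyTime.dataTl {f : α → Data} (hf : PolyTime f) : PolyTime fun a => (f a).tl :=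
  (PolyTime.of_expr (f := Data.tl) (.tl (.var 0)) (fun a s h => by simp [Expr.eval, h])
    (PolyBound.meas.mono fun d => by cases d <;> simp [Data.tl, Data.size]; omega)).comp hf

@[fun_prop]
theorem PolyTime.isEmpty {f : α → List β} (hf : PolyTime f) : PolyTime fun a => (f a).isEmpty := by
  refine ((PolyTime.isNil PolyTime.encode).comp hf).of_eq fun a => ?_
  cases f a <;> rfl

@[fun_prop]
theorem PolyTime.tail {f : α → List β} (hf : PolyTime f) : PolyTime fun a => (f a).tail :=
  (PolyTime.of_expr (f := fun l : List β => l.tail) (.tl (.var 0))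
    (fun a s h => by cases a <;> simp [Expr.eval, h, Data.tl])
    (PolyBound.meas.mono fun l => by cases l <;> simp; omega)).comp hf

@[fun_prop]
theorem PolyTime.headList {f : α → List (List β)} (hf : PolyTime f) :
    PolyTime fun a => (f a).headD [] :=
  (PolyTime.of_expr (f := fun l : List (List β) => l.headD []) (.hd (.var 0))
    (fun a s h => by cases a <;> simp [Expr.eval, h, Data.hd])
    (PolyBound.meas.mono fun l => by cases l <;> simp; omega)).comp hf

@[fun_prop]
theorem PolyTime.succ {f : α → ℕ} (hf : PolyTime f) : PolyTime fun a => f a + 1 :=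
  (PolyTime.of_expr (f := fun n : ℕ => n + 1) (.cons .nil (.var 0))
    (fun a s h => by simp [Expr.eval, h, Data.ofNat])
    (PolyBound.meas.add (.const 1))).comp hf

/-- A tree as the list of the trees that hang off its right spine. -/
def Data.toList : Data → List Data
  | .nil => []
  | .cons a b => a :: b.toList

theorem Data.enc_toList (d : Data) : enc d.toList = d := by
  induction d with
  | nil => rfl
  | cons a b _ ih => simp [Data.toList, ih]

theorem Data.meas_toList (d : Data) : meas d.toList = d.size := by
  induction d with
  | nil => rfl
  | cons a b _ ih => simp [Data.toList, ih, Data.size]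

@[fun_prop]
theorem PolyTime.toList {f : α → Data} (hf : PolyTime f) : PolyTime fun a => (f a).toList :=
  (PolyTime.of_expr (f := Data.toList) (.var 0) (fun d s h => by simp [Expr.eval, h, Data.enc_toList])
    (PolyBound.meas.mono fun d => by simp [Data.meas_toList])).comp hf

/-- A natural number as a list. -/
theorem PolyTime.natList {f : α → ℕ} (hf : PolyTime f) :
    PolyTime fun a => List.replicate (f a) Data.nil :=
  (PolyTime.of_expr (f := fun n : ℕ => List.replicate n Data.nil) (.var 0)
    (fun n s h => by
      rw [Expr.eval, h]
      clear h
      induction n with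
      | zero => rfl
      | succ n ih => rw [List.replicate_succ, enc_cons, ← ih]; rfl)
    (PolyBound.meas.mono fun n => by
      induction n with
      | zero => simp
      | succ n ih => simp only [List.replicate_succ, meas_cons, meas_nat] at *; simp [Data.size]; omega)).comp hf

/-! ### Loops -/

/-- One round of processing a work list: the step function gets the first item, the other items and
the rest of the state. -/
def workStep {τ ρ : Type} (b : τ × List τ × ρ → List τ × ρ) : List τ × ρ → List τ × ρ
  | ([], r) => ([], r)
  | (x :: l, r) => b (x, l, r)

theorem workStep_iterate_nil {τ ρ : Type} (b : τ × List τ × ρ → List τ × ρ) (r : ρ) (n : ℕ) :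
    (workStep b)^[n] ([], r) = ([], r) := Function.iterate_fixed rfl n

/-- The program stops at the first empty work list, whereas the statement speaks of exactly `N a`
rounds. Both give the same state, because `workStep` fixes every state with an empty list. The bound
`B` on all states on the way bounds the time of each round. -/
theorem PolyTime.work {b : τ × List τ × ρ → List τ × ρ} (hb : PolyTime b) {start : α → List τ × ρ}
    (hi : PolyTime start) {N B : α → ℕ} (hN : PolyBound N)
    (hend : ∀ a, ((workStep b)^[N a] (start a)).1 = []) (hB : PolyBound B)
    (hs : ∀ a, ∀ j ≤ N a, meas ((workStep b)^[j] (start a)) ≤ B a) :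
    PolyTime fun a => ((workStep b)^[N a] (start a)).2 := by
  classical
  obtain ⟨⟨P, T, ⟨c, hT⟩, hP⟩, -⟩ := hb
  suffices h : PolyTime fun a => (workStep b)^[N a] (start a) from h.snd
  refine ⟨?_, hB.mono fun a => hs a _ le_rfl⟩
  -- Rearranges the tree for `(x :: l, r)` into the tree for `(x, l, r)`, the form of argument that
  -- `b` takes; the cost is `11`.
  let R : Program := .assign 0 (.cons (.hd (.hd (.var 0))) (.cons (.tl (.hd (.var 0))) (.tl (.var 0))))
  obtain ⟨⟨Q, T', hT', hQ⟩, -⟩ := hi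
  refine ⟨.seq Q (.loop (.hd (.var 0)) (.seq R P)), fun a => T' a + (N a * ((11 + (B a + 2) ^ c) + 3) + 3),
    ?_, fun a => (hQ a).seq ?_⟩
  · exact hT'.add ((hN.mul (((PolyBound.const 11).add ((hB.add (.const 2)).pow c)).add
      (.const 3))).add (.const 3))
  -- `M` is the true number of rounds of the loop.
  · let M := Nat.find (⟨N a, hend a⟩ : ∃ m, ((workStep b)^[m] (start a)).1 = [])
    have hMN : M ≤ N a := Nat.find_min' _ (hend a)
    have hM : ((workStep b)^[M] (start a)).1 = [] :=
      Nat.find_spec (⟨N a, hend a⟩ : ∃ m, ((workStep b)^[m] (start a)).1 = [])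
    have hMM : (workStep b)^[N a] (start a) = (workStep b)^[M] (start a) := by
      obtain ⟨d, hd⟩ := Nat.exists_eq_add_of_le' hMN
      rw [hd, Function.iterate_add_apply, show (workStep b)^[M] (start a) =
        ([], ((workStep b)^[M] (start a)).2) from Prod.ext hM rfl, workStep_iterate_nil]
    show Does _ _ (enc ((workStep b)^[N a] (start a))) _
    rw [hMM]
    refine (does_loop (fun j => enc ((workStep b)^[j] (start a))) (T := 11 + (B a + 2) ^ c)
      (N := M) (fun j hj => ?_) ?_).mono ?_
    · have hne : ((workStep b)^[j] (start a)).1 ≠ [] := 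
        Nat.find_min (⟨N a, hend a⟩ : ∃ m, ((workStep b)^[m] (start a)).1 = []) hj
      have hm := hs a j (by omega)
      rw [Function.iterate_succ_apply']
      generalize (workStep b)^[j] (start a) = p at *
      obtain ⟨_ | ⟨x, l⟩, r⟩ := p
      · simp at hne
      · refine ⟨by simp [Data.hd], ?_⟩
        refine Does.seq (y := enc (x, l, r)) (does_assign _ _ _ fun s hs => ?_) ((hP (x, l, r)).mono ?_)
        · simp [Expr.eval, hs, Data.hd, Data.tl]
        · refine (hT _).trans (Nat.pow_le_pow_left ?_ c)
          simp only [meas_pair, meas_cons] at hm ⊢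
          omega
    · generalize (workStep b)^[M] (start a) = p at *
      obtain ⟨l, r⟩ := p
      obtain rfl : l = [] := hM
      rfl
    · gcongr

/-- A fold is a work list to which nothing is ever added. The parameter `a` travels along unchanged,
and the remainder `m` lets the lemma describe the intermediate states too. -/
theorem workStep_foldl {α β σ : Type} (f : α → σ → β → σ) (a : α) (s : σ) (l m : List β) :
    (workStep fun p : β × List β × α × σ => (p.2.1, p.2.2.1, f p.2.2.1 p.2.2.2 p.1))^[l.length]
      (l ++ m, a, s) = (m, a, l.foldl (f a) s) := by
  induction l generalizing s with
  | nil => rfl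
  | cons x l ih => simp only [List.length_cons, Function.iterate_succ_apply, List.cons_append,
      workStep, ih, List.foldl_cons]

/-- The intermediate states of the loop are the folds over prefixes of the list, so it suffices to
bound those. -/
theorem PolyTime.foldl_of_bound {f : α → σ → β → σ}
    (hf : PolyTime fun p : α × σ × β => f p.1 p.2.1 p.2.2) {i : α → σ} (hi : PolyTime i)
    {l : α → List β} (hl : PolyTime l) {B : α → ℕ} (hB : PolyBound B)
    (h : ∀ a l₁ l₂, l a = l₁ ++ l₂ → meas (l₁.foldl (f a) (i a)) ≤ B a) :
    PolyTime fun a => (l a).foldl (f a) (i a) := by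
  have hb : PolyTime fun p : β × List β × α × σ => (p.2.1, p.2.2.1, f p.2.2.1 p.2.2.2 p.1) :=
    .pair (by fun_prop) (.pair (by fun_prop)
      (hf.comp (f := fun p : β × List β × α × σ => (p.2.2.1, p.2.2.2, p.1)) (by fun_prop)))
  have hit : ∀ a, ∀ j ≤ (l a).length, (workStep fun p : β × List β × α × σ =>
      (p.2.1, p.2.2.1, f p.2.2.1 p.2.2.2 p.1))^[j] (l a, a, i a) =
        ((l a).drop j, a, ((l a).take j).foldl (f a) (i a)) := by
    intro a j hj
    have := workStep_foldl f a (i a) ((l a).take j) ((l a).drop j)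
    rwa [List.take_append_drop, List.length_take, min_eq_left hj] at this
  have := PolyTime.work hb (start := fun a => (l a, a, i a)) (.pair hl (.pair .id hi))
    (N := fun a => (l a).length) (B := fun a => meas (l a) + (meas a + B a + 1) + 1)
    (hl.2.mono fun a => length_le_meas _)
    (fun a => by rw [hit a _ le_rfl]; simp)
    ((hl.2.add ((PolyBound.meas.add hB).add (.const 1))).add (.const 1)) ?_
  · refine (this.snd).of_eq fun a => ?_
    rw [hit a _ le_rfl]; simp
  · intro a j hj
    rw [hit a j hj]
    have h1 := h a ((l a).take j) ((l a).drop j) (by simp)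
    have h2 := meas_sublist (List.drop_sublist j (l a))
    simp only [meas_pair]
    omega

/-- A fold whose state grows by a polynomial amount in every step. -/
theorem PolyTime.foldl {f : α → σ → β → σ}
    (hf : PolyTime fun p : α × σ × β => f p.1 p.2.1 p.2.2) {i : α → σ} (hi : PolyTime i)
    {l : α → List β} (hl : PolyTime l) {g : α × β → ℕ} (hg : PolyBound g)
    (h : ∀ a s b, meas (f a s b) ≤ meas s + g (a, b)) :
    PolyTime fun a => (l a).foldl (f a) (i a) := by
  obtain ⟨c, hc⟩ := hg
  refine PolyTime.foldl_of_bound hf hi hl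
    (B := fun a => meas (i a) + meas (l a) * (meas a + meas (l a) + 3) ^ c) ?_ ?_
  · exact hi.2.add (hl.2.mul (((PolyBound.meas.add hl.2).add (.const 3)).pow c))
  · intro a l₁ l₂ hl'
    have key : ∀ m : List β, (∀ b ∈ m, meas b ≤ meas (l a)) → ∀ s : σ,
        meas (m.foldl (f a) s) ≤ meas s + m.length * (meas a + meas (l a) + 3) ^ c := by
      intro m
      induction m with
      | nil => simp
      | cons x m ih =>
        intro hm s
        have h1 := ih (fun b hb => hm b (by simp [hb])) (f a s x)
        have h2 := h a s x
        have h3 : g (a, x) ≤ (meas a + meas (l a) + 3) ^ c :=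
          (hc _).trans (Nat.pow_le_pow_left (by simp only [meas_pair]; have := hm x (by simp); omega) c)
        rw [List.foldl_cons, List.length_cons]
        linarith
    refine (key l₁ (fun b hb => (meas_lt_of_mem (by simp [hl', hb])).le) _).trans ?_
    gcongr
    refine (length_le_meas l₁).trans ?_
    rw [hl', meas_append]; omega

end PolyTime

/-! ### Polynomial-time list operations and arithmetic -/

section Library

variable {α β γ : Type} [Enc α] [Enc β] [Enc γ]

@[fun_prop]
theorem PolyTime.not {f : α → Bool} (hf : PolyTime f) : PolyTime fun a => !f a :=
  (hf.cond (.const false) (.const true)).of_eq fun a => by cases f a <;> rfl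

@[fun_prop]
theorem PolyTime.and {f g : α → Bool} (hf : PolyTime f) (hg : PolyTime g) :
    PolyTime fun a => f a && g a :=
  (hf.cond hg (.const false)).of_eq fun a => by cases f a <;> rfl

@[fun_prop]
theorem PolyTime.or {f g : α → Bool} (hf : PolyTime f) (hg : PolyTime g) :
    PolyTime fun a => f a || g a :=
  (hf.cond (.const true) hg).of_eq fun a => by cases f a <;> rfl

@[fun_prop]
theorem PolyTime.length {f : α → List β} (hf : PolyTime f) : PolyTime fun a => (f a).length := by
  refine (PolyTime.foldl (f := fun _ n _ => n + 1) (i := fun _ => 0) (by fun_prop) (by fun_prop) hf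
    (.const 1) (by simp)).of_eq fun a => ?_
  generalize f a = l
  rw [← zero_add l.length]
  generalize 0 = n
  induction l generalizing n with
  | nil => rfl
  | cons x l ih => simp [ih]; omega

@[fun_prop]
theorem PolyTime.reverse {f : α → List β} (hf : PolyTime f) : PolyTime fun a => (f a).reverse := by
  refine (PolyTime.foldl (f := fun _ l x => x :: l) (i := fun _ => ([] : List β)) (by fun_prop)
    (by fun_prop) hf (g := fun p => meas p.2 + 1)
    ((PolyBound.meas.mono meas_snd_le).add (.const 1)) (by intros; simp; omega)).of_eq fun a => ?_
  exact List.foldl_flip_cons_eq_append.trans (by simp)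

@[fun_prop]
theorem PolyTime.append {f g : α → List β} (hf : PolyTime f) (hg : PolyTime g) :
    PolyTime fun a => f a ++ g a := by
  refine (PolyTime.foldl (f := fun _ l x => x :: l) (i := g) (by fun_prop)
    hg (PolyTime.reverse hf) (g := fun p => meas p.2 + 1)
    ((PolyBound.meas.mono meas_snd_le).add (.const 1)) (by intros; simp; omega)).of_eq fun a => ?_
  exact List.foldl_flip_cons_eq_append.trans (by simp)

@[fun_prop]
theorem PolyTime.map {f : α → β → γ} (hf : PolyTime fun p : α × β => f p.1 p.2) {l : α → List β}
    (hl : PolyTime l) : PolyTime fun a => (l a).map (f a) := by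
  refine (PolyTime.foldl (f := fun a l x => f a x :: l) (i := fun _ => ([] : List γ))
    (PolyTime.listCons (hf.comp (f := fun p : α × List γ × β => (p.1, p.2.2)) (by fun_prop))
      (by fun_prop))
    (by fun_prop) (PolyTime.reverse hl) (g := fun p => meas (f p.1 p.2) + 1)
    (hf.2.add (.const 1)) (by intros; simp; omega)).of_eq fun a => ?_
  rw [List.foldl_reverse, ← List.foldr_map (f := f a)]
  simp

@[fun_prop]
theorem PolyTime.filter {f : α → β → Bool} (hf : PolyTime fun p : α × β => f p.1 p.2)
    {l : α → List β} (hl : PolyTime l) : PolyTime fun a => (l a).filter (f a) := by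
  refine (PolyTime.foldl (f := fun a l x => bif f a x then x :: l else l)
    (i := fun _ => ([] : List β))
    (.cond (hf.comp (f := fun p : α × List β × β => (p.1, p.2.2)) (by fun_prop))
      (by fun_prop) (by fun_prop))
    (by fun_prop) (PolyTime.reverse hl) (g := fun p => meas p.2 + 1)
    ((PolyBound.meas.mono meas_snd_le).add (.const 1)) ?_).of_eq fun a => ?_
  · intro a s b
    cases f a b <;> simp; omega
  · rw [List.foldl_reverse]
    induction l a with
    | nil => rfl
    | cons x l ih =>
      rw [List.foldr_cons, ih, List.filter_cons]
      cases f a x <;> simp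

@[fun_prop]
theorem PolyTime.flatMap {f : α → β → List γ} (hf : PolyTime fun p : α × β => f p.1 p.2)
    {l : α → List β} (hl : PolyTime l) : PolyTime fun a => (l a).flatMap (f a) := by
  refine (PolyTime.foldl (f := fun a l x => f a x ++ l) (i := fun _ => ([] : List γ))
    (PolyTime.append (hf.comp (f := fun p : α × List γ × β => (p.1, p.2.2)) (by fun_prop))
      (by fun_prop))
    (by fun_prop) (PolyTime.reverse hl) (g := fun p => meas (f p.1 p.2))
    hf.2 (by intros; simp [meas_append]; omega)).of_eq fun a => ?_
  rw [List.foldl_reverse]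
  induction l a with
  | nil => rfl
  | cons x l ih => rw [List.foldr_cons, ih, List.flatMap_cons]

@[fun_prop]
theorem PolyTime.any {f : α → β → Bool} (hf : PolyTime fun p : α × β => f p.1 p.2)
    {l : α → List β} (hl : PolyTime l) : PolyTime fun a => (l a).any (f a) := by
  refine (PolyTime.not (PolyTime.isEmpty (PolyTime.filter hf hl))).of_eq fun a => ?_
  induction l a with
  | nil => rfl
  | cons x l ih =>
    rw [List.filter_cons, List.any_cons, ← ih]
    cases f a x <;> simp

@[fun_prop]
theorem PolyTime.all {f : α → β → Bool} (hf : PolyTime fun p : α × β => f p.1 p.2)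
    {l : α → List β} (hl : PolyTime l) : PolyTime fun a => (l a).all (f a) := by
  refine (PolyTime.not (PolyTime.any (f := fun a x => !f a x) (PolyTime.not hf) hl)).of_eq fun a => ?_
  rw [List.all_eq_not_any_not]

@[fun_prop]
theorem PolyTime.add {f g : α → ℕ} (hf : PolyTime f) (hg : PolyTime g) :
    PolyTime fun a => f a + g a := by
  refine (PolyTime.length (PolyTime.append (PolyTime.natList hf) (PolyTime.natList hg))).of_eq
    fun a => ?_
  simp

@[fun_prop]
theorem PolyTime.mul {f g : α → ℕ} (hf : PolyTime f) (hg : PolyTime g) :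
    PolyTime fun a => f a * g a := by
  refine (PolyTime.length (PolyTime.flatMap (f := fun a _ => List.replicate (g a) Data.nil)
    (PolyTime.natList (by fun_prop)) (PolyTime.natList hf))).of_eq fun a => ?_
  simp

theorem foldl_append_length_eq_range {β : Type} (l : List β) :
    l.foldl (fun (s : List ℕ) _ => s ++ [s.length]) [] = List.range l.length := by
  induction l using List.reverseRecOn with
  | nil => rfl
  | append_singleton l x ih =>
    rw [List.foldl_append, ih]
    simp [List.range_succ]

@[fun_prop]
theorem PolyTime.range {f : α → ℕ} (hf : PolyTime f) : PolyTime fun a => List.range (f a) := by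
  refine (PolyTime.foldl_of_bound (f := fun _ (s : List ℕ) _ => s ++ [s.length])
    (i := fun _ => []) (by fun_prop) (by fun_prop) (PolyTime.natList hf)
    (B := fun a => f a * (f a + 1)) (hf.2.mul (hf.2.add (.const 1))) ?_).of_eq fun a => ?_
  · intro a l₁ l₂ h
    have hl : l₁.length ≤ f a := by
      have := congrArg List.length h
      simp at this
      omega
    rw [foldl_append_length_eq_range]
    refine (meas_list_le (B := f a) fun n hn => ?_).trans ?_
    · have := List.mem_range.1 hn
      simp only [meas_nat]
      omega
    · rw [List.length_range]
      gcongr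
  · rw [foldl_append_length_eq_range, List.length_replicate]

theorem foldl_getD {β : Type} (l : List β) (i n : ℕ) (d : β) (h : n ≤ i) :
    (l.foldl (fun (s : ℕ × β) x => (s.1 + 1, bif s.1 == i then x else s.2)) (n, d)).2 =
      l.getD (i - n) d := by
  -- The second component of the accumulator is arbitrary in the induction: once the counter has
  -- passed `i`, it holds the value found and no longer changes.
  suffices H : ∀ d' : β, (i < n → (l.foldl (fun (s : ℕ × β) x =>
      (s.1 + 1, bif s.1 == i then x else s.2)) (n, d')).2 = d') ∧
      (n ≤ i → (l.foldl (fun (s : ℕ × β) x =>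
      (s.1 + 1, bif s.1 == i then x else s.2)) (n, d')).2 = l.getD (i - n) d') from (H d).2 h
  clear h
  induction l generalizing n with
  | nil => simp
  | cons x l ih =>
    intro d'
    refine ⟨fun h => ?_, fun h => ?_⟩
    · have : (n == i) = false := by simp; omega
      rw [List.foldl_cons]
      simpa [this] using (ih (n + 1) d').1 (by omega)
    · rw [List.foldl_cons]
      rcases h.eq_or_lt with rfl | h'
      · simpa using (ih (n + 1) x).1 (by omega)
      · have : (n == i) = false := by simp; omega
        have e : i - n = (i - (n + 1)) + 1 := by omega
        rw [e]
        simpa [this] using (ih (n + 1) d').2 (by omega)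

/-! ### Equality -/

/-- One step of comparing the pairs of trees on a work list. -/
def eqStep (p : (Data × Data) × List (Data × Data) × Bool) : List (Data × Data) × Bool :=
  bif p.1.1.isNil then bif p.1.2.isNil then p.2 else ([], false)
  else bif p.1.2.isNil then ([], false)
  else ((p.1.1.hd, p.1.2.hd) :: (p.1.1.tl, p.1.2.tl) :: p.2.1, p.2.2)

/-- A tree with `x.size` pairs has `2 * x.size + 1` nodes, and every round consumes one node of `x`.
A mismatch empties the work list, after which further rounds do nothing; hence only an upper bound
on the number of rounds. -/
theorem eqStep_iterate [DecidableEq Data] (x y : Data) (l : List (Data × Data)) (b : Bool) :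
    ∃ N ≤ 2 * x.size + 1,
      (workStep eqStep)^[N] ((x, y) :: l, b) = if x = y then (l, b) else ([], false) := by
  induction x generalizing y l b with
  | nil => exact ⟨1, by omega, by cases y <;> simp [workStep, eqStep, Data.isNil]⟩
  | cons x₁ x₂ ih₁ ih₂ =>
    cases y with
    | nil => exact ⟨1, by omega, by simp [workStep, eqStep, Data.isNil]⟩
    | cons y₁ y₂ =>
      obtain ⟨N₁, h₁, e₁⟩ := ih₁ y₁ ((x₂, y₂) :: l) b
      obtain ⟨N₂, h₂, e₂⟩ := ih₂ y₂ l b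
      refine ⟨N₂ + (N₁ + 1), by simp only [Data.size]; omega, ?_⟩
      rw [Function.iterate_add_apply, Function.iterate_succ_apply]
      simp only [workStep, eqStep, Data.isNil, Data.hd, Data.tl, cond_false, e₁]
      by_cases h : x₁ = y₁
      · simp [h, e₂]
      · simp [h, workStep_iterate_nil]

/-- Splitting a pair of trees into two pairs removes the two roots, which pay for the additional
pair and list cell. -/
theorem meas_workStep_eqStep (s : List (Data × Data) × Bool) :
    meas (workStep eqStep s) ≤ meas s := by
  obtain ⟨_ | ⟨⟨x, y⟩, l⟩, b⟩ := s
  · simp [workStep]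
  · cases x <;> cases y <;>
      simp [workStep, eqStep, Data.isNil, Data.hd, Data.tl, Data.size] <;> omega

/-- Decides equality of trees. -/
def Data.beq (p : Data × Data) : Bool :=
  ((workStep eqStep)^[2 * p.1.size + 1] ([p], true)).2

theorem workStep_eqStep_iterate [DecidableEq Data] (p : Data × Data) :
    (workStep eqStep)^[2 * p.1.size + 1] ([p], true) = ([], decide (p.1 = p.2)) := by
  obtain ⟨N, hN, e⟩ := eqStep_iterate p.1 p.2 [] true
  obtain ⟨d, hd⟩ := Nat.exists_eq_add_of_le' hN
  rw [hd, Function.iterate_add_apply, e]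
  split_ifs with h <;> simp [workStep_iterate_nil, h]

theorem PolyTime.dataBeq : PolyTime Data.beq := by
  classical
  refine PolyTime.work (b := eqStep) (by unfold eqStep; fun_prop) (start := fun p => ([p], true))
    (by fun_prop) (N := fun p => 2 * p.1.size + 1) (B := fun p => meas p + 3) ?_ ?_ ?_ ?_
  · exact ((PolyBound.const 2).mul (PolyBound.meas.mono fun p => meas_fst_le p)).add (.const 1)
  · exact fun p => by rw [workStep_eqStep_iterate]
  · exact PolyBound.meas.add (.const 3)
  · intro p j _
    induction j with
    | zero => simp
    | succ j ih =>
      rw [Function.iterate_succ_apply']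
      exact (meas_workStep_eqStep _).trans (ih (by omega))

/-- Types whose elements are determined by their representations. -/
class EncInj (α : Type) [Enc α] : Prop where
  inj : Function.Injective (enc : α → Data)

instance : EncInj ℕ := ⟨fun m => by
  induction m with
  | zero => intro n h; cases n <;> simp [Data.ofNat] at h ⊢
  | succ m ih =>
    intro n h
    cases n with
    | zero => simp [Data.ofNat] at h
    | succ n => simpa using ih (by simpa [Data.ofNat] using h)⟩

instance [EncInj α] [EncInj β] : EncInj (α × β) := ⟨by
  rintro ⟨a, b⟩ ⟨c, d⟩ h
  simp only [enc_pair, Data.cons.injEq] at h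
  rw [EncInj.inj h.1, EncInj.inj h.2]⟩

instance [EncInj α] : EncInj (List α) := ⟨fun l => by
  induction l with
  | nil => intro m h; cases m <;> simp at h ⊢
  | cons x l ih =>
    intro m h
    cases m with
    | nil => simp at h
    | cons y m =>
      simp only [enc_cons, Data.cons.injEq] at h
      rw [EncInj.inj h.1, ih h.2]⟩

@[fun_prop]
theorem PolyTime.beq [EncInj β] [BEq β] [LawfulBEq β] {f g : α → β} (hf : PolyTime f)
    (hg : PolyTime g) : PolyTime fun a => f a == g a := by
  classical
  refine (PolyTime.dataBeq.comp (f := fun a => (enc (f a), enc (g a)))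
    ((PolyTime.encode.comp hf).pair (PolyTime.encode.comp hg))).of_eq fun a => ?_
  rw [Data.beq, workStep_eqStep_iterate]
  by_cases h : f a = g a
  · simp [h]
  · simp [h, EncInj.inj.ne h]

@[fun_prop]
theorem PolyTime.getD {l : α → List β} {i : α → ℕ} {d : α → β} (hl : PolyTime l) (hi : PolyTime i)
    (hd : PolyTime d) : PolyTime fun a => (l a).getD (i a) (d a) := by
  refine (PolyTime.snd (PolyTime.foldl (f := fun a (s : ℕ × β) x =>
    (s.1 + 1, bif s.1 == i a then x else s.2)) (i := fun a => (0, d a)) (by fun_prop) (by fun_prop)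
    hl (g := fun p => meas p.2 + 1) ((PolyBound.meas.mono meas_snd_le).add (.const 1)) ?_)).of_eq
    fun a => ?_
  · rintro a ⟨n, y⟩ x
    cases n == i a <;> simp <;> omega
  · rw [foldl_getD _ _ _ _ (Nat.zero_le _), Nat.sub_zero]

end Library

/-! ## The algorithm

The expression is translated to a list of instructions in postfix order, in which vertices have
names and no fusions occur: all leaves that end up in the same vertex get the same name. -/

/-- An instruction: the number of an operation and two arguments. -/
abbrev Instr : Type := ℕ × ℕ × ℕ

/-- The value of the last binding of `i`, or `0`. -/
def look (δ : List (ℕ × ℕ)) (i : ℕ) : ℕ := δ.foldl (fun r e => bif e.1 == i then e.2 else r) 0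

/-- The numeral that a tree represents. -/
def Data.toNat (d : Data) : ℕ := d.toList.length

/-- The name bound to `i`, or the new name `p + 1` if there is none. -/
def pick (δ : List (ℕ × ℕ)) (i p : ℕ) : ℕ := bif look δ i == 0 then p + 1 else look δ i

/-- Translation of one node of the parse tree. With every pending subtree comes a list that tells
for which labels the vertices will be fused later, and what the name of the fused vertex is. -/
def parseStep (p : (Data × List (ℕ × ℕ)) × List (Data × List (ℕ × ℕ)) × List Instr) :
    List (Data × List (ℕ × ℕ)) × List Instr :=
  bif p.1.1.hd.toNat == 0 then
    (p.2.1, (0, p.1.1.tl.toNat, pick p.1.2 p.1.1.tl.toNat p.2.2.length) :: p.2.2)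
  else bif p.1.1.hd.toNat == 1 then
    ((p.1.1.tl.tl, p.1.2) :: (p.1.1.tl.hd, p.1.2) :: p.2.1, (1, 0, 0) :: p.2.2)
  else bif p.1.1.hd.toNat == 2 then
    ((p.1.1.tl.tl, p.1.2) :: p.2.1, (2, p.1.1.tl.hd.hd.toNat, p.1.1.tl.hd.tl.toNat) :: p.2.2)
  else bif p.1.1.hd.toNat == 3 then
    ((p.1.1.tl.tl, p.1.2 ++ [(p.1.1.tl.hd.hd.toNat, look p.1.2 p.1.1.tl.hd.tl.toNat)]) :: p.2.1,
      (3, p.1.1.tl.hd.hd.toNat, p.1.1.tl.hd.tl.toNat) :: p.2.2)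
  else
    ((p.1.1.tl.tl, p.1.2 ++
        [(p.1.1.tl.hd.toNat, pick p.1.2 p.1.1.tl.hd.toNat p.2.2.length)]) :: p.2.1,
      (4, 0, 0) :: p.2.2)

/-- The pairs of names, in both orders, that are connected by a join of the labels `i` and `j`, if
`l` lists the labels and names of the vertices. -/
def joinPairs (i j : ℕ) (l : List (ℕ × ℕ)) : List (ℕ × ℕ) :=
  (l.filter fun e => e.1 == i).flatMap fun e =>
    (l.filter fun f => f.1 == j).flatMap fun f => [(e.2, f.2), (f.2, e.2)]

/-- One step of evaluating a list of instructions with a stack of lists of labels and names,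
recording the pairs that the joins connect. -/
def annotStep (s : List (List (ℕ × ℕ)) × List (Instr × List (ℕ × ℕ))) (c : Instr) :
    List (List (ℕ × ℕ)) × List (Instr × List (ℕ × ℕ)) :=
  (bif c.1 == 0 then [(c.2.1, c.2.2)] :: s.1
    else bif c.1 == 1 then (s.1.tail.headD [] ++ s.1.headD []) :: s.1.tail.tail
    else bif c.1 == 3 then
      ((s.1.headD []).map fun e => bif e.1 == c.2.1 then (c.2.2, e.2) else e) :: s.1.tail
    else s.1,
  (c, bif c.1 == 2 then joinPairs c.2.1 c.2.2 (s.1.headD []) else []) :: s.2)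

/-- One step, from the last instruction to the first, of removing the joins all of whose edges are
also created by later joins. -/
def pruneStep (s : List (ℕ × ℕ) × List Instr) (c : Instr × List (ℕ × ℕ)) :
    List (ℕ × ℕ) × List Instr :=
  (c.2 ++ s.1,
    (bif c.1.1 == 2 && c.2.all fun q => q.1 == q.2 || s.1.any fun r => r == q then (4, 0, 0)
      else c.1) :: s.2)

/-- The list of instructions without redundant joins. -/
def pruneCode (l : List Instr) : List Instr :=
  ((l.foldl annotStep ([], [])).2.foldl pruneStep ([], [])).2

/-- The different names in a list of instructions. -/
def codeNames (l : List Instr) : List ℕ :=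
  (l.filter fun c => c.1 == 0).foldl
    (fun r c => bif r.any fun x => x == c.2.2 then r else c.2.2 :: r) []

/-- What a partial solution remembers of the vertices of one label: the name of one of them (`0` if
there is none) and the numbers of vertices on the two sides. -/
abbrev Entry : Type := ℕ × ℕ × ℕ

/-- A partial solution: an entry for every label, and the number of edges in the cut. -/
abbrev CutState : Type := List Entry × ℕ

/-- The entry for the union of two sets of vertices that are disjoint or equal singletons; it is
`(0, 1, 0)` if the two sides do not fit together. -/
def mergeEntry (e f : Entry) : Entry :=
  bif e.1 == 0 then f else bif f.1 == 0 then e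
  else bif e.1 == f.1 then bif e.2 == f.2 then e else (0, 1, 0)
  else (e.1, e.2.1 + f.2.1, e.2.2 + f.2.2)

/-- The possible entries of a partial solution (none if there are fewer than two names). -/
def entries (names : List ℕ) : List Entry :=
  bif names.tail.isEmpty then [] else
    (0, 0, 0) :: names.flatMap fun x => (List.range (names.length + 1)).flatMap fun s =>
      (List.range (names.length + 1)).map fun f => (x, s, f)

/-- The lists of length `k` with members in `E`. -/
def vectors (E : List Entry) (k : ℕ) : List (List Entry) :=
  (List.range k).foldl (fun acc _ => E.flatMap fun e => acc.map fun v => e :: v) [[]]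

/-- An upper bound on the number of edges in a cut. -/
def cutBound (code : List Instr) (names : List ℕ) : ℕ :=
  code.length * (2 * (names.length * names.length))

/-- The possible partial solutions. -/
def allStates (code : List Instr) (names : List ℕ) (k : ℕ) : List CutState :=
  (vectors (entries names) k).flatMap fun v =>
    (List.range (cutBound code names + 1)).map fun w => (v, w)

/-- The partial solutions of a single vertex. -/
def leafTable (k i x : ℕ) : List CutState :=
  [((List.range k).map fun l => bif l == i then (x, 1, 0) else (0, 0, 0), 0),
    ((List.range k).map fun l => bif l == i then (x, 0, 1) else (0, 0, 0), 0)]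

/-- The partial solutions of a disjoint union. -/
def unionTable (k : ℕ) (A B : List CutState) : List CutState :=
  A.flatMap fun s => B.map fun t =>
    ((List.range k).map fun l => mergeEntry (s.1.getD l (0, 0, 0)) (t.1.getD l (0, 0, 0)),
      s.2 + t.2)

/-- The partial solutions after a join. -/
def joinTable (i j : ℕ) (A : List CutState) : List CutState :=
  A.map fun s => (s.1, s.2 +
    ((s.1.getD i (0, 0, 0)).2.1 * (s.1.getD j (0, 0, 0)).2.2 +
      (s.1.getD i (0, 0, 0)).2.2 * (s.1.getD j (0, 0, 0)).2.1))

/-- The partial solutions after a relabel. -/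
def relabelTable (k i j : ℕ) (A : List CutState) : List CutState :=
  A.map fun s => ((List.range k).map fun l => bif l == i then (0, 0, 0) else
    bif l == j then mergeEntry (s.1.getD j (0, 0, 0)) (s.1.getD i (0, 0, 0))
    else s.1.getD l (0, 0, 0), s.2)

/-- The members of `U` that occur in `A`. -/
def restrict (U A : List CutState) : List CutState := U.filter fun u => A.any fun s => s == u

/-- One step of the dynamic program, with a stack of sets of partial solutions. -/
def tableStep (k : ℕ) (U : List CutState) (S : List (List CutState)) (c : Instr) :
    List (List CutState) :=
  bif c.1 == 0 then restrict U (leafTable k c.2.1 c.2.2) :: S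
  else bif c.1 == 1 then restrict U (unionTable k (S.tail.headD []) (S.headD [])) :: S.tail.tail
  else bif c.1 == 2 then restrict U (joinTable c.2.1 c.2.2 (S.headD [])) :: S.tail
  else bif c.1 == 3 then restrict U (relabelTable k c.2.1 c.2.2 (S.headD [])) :: S.tail
  else S

/-- The largest number of edges, up to `b`, in a partial solution. -/
def bestValue (A : List CutState) (b : ℕ) : ℕ :=
  (List.range (b + 1)).foldl (fun r w => bif A.any fun s => s.2 == w then w else r) 0

/-- The maximum size of a cut of the graph given by a list of instructions. -/
def codeMaxCut (k : ℕ) (l : List Instr) : ℕ :=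
  bif (codeNames l).tail.isEmpty then 0 else
    bestValue (((pruneCode l).foldl (tableStep k (allStates l (codeNames l) k)) []).headD [])
      (cutBound l (codeNames l))

/-! ### Running times -/

section

variable {α : Type} [Enc α]

@[fun_prop]
theorem PolyTime.look {δ : α → List (ℕ × ℕ)} {i : α → ℕ} (hδ : PolyTime δ) (hi : PolyTime i) :
    PolyTime fun a => look (δ a) (i a) := by
  unfold _root_.look
  refine PolyTime.foldl (f := fun a r (e : ℕ × ℕ) => bif e.1 == i a then e.2 else r) (by fun_prop)
    (by fun_prop) hδ (g := fun p => meas p.2) (PolyBound.meas.mono meas_snd_le) ?_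
  rintro a s ⟨x, y⟩
  cases x == i a <;> simp; omega

@[fun_prop]
theorem PolyTime.toNat {f : α → Data} (hf : PolyTime f) : PolyTime fun a => (f a).toNat := by
  unfold Data.toNat; fun_prop

@[fun_prop]
theorem PolyTime.pick {δ : α → List (ℕ × ℕ)} {i p : α → ℕ} (hδ : PolyTime δ) (hi : PolyTime i)
    (hp : PolyTime p) : PolyTime fun a => pick (δ a) (i a) (p a) := by
  unfold _root_.pick; fun_prop

theorem PolyTime.parseStep : PolyTime parseStep := by
  unfold _root_.parseStep; fun_prop

@[fun_prop]
theorem PolyTime.joinPairs {i j : α → ℕ} {l : α → List (ℕ × ℕ)} (hi : PolyTime i) (hj : PolyTime j)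
    (hl : PolyTime l) : PolyTime fun a => joinPairs (i a) (j a) (l a) := by
  unfold _root_.joinPairs; fun_prop

theorem PolyTime.annotStep {s : α → List (List (ℕ × ℕ)) × List (Instr × List (ℕ × ℕ))}
    {c : α → Instr} (hs : PolyTime s) (hc : PolyTime c) :
    PolyTime fun a => annotStep (s a) (c a) := by
  unfold _root_.annotStep; fun_prop

theorem PolyTime.pruneStep {s : α → List (ℕ × ℕ) × List Instr}
    {c : α → Instr × List (ℕ × ℕ)} (hs : PolyTime s) (hc : PolyTime c) :
    PolyTime fun a => pruneStep (s a) (c a) := by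
  unfold _root_.pruneStep; fun_prop

@[fun_prop]
theorem PolyTime.codeNames {l : α → List Instr} (hl : PolyTime l) :
    PolyTime fun a => codeNames (l a) := by
  unfold _root_.codeNames
  refine PolyTime.foldl (f := fun _ (r : List ℕ) (c : Instr) => bif r.any fun x => x == c.2.2 then r
    else c.2.2 :: r) (by fun_prop) (by fun_prop) (by fun_prop) (g := fun p => meas p.2 + 1)
    ((PolyBound.meas.mono meas_snd_le).add (.const 1)) ?_
  rintro a s ⟨x, y, z⟩
  cases s.any fun x => x == z <;> simp; omega

@[fun_prop]
theorem PolyTime.mergeEntry {e f : α → Entry} (he : PolyTime e) (hf : PolyTime f) :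
    PolyTime fun a => mergeEntry (e a) (f a) := by
  unfold _root_.mergeEntry; fun_prop

@[fun_prop]
theorem PolyTime.entries {l : α → List ℕ} (hl : PolyTime l) :
    PolyTime fun a => entries (l a) := by
  unfold _root_.entries; fun_prop

@[fun_prop]
theorem PolyTime.cutBound {l : α → List Instr} {m : α → List ℕ} (hl : PolyTime l)
    (hm : PolyTime m) : PolyTime fun a => cutBound (l a) (m a) := by
  unfold _root_.cutBound; fun_prop

@[fun_prop]
theorem PolyTime.restrict {U A : α → List CutState} (hU : PolyTime U) (hA : PolyTime A) :
    PolyTime fun a => restrict (U a) (A a) := by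
  unfold _root_.restrict; fun_prop

theorem PolyTime.tableStep {k : α → ℕ} {U : α → List CutState} {S : α → List (List CutState)}
    {c : α → Instr} (hk : PolyTime k) (hU : PolyTime U) (hS : PolyTime S) (hc : PolyTime c) :
    PolyTime fun a => tableStep (k a) (U a) (S a) (c a) := by
  unfold _root_.tableStep leafTable unionTable joinTable relabelTable; fun_prop

@[fun_prop]
theorem PolyTime.bestValue {A : α → List CutState} {b : α → ℕ} (hA : PolyTime A)
    (hb : PolyTime b) : PolyTime fun a => bestValue (A a) (b a) := by
  unfold _root_.bestValue
  refine PolyTime.foldl (f := fun a r w => bif (A a).any fun s => s.2 == w then w else r)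
    (by fun_prop) (by fun_prop) (by fun_prop) (g := fun p => meas p.2)
    (PolyBound.meas.mono meas_snd_le) ?_
  intro a s w
  cases (A a).any fun s => s.2 == w <;> simp

end

/-! ### Sizes of the intermediate results of the pruning -/

theorem length_flatMap_le {β γ : Type} {l : List β} {f : β → List γ} {B : ℕ}
    (h : ∀ x ∈ l, (f x).length ≤ B) : (l.flatMap f).length ≤ l.length * B := by
  induction l with
  | nil => simp
  | cons x l ih =>
    have h1 := h x (by simp)
    have h2 := ih fun y hy => h y (by simp [hy])
    simp only [List.flatMap_cons, List.length_append, List.length_cons]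
    linarith

theorem length_joinPairs_le (i j : ℕ) (l : List (ℕ × ℕ)) :
    (joinPairs i j l).length ≤ l.length * (l.length * 2) := by
  have h : (l.filter fun e => e.1 == i).length ≤ l.length := List.length_filter_le _ _
  have h' : (l.filter fun e => e.1 == j).length ≤ l.length := List.length_filter_le _ _
  refine (length_flatMap_le fun x _ => length_flatMap_le (B := 2) fun y _ => by simp).trans ?_
  gcongr

theorem mem_joinPairs {i j : ℕ} {l : List (ℕ × ℕ)} {q : ℕ × ℕ} :
    q ∈ joinPairs i j l ↔
      ((i, q.1) ∈ l ∧ (j, q.2) ∈ l) ∨ ((i, q.2) ∈ l ∧ (j, q.1) ∈ l) := by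
  obtain ⟨x, y⟩ := q
  simp only [joinPairs, List.mem_flatMap, List.mem_filter, beq_iff_eq, List.mem_cons,
    List.not_mem_nil, or_false, Prod.mk.injEq]
  constructor
  · rintro ⟨⟨a, b⟩, ⟨h1, rfl⟩, ⟨c, d⟩, ⟨h2, rfl⟩, ⟨rfl, rfl⟩ | ⟨rfl, rfl⟩⟩
    · exact .inl ⟨h1, h2⟩
    · exact .inr ⟨h1, h2⟩
  · rintro (⟨h1, h2⟩ | ⟨h1, h2⟩)
    · exact ⟨_, ⟨h1, rfl⟩, _, ⟨h2, rfl⟩, .inl ⟨rfl, rfl⟩⟩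
    · exact ⟨_, ⟨h1, rfl⟩, _, ⟨h2, rfl⟩, .inr ⟨rfl, rfl⟩⟩

/-- Bounds on the state after `n` steps of evaluation. -/
structure AnnotBound (M n : ℕ) (s : List (List (ℕ × ℕ)) × List (Instr × List (ℕ × ℕ))) : Prop where
  stack : s.1.length ≤ n
  flat : s.1.flatten.length ≤ n
  mem : ∀ e ∈ s.1.flatten, e.1 ≤ M ∧ e.2 ≤ M
  out : s.2.length ≤ n
  out_mem : ∀ d ∈ s.2, meas d.1 ≤ M ∧ d.2.length ≤ n * (n * 2) ∧ ∀ q ∈ d.2, q.1 ≤ M ∧ q.2 ≤ M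

/-- Only a leaf adds a vertex to the stack; unions concatenate and relabels keep lengths. So the
lists on the stack have total length at most `n`, and a join records at most `2 * n ^ 2` pairs. -/
theorem AnnotBound.step {M n : ℕ} {s : List (List (ℕ × ℕ)) × List (Instr × List (ℕ × ℕ))}
    (h : AnnotBound M n s) {c : Instr} (hc : meas c ≤ M) : AnnotBound M (n + 1) (annotStep s c) := by
  obtain ⟨S, O⟩ := s
  obtain ⟨op, i, j⟩ := c
  obtain ⟨h1, h2, h3, h4, h5⟩ := h
  simp only [meas_pair, meas_nat] at hc
  simp only at h1 h2 h3 h4 h5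
  have hhead : ∀ e ∈ S.headD [], e ∈ S.flatten := by cases S <;> simp +contextual
  have hheadl : (S.headD []).length ≤ n := by
    cases S
    · simp
    · simp only [List.flatten_cons, List.length_append, List.headD_cons] at h2 ⊢; omega
  have hpairs : ∀ q ∈ joinPairs i j (S.headD []), q.1 ≤ M ∧ q.2 ≤ M := by
    intro q hq
    rcases mem_joinPairs.1 hq with ⟨ha, hb⟩ | ⟨ha, hb⟩
    · exact ⟨(h3 _ (hhead _ ha)).2, (h3 _ (hhead _ hb)).2⟩
    · exact ⟨(h3 _ (hhead _ hb)).2, (h3 _ (hhead _ ha)).2⟩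
  have hpl : (joinPairs i j (S.headD [])).length ≤ n * (n * 2) := by
    refine (length_joinPairs_le _ _ _).trans ?_
    gcongr
  have hnn : n * (n * 2) ≤ (n + 1) * ((n + 1) * 2) := by gcongr <;> omega
  have key : (annotStep (S, O) (op, i, j)).1.length ≤ n + 1 ∧
      (annotStep (S, O) (op, i, j)).1.flatten.length ≤ n + 1 ∧
      ∀ e ∈ (annotStep (S, O) (op, i, j)).1.flatten, e.1 ≤ M ∧ e.2 ≤ M := by
    unfold annotStep
    simp only [cond_eq_ite, beq_iff_eq]
    split_ifs with o1 o2 o3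
    · refine ⟨by simpa using h1, by simpa using h2, ?_⟩
      simp only [List.flatten_cons, List.cons_append, List.nil_append, List.mem_cons]
      rintro e (rfl | he)
      · constructor <;> simp <;> omega
      · exact h3 e he
    · rcases S with _ | ⟨a, _ | ⟨b, S⟩⟩
      · simp
      · simp at *
        exact ⟨by omega, h3⟩
      · simp at *
        refine ⟨by omega, by omega, ?_⟩
        rintro x y (h | h | h)
        · exact h3 _ _ (.inr (.inl h))
        · exact h3 _ _ (.inl h)
        · exact h3 _ _ (.inr (.inr h))
    · rcases S with _ | ⟨a, S⟩
      · simp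
      · simp only [List.headD_cons, List.tail_cons, List.length_cons, List.flatten_cons,
          List.length_append, List.length_map, List.mem_append, List.mem_map] at *
        refine ⟨by omega, by omega, ?_⟩
        rintro e (⟨f, hf, rfl⟩ | he)
        · have := h3 f (.inl hf)
          split_ifs
          · exact ⟨by simp; omega, this.2⟩
          · exact this
        · exact h3 e (.inr he)
    · exact ⟨by omega, by omega, h3⟩
  refine ⟨key.1, key.2.1, key.2.2, ?_, ?_⟩
  · simp only [annotStep, List.length_cons]; omega
  · simp only [annotStep, List.mem_cons]
    rintro d (rfl | hd)
    · refine ⟨by simpa only [meas_pair, meas_nat] using hc, ?_, ?_⟩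
      · cases op == 2
        · simp
        · simp only [cond_true]; omega
      · cases op == 2
        · simp
        · exact hpairs
    · have := h5 d hd
      exact ⟨this.1, by omega, this.2.2⟩

theorem annotBound_foldl {M : ℕ} (l : List Instr) (h : ∀ c ∈ l, meas c ≤ M) :
    AnnotBound M l.length (l.foldl annotStep ([], [])) := by
  induction l using List.reverseRecOn with
  | nil => constructor <;> simp
  | append_singleton l x ih =>
    rw [List.foldl_append, List.length_append]
    exact (ih fun c hc => h c (by simp [hc])).step (h x (by simp))

theorem AnnotBound.meas_le {M n : ℕ} {s : List (List (ℕ × ℕ)) × List (Instr × List (ℕ × ℕ))}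
    (h : AnnotBound M n s) : meas s ≤
      n * (n * (M + M + 1 + 1) + 1) + n * (M + (n * (n * 2)) * (M + M + 1 + 1) + 1 + 1) + 1 := by
  obtain ⟨S, O⟩ := s
  obtain ⟨h1, h2, h3, h4, h5⟩ := h
  simp only at h1 h2 h3 h4 h5
  have e1 : meas S ≤ n * (n * (M + M + 1 + 1) + 1) := by
    refine (meas_list_le (B := n * (M + M + 1 + 1)) fun l hl => ?_).trans (by gcongr)
    refine (meas_list_le (B := M + M + 1) fun e he => ?_).trans ?_
    · have := h3 e (List.mem_flatten.2 ⟨l, hl, he⟩)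
      obtain ⟨a, b⟩ := e
      simp only [meas_pair, meas_nat] at *
      omega
    · have : l.length ≤ S.flatten.length := (List.sublist_flatten_of_mem hl).length_le
      gcongr
      omega
  have e2 : meas O ≤ n * (M + (n * (n * 2)) * (M + M + 1 + 1) + 1 + 1) := by
    refine (meas_list_le (B := M + (n * (n * 2)) * (M + M + 1 + 1) + 1) fun d hd => ?_).trans
      (by gcongr)
    obtain ⟨c, P⟩ := d
    obtain ⟨g1, g2, g3⟩ := h5 _ hd
    simp only at g1 g2 g3
    have : meas P ≤ P.length * (M + M + 1 + 1) := meas_list_le fun e he => by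
      have := g3 e he
      obtain ⟨a, b⟩ := e
      simp only [meas_pair, meas_nat] at *
      omega
    have h' : P.length * (M + M + 1 + 1) ≤ (n * (n * 2)) * (M + M + 1 + 1) := by gcongr
    simp only [meas_pair] at *
    omega
  simp only [meas_pair] at *
  omega

section

variable {α : Type} [Enc α]

-- The growth in a step of the first fold depends on its state, since joins record pairs from the
-- whole top list; therefore it needs the a priori bound `AnnotBound`. The second fold grows only by
-- the size of the item read, plus a constant for the instruction `(4, 0, 0)`.
@[fun_prop]
theorem PolyTime.pruneCode {l : α → List Instr} (hl : PolyTime l) :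
    PolyTime fun a => pruneCode (l a) := by
  have hA : PolyTime fun a => (l a).foldl _root_.annotStep ([], []) := by
    refine PolyTime.foldl_of_bound (f := fun _ => _root_.annotStep)
      (PolyTime.annotStep (by fun_prop) (by fun_prop)) (by fun_prop) hl
      (B := fun a =>
        meas (l a) * (meas (l a) * (meas (l a) + meas (l a) + 1 + 1) + 1) + meas (l a) *
        (meas (l a) + (meas (l a) * (meas (l a) * 2)) * (meas (l a) + meas (l a) + 1 + 1) + 1 + 1) + 1)
      ?_ ?_
    · have h := hl.2
      have h1 : ∀ n : ℕ, PolyBound fun _ : α => n := fun n => .const n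
      exact ((h.mul ((h.mul (((h.add h).add (h1 1)).add (h1 1))).add (h1 1))).add
        (h.mul (((h.add ((h.mul (h.mul (h1 2))).mul (((h.add h).add (h1 1)).add (h1 1)))).add
          (h1 1)).add (h1 1)))).add (h1 1)
    · intro a l₁ l₂ h
      refine (annotBound_foldl (M := meas (l a)) l₁ fun c hc =>
        (meas_lt_of_mem (by simp [h, hc])).le).meas_le.trans ?_
      have : l₁.length ≤ meas (l a) := by
        rw [h, meas_append]
        exact (length_le_meas l₁).trans (by omega)
      gcongr
  unfold _root_.pruneCode
  refine PolyTime.snd (PolyTime.foldl (f := fun _ => _root_.pruneStep)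
    (PolyTime.pruneStep (by fun_prop) (by fun_prop)) (by fun_prop) (PolyTime.snd hA)
    (g := fun p => meas p.2 + 10) ((PolyBound.meas.mono meas_snd_le).add (.const 10)) ?_)
  rintro a ⟨J, R⟩ ⟨⟨op, i, j⟩, P⟩
  simp only [_root_.pruneStep, meas_pair, meas_append, meas_cons]
  cases (op == 2 && P.all fun q => q.1 == q.2 || J.any fun r => r == q) <;> simp <;> omega

/-! ### The number of partial solutions -/

theorem vectors_succ (E : List Entry) (k : ℕ) :
    vectors E (k + 1) = E.flatMap fun e => (vectors E k).map fun v => e :: v := by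
  simp [vectors, List.range_succ]

theorem mem_vectors {E : List Entry} {k : ℕ} {v : List Entry} :
    v ∈ vectors E k ↔ v.length = k ∧ ∀ e ∈ v, e ∈ E := by
  induction k generalizing v with
  | zero =>
    simp only [vectors, List.range_zero, List.foldl_nil, List.mem_singleton, List.length_eq_zero_iff]
    exact ⟨by rintro rfl; simp, fun h => h.1⟩
  | succ k ih =>
    simp only [vectors_succ, List.mem_flatMap, List.mem_map]
    constructor
    · rintro ⟨e, he, w, hw, rfl⟩
      obtain ⟨h1, h2⟩ := ih.1 hw
      exact ⟨by simp [h1], by simpa using ⟨he, fun a b c => h2 (a, b, c)⟩⟩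
    · rintro ⟨h1, h2⟩
      cases v with
      | nil => simp at h1
      | cons e v =>
        exact ⟨e, h2 e (by simp), v, ih.2 ⟨by simpa using h1, fun f hf => h2 f (by simp [hf])⟩, rfl⟩

theorem length_vectors_le (E : List Entry) (k : ℕ) : (vectors E k).length ≤ E.length ^ k := by
  induction k with
  | zero => simp [vectors]
  | succ k ih =>
    rw [vectors_succ, pow_succ, mul_comm]
    exact length_flatMap_le fun e _ => by simpa using ih

theorem foldl_const_eq {β σ : Type} (f : σ → σ) (s : σ) (l m : List β) (h : l.length = m.length) :
    l.foldl (fun s _ => f s) s = m.foldl (fun s _ => f s) s := by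
  induction l generalizing s m with
  | nil => cases m <;> simp_all
  | cons x l ih => cases m with
    | nil => simp at h
    | cons y m => exact ih _ m (by simpa using h)

/-- The intermediate results are the lists of shorter vectors, so a bound on the number of
full-length vectors is enough. The `+ 1` in the base makes the powers monotone in the exponent even
for empty `E`. -/
theorem PolyTime.vectors {E : α → List Entry} {k : α → ℕ} (hE : PolyTime E) (hk : PolyTime k)
    (h : PolyBound fun a => ((E a).length + 1) ^ k a) : PolyTime fun a => vectors (E a) (k a) := by
  refine PolyTime.foldl_of_bound (f := fun a (acc : List (List Entry)) _ =>
    (E a).flatMap fun e => acc.map fun v => e :: v) (by fun_prop) (by fun_prop) (by fun_prop)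
    (B := fun a => ((E a).length + 1) ^ k a * (k a * (meas (E a) + 1) + 1))
    (h.mul ((hk.2.mul (hE.2.add (.const 1))).add (.const 1))) ?_
  intro a l₁ l₂ hl
  have hlen : l₁.length ≤ k a := by
    have := congrArg List.length hl
    simp at this; omega
  have : l₁.foldl (fun (acc : List (List Entry)) _ => (E a).flatMap fun e => acc.map fun v => e :: v)
      [[]] = _root_.vectors (E a) l₁.length :=
    foldl_const_eq _ _ _ _ (by simp)
  rw [this]
  refine (meas_list_le (B := k a * (meas (E a) + 1)) fun v hv => ?_).trans ?_
  · obtain ⟨h1, h2⟩ := mem_vectors.1 hv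
    refine (meas_list_le fun e he => (meas_lt_of_mem (h2 e he)).le).trans ?_
    gcongr
    omega
  · gcongr
    calc _ ≤ (E a).length ^ l₁.length := length_vectors_le _ _
      _ ≤ ((E a).length + 1) ^ l₁.length := by gcongr; omega
      _ ≤ _ := by gcongr; omega

/-- Every new table is a sublist of `U` because of `restrict`, so the stack grows by at most the
size of `U` in each step. Without the restriction, repetitions in the tables could multiply at every
union. -/
theorem PolyTime.tableFold {k : α → ℕ} {U : α → List CutState} {l : α → List Instr}
    (hk : PolyTime k) (hU : PolyTime U) (hl : PolyTime l) :
    PolyTime fun a => (l a).foldl (_root_.tableStep (k a) (U a)) [] := by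
  refine PolyTime.foldl (f := fun a => _root_.tableStep (k a) (U a))
    (PolyTime.tableStep (by fun_prop) (by fun_prop) (by fun_prop) (by fun_prop)) (by fun_prop) hl
    (g := fun p => meas (U p.1) + 1)
    ((hU.2.comp (PolyBound.meas.mono meas_fst_le)).add (.const 1)) ?_
  intro a S c
  have ht : ∀ S : List (List CutState), meas S.tail ≤ meas S := fun S =>
    meas_sublist (List.tail_sublist S)
  have hr : ∀ A, meas (_root_.restrict (U a) A) ≤ meas (U a) := fun A =>
    meas_sublist List.filter_sublist
  have := ht S
  have := ht S.tail
  unfold _root_.tableStep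
  cases c.1 == 0 <;> [cases c.1 == 1 <;> [cases c.1 == 2 <;> [cases c.1 == 3; skip]; skip]; skip]
  · simp
  all_goals
    simp only [cond_true, cond_false, meas_cons]
  · have := hr (relabelTable (k a) c.2.1 c.2.2 (S.headD [])); omega
  · have := hr (joinTable c.2.1 c.2.2 (S.headD [])); omega
  · have := hr (unionTable (k a) (S.tail.headD []) (S.headD [])); omega
  · have := hr (leafTable (k a) c.2.1 c.2.2); omega

/-- For `n ≥ 2` names the base is at most `n ^ 6`, whose `k`-th power is `(n ^ k) ^ 6`. For a single
name this would fail: `n ^ k` is `1`, while several entries per label would give exponentially many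
vectors. Therefore `entries` is empty in that case, and `codeMaxCut` answers `0` directly. -/
theorem length_entries_add_one_le (names : List ℕ) (k : ℕ) :
    ((entries names).length + 1) ^ k ≤ (names.length ^ k + 2) ^ 6 := by
  unfold entries
  rcases names with _ | ⟨x, _ | ⟨y, l⟩⟩
  · exact (by simp : _ ≤ 1).trans (Nat.one_le_pow _ _ (Nat.succ_pos _))
  · simp
  · simp only [List.tail_cons, List.isEmpty_cons, cond_false]
    set names := x :: y :: l
    set n := names.length with hn
    have h2 : 2 ≤ n := by simp [hn, names]
    have : (names.flatMap fun x => (List.range (n + 1)).flatMap fun s =>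
        (List.range (n + 1)).map fun f => (x, s, f)).length ≤ n * ((n + 1) * (n + 1)) := by
      refine length_flatMap_le fun x _ => (length_flatMap_le (B := n + 1) fun y _ => ?_).trans ?_
      · simp
      · simp
    have h6 : n * ((n + 1) * (n + 1)) + 2 ≤ n ^ 6 := by
      have a1 : (n + 1) * (n + 1) ≤ n ^ 4 := by
        have : n + 1 ≤ n * n := by nlinarith
        calc _ ≤ (n * n) * (n * n) := Nat.mul_le_mul this this
          _ = _ := by ring
      have a2 : n * ((n + 1) * (n + 1)) ≤ n * n ^ 4 := Nat.mul_le_mul_left _ a1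
      have a3 : n ^ 5 * 2 ≤ n ^ 5 * n := Nat.mul_le_mul_left _ h2
      have a4 : 2 ^ 5 ≤ n ^ 5 := Nat.pow_le_pow_left h2 5
      have a5 : n * n ^ 4 = n ^ 5 := by ring
      have a6 : n ^ 5 * n = n ^ 6 := by ring
      omega
    calc _ ≤ (n ^ 6) ^ k := by
          gcongr
          simp only [List.length_cons]
          omega
      _ = (n ^ k) ^ 6 := by rw [← pow_mul, ← pow_mul, mul_comm]
      _ ≤ _ := by gcongr; omega

theorem PolyTime.codeMaxCut {k : α → ℕ} {l : α → List Instr} (hk : PolyTime k) (hl : PolyTime l)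
    (h : PolyBound fun a => (_root_.codeNames (l a)).length ^ k a) :
    PolyTime fun a => _root_.codeMaxCut (k a) (l a) := by
  have hv : PolyTime fun a => _root_.vectors (_root_.entries (_root_.codeNames (l a))) (k a) :=
    PolyTime.vectors (by fun_prop) hk
      (((h.add (.const 2)).pow 6).mono fun a => length_entries_add_one_le _ _)
  have hU : PolyTime fun a => allStates (l a) (_root_.codeNames (l a)) (k a) := by
    unfold allStates; fun_prop
  have := PolyTime.tableFold hk hU (PolyTime.pruneCode hl)
  unfold _root_.codeMaxCut
  fun_prop

end

/-! ## Expressions with named vertices -/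

/-- Parse trees of expressions without fusions in which the vertices have names. Leaves with the
same name stand for the same vertex. -/
inductive NamedExpr : Type
  | leaf (i x : ℕ) : NamedExpr
  | union (a b : NamedExpr) : NamedExpr
  | join (i j : ℕ) (a : NamedExpr) : NamedExpr
  | relabel (i j : ℕ) (a : NamedExpr) : NamedExpr
  | skip (a : NamedExpr) : NamedExpr

/-- The list of instructions in postfix order. -/
def NamedExpr.code : NamedExpr → List Instr
  | leaf i x => [(0, i, x)]
  | union a b => a.code ++ b.code ++ [(1, 0, 0)]
  | join i j a => a.code ++ [(2, i, j)]
  | relabel i j a => a.code ++ [(3, i, j)]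
  | skip a => a.code ++ [(4, 0, 0)]

/-- The name for the vertices of label `i`: the name that `δ` prescribes, or else `p + 1`. -/
def newName (δ : ℕ → ℕ) (i p : ℕ) : ℕ := if δ i = 0 then p + 1 else δ i

/-- The translation of an expression. The vertices of a label `i` with `δ i ≠ 0` will be fused
later, and `δ i` is the name of the resulting vertex; new names are larger than `p`. -/
def FuseExpr.toNamed {k : ℕ} : FuseExpr k → (ℕ → ℕ) → ℕ → NamedExpr
  | .intro i, δ, p => .leaf i (newName δ i p)
  | .union a b, δ, p => .union (a.toNamed δ (p + 1 + b.size)) (b.toNamed δ (p + 1))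
  | .join i j a, δ, p => .join i j (a.toNamed δ (p + 1))
  | .relabel i j a, δ, p => .relabel i j (a.toNamed (Function.update δ i (δ j)) (p + 1))
  | .fuse i a, δ, p => .skip (a.toNamed (Function.update δ i (newName δ i p)) (p + 1))

/-! ### Correctness and cost of the translation program -/

theorem FuseExpr.length_code_toNamed {k : ℕ} (φ : FuseExpr k) (δ : ℕ → ℕ) (p : ℕ) :
    (φ.toNamed δ p).code.length = φ.size := by
  induction φ generalizing δ p with
  | intro i => rfl
  | union a b iha ihb => simp [toNamed, NamedExpr.code, size, iha, ihb]; omega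
  | join i j a ih => simp [toNamed, NamedExpr.code, size, ih]
  | relabel i j a ih => simp [toNamed, NamedExpr.code, size, ih]
  | fuse i a ih => simp [toNamed, NamedExpr.code, size, ih]

@[simp] theorem Data.toNat_ofNat (n : ℕ) : (Data.ofNat n).toNat = n := by
  induction n with
  | zero => rfl
  | succ n ih => simpa [Data.toNat, Data.ofNat, Data.toList] using ih

theorem look_append (δ : List (ℕ × ℕ)) (i q : ℕ) :
    look (δ ++ [(i, q)]) = Function.update (look δ) i q := by
  funext l
  simp only [look, List.foldl_append, List.foldl_cons, List.foldl_nil, Function.update_apply]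
  by_cases h : l = i
  · simp [h]
  · have : (i == l) = false := by simpa using fun h' => h h'.symm
    simp [h, this]

theorem pick_eq_newName (δ : List (ℕ × ℕ)) (i p : ℕ) : pick δ i p = newName (look δ) i p := by
  simp only [pick, newName, cond_eq_ite, beq_iff_eq]

/-- Nodes are visited from the root with the right subtree first, and instructions are put in front
of the output; this yields postfix order. One instruction is written per node, so the length of the
output counts the visited nodes and can serve as the supply `p` of new names. This explains the
shift by `b.size` for the left subtree of a union in `toNamed`. -/
theorem parseStep_iterate {k : ℕ} (φ : FuseExpr k) (δ : List (ℕ × ℕ))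
    (W : List (Data × List (ℕ × ℕ))) (out : List Instr) :
    (workStep parseStep)^[φ.size] ((φ.encode, δ) :: W, out) =
      (W, (φ.toNamed (look δ) out.length).code ++ out) := by
  induction φ generalizing δ W out with
  | intro i =>
    simp [FuseExpr.size, workStep, parseStep, FuseExpr.encode, Data.hd, Data.tl, FuseExpr.toNamed,
      NamedExpr.code, pick_eq_newName]
  | union a b iha ihb =>
    rw [FuseExpr.size, Function.iterate_succ_apply, Function.iterate_add_apply]
    simp only [workStep, parseStep, FuseExpr.encode, Data.hd, Data.tl, Data.toNat_ofNat]
    simp [ihb, iha, FuseExpr.toNamed, NamedExpr.code, FuseExpr.length_code_toNamed,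
      add_comm b.size]
  | join i j a ih =>
    rw [FuseExpr.size, Function.iterate_succ_apply]
    simp only [workStep, parseStep, FuseExpr.encode, Data.hd, Data.tl, Data.toNat_ofNat]
    simp [ih, FuseExpr.toNamed, NamedExpr.code]
  | relabel i j a ih =>
    rw [FuseExpr.size, Function.iterate_succ_apply]
    simp only [workStep, parseStep, FuseExpr.encode, Data.hd, Data.tl, Data.toNat_ofNat]
    simp [ih, FuseExpr.toNamed, NamedExpr.code, look_append]
  | fuse i a ih =>
    rw [FuseExpr.size, Function.iterate_succ_apply]
    simp only [workStep, parseStep, FuseExpr.encode, Data.hd, Data.tl, Data.toNat_ofNat]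
    simp [ih, FuseExpr.toNamed, NamedExpr.code, look_append, pick_eq_newName]

theorem Data.size_hd_le (d : Data) : d.hd.size ≤ d.size := by
  cases d <;> simp [Data.hd, Data.size]; omega

theorem Data.size_tl_le (d : Data) : d.tl.size ≤ d.size := by
  cases d <;> simp [Data.tl, Data.size]; omega

theorem Data.toNat_le (d : Data) : d.toNat ≤ d.size :=
  (length_le_meas _).trans d.meas_toList.le

theorem look_le {δ : List (ℕ × ℕ)} {B : ℕ} (h : ∀ e ∈ δ, e.2 ≤ B) (i : ℕ) : look δ i ≤ B := by
  induction δ using List.reverseRecOn with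
  | nil => simp [look]
  | append_singleton δ e ih =>
    obtain ⟨j, q⟩ := e
    rw [look_append, Function.update_apply]
    split_ifs
    · exact h (j, q) (by simp)
    · exact ih fun e he => h e (by simp [he])

theorem pick_le {δ : List (ℕ × ℕ)} {B : ℕ} (h : ∀ e ∈ δ, e.2 ≤ B) (i : ℕ) {p : ℕ} (hp : p + 1 ≤ B) :
    pick δ i p ≤ B := by
  unfold pick
  cases look δ i == 0
  · exact look_le h i
  · exact hp

/-- Bounds on the state after `n` steps of the translation. -/
structure ParseBound (M n : ℕ) (s : List (Data × List (ℕ × ℕ)) × List Instr) : Prop where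
  work : s.1.length ≤ n + 1
  mem : ∀ w ∈ s.1, w.1.size ≤ M ∧ w.2.length ≤ n ∧ ∀ e ∈ w.2, e.1 ≤ M ∧ e.2 ≤ n
  out : s.2.length ≤ n
  out_mem : ∀ c ∈ s.2, c.1 ≤ 4 ∧ c.2.1 ≤ M ∧ c.2.2 ≤ M + n

/-- In each round at most one subtree and one instruction are added and a list of bindings gets at
most one more member. A new name is one more than the length of the output, so after `n` rounds the
names are at most `n`. -/
theorem ParseBound.step {M n : ℕ} {s : List (Data × List (ℕ × ℕ)) × List Instr}
    (h : ParseBound M n s) : ParseBound M (n + 1) (workStep parseStep s) := by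
  obtain ⟨_ | ⟨⟨d, δ⟩, W⟩, O⟩ := s
  · obtain ⟨h1, h2, h3, h4⟩ := h
    refine ⟨by simp [workStep], by simp [workStep], ?_, fun c hc => ?_⟩
    · simp only [workStep] at *; omega
    · have := h4 c hc
      exact ⟨this.1, this.2.1, by omega⟩
  obtain ⟨h1, h2, h3, h4⟩ := h
  simp only [List.length_cons] at h1
  simp only at h3 h4
  obtain ⟨hd, hδ, hδ'⟩ := h2 (d, δ) (by simp)
  simp only at hd hδ hδ'
  have hδ'' : ∀ e ∈ δ, e.2 ≤ n + 1 := fun e he => by have := hδ' e he; omega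
  have g0 : d.tl.size ≤ M := d.size_tl_le.trans hd
  have g1 : d.tl.tl.size ≤ M := d.tl.size_tl_le.trans g0
  have g2 : d.tl.hd.size ≤ M := d.tl.size_hd_le.trans g0
  have l0 : d.tl.toNat ≤ M := (Data.toNat_le _).trans g0
  have l1 : d.tl.hd.toNat ≤ M := (Data.toNat_le _).trans g2
  have l2 : d.tl.hd.hd.toNat ≤ M := (Data.toNat_le _).trans ((Data.size_hd_le _).trans g2)
  have l3 : d.tl.hd.tl.toNat ≤ M := (Data.toNat_le _).trans ((Data.size_tl_le _).trans g2)
  have hW : ∀ w ∈ W, w.1.size ≤ M ∧ w.2.length ≤ n + 1 ∧ ∀ e ∈ w.2, e.1 ≤ M ∧ e.2 ≤ n + 1 := by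
    intro w hw
    obtain ⟨a, b, c⟩ := h2 w (by simp [hw])
    exact ⟨a, by omega, fun e he => by have := c e he; omega⟩
  have hO : ∀ c ∈ O, c.1 ≤ 4 ∧ c.2.1 ≤ M ∧ c.2.2 ≤ M + (n + 1) := fun c hc => by
    have := h4 c hc; omega
  have hδ1 : ∀ e ∈ δ, e.1 ≤ M ∧ e.2 ≤ n + 1 := fun e he => by have := hδ' e he; omega
  have hcons : ∀ (W' : List (Data × List (ℕ × ℕ))) (c : Instr), W'.length ≤ n + 2 →
      (∀ w ∈ W', w.1.size ≤ M ∧ w.2.length ≤ n + 1 ∧ ∀ e ∈ w.2, e.1 ≤ M ∧ e.2 ≤ n + 1) →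
      (c.1 ≤ 4 ∧ c.2.1 ≤ M ∧ c.2.2 ≤ M + (n + 1)) → ParseBound M (n + 1) (W', c :: O) := by
    intro W' c a1 a2 a3
    refine ⟨a1, a2, by simpa using h3, ?_⟩
    simp only [List.mem_cons]
    rintro c' (rfl | hc')
    · exact a3
    · exact hO c' hc'
  simp only [workStep, parseStep, cond_eq_ite, beq_iff_eq]
  split_ifs
  · exact hcons _ _ (by omega) hW
      ⟨by simp, l0, (pick_le hδ'' _ (p := O.length) (by omega)).trans (by omega)⟩
  · refine hcons _ _ (by simp; omega) ?_ (by simp)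
    simp only [List.mem_cons]
    rintro w (rfl | rfl | hw)
    · exact ⟨g1, by simp; omega, hδ1⟩
    · exact ⟨g2, by simp; omega, hδ1⟩
    · exact hW w hw
  · refine hcons _ _ (by simp; omega) ?_ ⟨by simp, l2, by simp; omega⟩
    simp only [List.mem_cons]
    rintro w (rfl | hw)
    · exact ⟨g1, by simp; omega, hδ1⟩
    · exact hW w hw
  · refine hcons _ _ (by simp; omega) ?_ ⟨by simp, l2, by simp; omega⟩
    simp only [List.mem_cons]
    rintro w (rfl | hw)
    · refine ⟨g1, by simp; omega, ?_⟩
      simp only [List.mem_append, List.mem_singleton]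
      rintro e (he | rfl)
      · exact hδ1 e he
      · exact ⟨l2, look_le hδ'' _⟩
    · exact hW w hw
  · refine hcons _ _ (by simp; omega) ?_ (by simp)
    simp only [List.mem_cons]
    rintro w (rfl | hw)
    · refine ⟨g1, by simp; omega, ?_⟩
      simp only [List.mem_append, List.mem_singleton]
      rintro e (he | rfl)
      · exact hδ1 e he
      · exact ⟨l1, pick_le hδ'' _ (by omega)⟩
    · exact hW w hw

theorem ParseBound.meas_le {M n : ℕ} {s : List (Data × List (ℕ × ℕ)) × List Instr}
    (h : ParseBound M n s) : meas s ≤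
      (n + 1) * (M + n * (M + n + 1 + 1) + 1 + 1) + n * (4 + (M + (M + n) + 1) + 1 + 1) + 1 := by
  obtain ⟨W, O⟩ := s
  obtain ⟨h1, h2, h3, h4⟩ := h
  simp only at h1 h2 h3 h4
  have e1 : meas W ≤ (n + 1) * (M + n * (M + n + 1 + 1) + 1 + 1) := by
    refine (meas_list_le (B := M + n * (M + n + 1 + 1) + 1) fun w hw => ?_).trans (by gcongr)
    obtain ⟨d, δ⟩ := w
    obtain ⟨g1, g2, g3⟩ := h2 _ hw
    simp only at g1 g2 g3
    have : meas δ ≤ δ.length * (M + n + 1 + 1) := meas_list_le fun e he => by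
      have := g3 e he
      obtain ⟨a, b⟩ := e
      simp only [meas_pair, meas_nat] at *
      omega
    have h' : δ.length * (M + n + 1 + 1) ≤ n * (M + n + 1 + 1) := by gcongr
    simp only [meas_pair, meas_data] at *
    omega
  have e2 : meas O ≤ n * (4 + (M + (M + n) + 1) + 1 + 1) := by
    refine (meas_list_le (B := 4 + (M + (M + n) + 1) + 1) fun c hc => ?_).trans (by gcongr)
    have := h4 c hc
    obtain ⟨a, b, c⟩ := c
    simp only [meas_pair, meas_nat] at *
    omega
  simp only [meas_pair] at *
  omega

/-- An instance of the problem. -/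
structure MaxCutInstance : Type where
  k : ℕ
  expr : FuseExpr k

namespace MaxCutInstance

/-- The translation of an instance to named expressions. -/
def named (a : MaxCutInstance) : NamedExpr := a.expr.toNamed (fun _ => 0) 0

/-- The measure of an instance contains the number of vertices to the power of `k`. -/
instance : Enc MaxCutInstance where
  enc a := .cons (.ofNat a.k) a.expr.encode
  meas a := a.k + a.expr.encode.size + 1 + (codeNames a.named.code).length ^ a.k
  size_le a := by simp [Data.size]

theorem polyTime_k : PolyTime MaxCutInstance.k :=
  .of_expr (.hd (.var 0)) (fun a s h => by simp [Expr.eval, h, enc, Data.hd])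
    (PolyBound.meas.mono fun a => by simp only [Enc.meas, id]; omega)

theorem polyTime_encode : PolyTime fun a : MaxCutInstance => a.expr.encode :=
  .of_expr (.tl (.var 0)) (fun a s h => by simp [Expr.eval, h, enc, Data.tl])
    (PolyBound.meas.mono fun a => by simp only [Enc.meas]; omega)

theorem _root_.FuseExpr.size_le_size_encode {k : ℕ} (φ : FuseExpr k) :
    φ.size ≤ φ.encode.size := by
  induction φ <;> simp only [FuseExpr.size, FuseExpr.encode, Data.size] <;> omega

theorem polyTime_code : PolyTime fun a : MaxCutInstance => a.named.code := by
  have hit : ∀ a : MaxCutInstance, (workStep parseStep)^[a.expr.size] ([(a.expr.encode, [])], []) =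
      ([], a.named.code) := fun a => by
    rw [parseStep_iterate]
    simp [named]; rfl
  have hm : PolyBound fun a : MaxCutInstance => a.expr.encode.size := polyTime_encode.2
  refine (PolyTime.work (b := parseStep) PolyTime.parseStep
    (start := fun a : MaxCutInstance => ([(a.expr.encode, [])], []))
    (((polyTime_encode.pair (.const [])).listCons (.const [])).pair (.const []))
    (N := fun a => a.expr.size) (B := fun a =>
      (a.expr.encode.size + 1) * (a.expr.encode.size + a.expr.encode.size *
        (a.expr.encode.size + a.expr.encode.size + 1 + 1) + 1 + 1) + a.expr.encode.size *
        (4 + (a.expr.encode.size + (a.expr.encode.size + a.expr.encode.size) + 1) + 1 + 1) + 1)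
    (hm.mono fun a => a.expr.size_le_size_encode) (fun a => by rw [hit]) ?_ ?_).of_eq
    fun a => by rw [hit]
  · have h1 : ∀ n : ℕ, PolyBound fun _ : MaxCutInstance => n := fun n => .const n
    exact (((hm.add (h1 1)).mul (((hm.add (hm.mul (((hm.add hm).add (h1 1)).add (h1 1)))).add
      (h1 1)).add (h1 1))).add (hm.mul ((((h1 4).add ((hm.add (hm.add hm)).add (h1 1))).add
        (h1 1)).add (h1 1)))).add (h1 1)
  · intro a j hj
    have key : ∀ j, ParseBound a.expr.encode.size j
        ((workStep parseStep)^[j] ([(a.expr.encode, [])], [])) := by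
      intro j
      induction j with
      | zero => constructor <;> simp
      | succ j ih =>
        rw [Function.iterate_succ_apply']
        exact ih.step
    refine (key j).meas_le.trans ?_
    have := hj.trans a.expr.size_le_size_encode
    gcongr

/-- The output of the algorithm. -/
def solve (a : MaxCutInstance) : ℕ := codeMaxCut a.k a.named.code

/-- The number of names to the power of `k` is a summand of the measure of an instance, so the only
hypothesis of `PolyTime.codeMaxCut` that is not plain polynomial time holds by definition. -/
theorem polyTime_solve : PolyTime solve :=
  PolyTime.codeMaxCut polyTime_k polyTime_code
    (PolyBound.meas.mono fun a => by simp only [Enc.meas]; omega)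

end MaxCutInstance

namespace NamedExpr

/-! ### Labels, redundant joins -/

/-- The labels and names of the vertices. -/
def labels : NamedExpr → List (ℕ × ℕ)
  | leaf i x => [(i, x)]
  | union a b => a.labels ++ b.labels
  | join _ _ a => a.labels
  | relabel i j a => a.labels.map fun e => bif e.1 == i then (j, e.2) else e
  | skip a => a.labels

/-- The pairs of names, in both orders, that the joins connect. -/
def pairs : NamedExpr → List (ℕ × ℕ)
  | leaf _ _ => []
  | union a b => a.pairs ++ b.pairs
  | join i j a => a.pairs ++ joinPairs i j a.labels
  | relabel _ _ a => a.pairs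
  | skip a => a.pairs

/-- The instructions in postfix order together with the pairs of names that they connect. -/
def annot : NamedExpr → List (Instr × List (ℕ × ℕ))
  | leaf i x => [((0, i, x), [])]
  | union a b => a.annot ++ b.annot ++ [((1, 0, 0), [])]
  | join i j a => a.annot ++ [((2, i, j), joinPairs i j a.labels)]
  | relabel i j a => a.annot ++ [((3, i, j), [])]
  | skip a => a.annot ++ [((4, 0, 0), [])]

/-- All edges that a join of `i` and `j` creates are among `J`. -/
def redundant (i j : ℕ) (a : NamedExpr) (J : List (ℕ × ℕ)) : Bool :=
  (joinPairs i j a.labels).all fun q => q.1 == q.2 || J.any fun r => r == q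

/-- Removal of the joins all of whose edges are in `J` or created by later joins. -/
def prune : NamedExpr → List (ℕ × ℕ) → NamedExpr
  | leaf i x, _ => leaf i x
  | union a b, J => union (a.prune (b.pairs ++ J)) (b.prune J)
  | join i j a, J => bif a.redundant i j J then skip (a.prune (joinPairs i j a.labels ++ J))
      else join i j (a.prune (joinPairs i j a.labels ++ J))
  | relabel i j a, J => relabel i j (a.prune J)
  | skip a, J => skip (a.prune J)

theorem foldl_annotStep (a : NamedExpr) (S : List (List (ℕ × ℕ)))
    (O : List (Instr × List (ℕ × ℕ))) :
    a.code.foldl annotStep (S, O) = (a.labels :: S, a.annot.reverse ++ O) := by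
  induction a generalizing S O with
  | leaf i x => simp [code, annotStep, labels, annot]
  | union a b iha ihb => simp [code, iha, ihb, annotStep, labels, annot]
  | join i j a ih => simp [code, ih, annotStep, labels, annot]
  | relabel i j a ih => simp [code, ih, annotStep, labels, annot]
  | skip a ih => simp [code, ih, annotStep, labels, annot]

/-- Read backwards, the fold has collected in `J` the pairs of all later instructions. In postfix
order these include, for the left part of a union, the whole right part; hence `b.pairs ++ J` in
`prune`. -/
theorem foldl_pruneStep (a : NamedExpr) (J : List (ℕ × ℕ)) (R : List Instr) :
    a.annot.reverse.foldl pruneStep (J, R) = (a.pairs ++ J, (a.prune J).code ++ R) := by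
  induction a generalizing J R with
  | leaf i x => simp [code, pruneStep, pairs, annot, prune]
  | union a b iha ihb =>
    simp only [annot, List.reverse_append, List.reverse_singleton, List.foldl_append,
      List.foldl_cons, List.foldl_nil, pruneStep]
    simp [iha, ihb, pairs, prune, code]
  | join i j a ih =>
    simp only [annot, List.reverse_append, List.reverse_singleton, List.foldl_append,
      List.foldl_cons, List.foldl_nil, pruneStep, ih, pairs, prune, beq_self_eq_true, Bool.true_and]
    rw [← redundant]
    cases a.redundant i j J <;> simp [code]
  | relabel i j a ih =>
    simp only [annot, List.reverse_append, List.reverse_singleton, List.foldl_append,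
      List.foldl_cons, List.foldl_nil, pruneStep]
    simp [ih, pairs, prune, code]
  | skip a ih =>
    simp only [annot, List.reverse_append, List.reverse_singleton, List.foldl_append,
      List.foldl_cons, List.foldl_nil, pruneStep]
    simp [ih, pairs, prune, code]

theorem pruneCode_code (a : NamedExpr) : pruneCode a.code = (a.prune []).code := by
  rw [pruneCode, foldl_annotStep, List.append_nil, foldl_pruneStep]
  exact List.append_nil _

theorem length_code_prune (a : NamedExpr) (J : List (ℕ × ℕ)) :
    (a.prune J).code.length = a.code.length := by
  induction a generalizing J with
  | leaf i x => rfl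
  | union a b iha ihb => simp [prune, code, iha, ihb]
  | join i j a ih =>
    rw [prune]
    cases a.redundant i j J <;> simp [code, ih]
  | relabel i j a ih => simp [prune, code, ih]
  | skip a ih => simp [prune, code, ih]

theorem labels_prune (a : NamedExpr) (J : List (ℕ × ℕ)) : (a.prune J).labels = a.labels := by
  induction a generalizing J with
  | leaf i x => rfl
  | union a b iha ihb => simp [prune, labels, iha, ihb]
  | join i j a ih =>
    rw [prune]
    cases a.redundant i j J <;> simp [labels, ih]
  | relabel i j a ih => simp [prune, labels, ih]
  | skip a ih => simp [prune, labels, ih]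

/-! ### Label classes and their separation -/

/-- The names of the vertices of label `l`. -/
def cls (a : NamedExpr) (l : ℕ) : Finset ℕ :=
  ((a.labels.filter fun e => e.1 == l).map Prod.snd).toFinset

theorem mem_cls {a : NamedExpr} {l x : ℕ} : x ∈ a.cls l ↔ (l, x) ∈ a.labels := by
  simp [cls]

theorem cls_prune (a : NamedExpr) (J : List (ℕ × ℕ)) (l : ℕ) : (a.prune J).cls l = a.cls l := by
  simp [cls, labels_prune]

theorem cls_leaf (i x l : ℕ) : (leaf i x).cls l = if l = i then {x} else ∅ := by
  ext y
  split_ifs with h <;> simp [mem_cls, labels, h]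

theorem cls_union (a b : NamedExpr) (l : ℕ) : (union a b).cls l = a.cls l ∪ b.cls l := by
  ext y
  simp [mem_cls, labels]

theorem mem_cls_relabel {i j l x : ℕ} {a : NamedExpr} :
    x ∈ (relabel i j a).cls l ↔ ∃ l', x ∈ a.cls l' ∧ (if l' = i then j else l') = l := by
  simp only [mem_cls, labels, List.mem_map, Prod.exists]
  constructor
  · rintro ⟨l', y, h, e⟩
    by_cases hl : l' = i
    · simp only [hl, beq_self_eq_true, cond_true, Prod.mk.injEq] at e
      exact ⟨l', e.2 ▸ h, by simp [hl, e.1]⟩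
    · have : (l' == i) = false := by simpa using hl
      simp only [this, cond_false, Prod.mk.injEq] at e
      exact ⟨l', e.2 ▸ h, by rw [if_neg hl, e.1]⟩
  · rintro ⟨l', h, e⟩
    refine ⟨l', x, h, ?_⟩
    by_cases hl : l' = i
    · simp only [hl, if_true] at e
      simp [hl, e]
    · have : (l' == i) = false := by simpa using hl
      simp only [hl, if_false] at e
      rw [this, cond_false, e]

theorem cls_relabel {i j : ℕ} (hij : i ≠ j) (a : NamedExpr) (l : ℕ) :
    (relabel i j a).cls l = if l = i then ∅ else if l = j then a.cls j ∪ a.cls i else a.cls l := by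
  ext x
  rw [mem_cls_relabel]
  split_ifs with h1 h2
  · subst h1
    simp only [Finset.notMem_empty, iff_false, not_exists, not_and]
    intro l' _ e
    split_ifs at e with h
    · exact hij e.symm
    · exact h e
  · subst h2
    rw [Finset.mem_union]
    constructor
    · rintro ⟨l', h, e⟩
      split_ifs at e with h'
      · exact .inr (h' ▸ h)
      · exact .inl (e ▸ h)
    · rintro (h | h)
      · exact ⟨l, h, by simp [Ne.symm hij]⟩
      · exact ⟨i, h, by simp⟩
  · constructor
    · rintro ⟨l', h, e⟩
      split_ifs at e with h'
      · exact absurd e.symm h2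
      · exact e ▸ h
    · intro h
      exact ⟨l, h, by simp [h1]⟩

theorem mem_joinPairs_labels {a : NamedExpr} {i j : ℕ} {q : ℕ × ℕ} :
    q ∈ joinPairs i j a.labels ↔
      (q.1 ∈ a.cls i ∧ q.2 ∈ a.cls j) ∨ (q.2 ∈ a.cls i ∧ q.1 ∈ a.cls j) := by
  simp [mem_joinPairs, mem_cls]

/-- Two sets are disjoint or the same singleton. -/
def _root_.Separated (X Y : Finset ℕ) : Prop := Disjoint X Y ∨ ∃ u, X = {u} ∧ Y = {u}

/-- Labels are smaller than `k`, names are positive, and sets of names that are united or joined are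
separated. -/
def Good (k : ℕ) : NamedExpr → Prop
  | leaf i x => i < k ∧ x ≠ 0
  | union a b => a.Good k ∧ b.Good k ∧ ∀ l, Separated (a.cls l) (b.cls l)
  | join i j a => a.Good k ∧ i < k ∧ j < k ∧ Separated (a.cls i) (a.cls j)
  | relabel i j a => a.Good k ∧ i < k ∧ j < k ∧ i ≠ j ∧ Separated (a.cls j) (a.cls i)
  | skip a => a.Good k

theorem Good.prune {k : ℕ} {a : NamedExpr} (h : a.Good k) (J : List (ℕ × ℕ)) :
    (a.prune J).Good k := by
  induction a generalizing J with
  | leaf i x => exact h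
  | union a b iha ihb =>
    exact ⟨iha h.1 _, ihb h.2.1 _, fun l => by simpa only [cls_prune] using h.2.2 l⟩
  | join i j a ih =>
    rw [NamedExpr.prune]
    cases a.redundant i j J
    · exact ⟨ih h.1 _, h.2.1, h.2.2.1, by simpa only [cls_prune] using h.2.2.2⟩
    · exact ih h.1 _
  | relabel i j a ih =>
    exact ⟨ih h.1 _, h.2.1, h.2.2.1, h.2.2.2.1, by simpa only [cls_prune] using h.2.2.2.2⟩
  | skip a ih => exact ih h _

theorem Good.lt {k : ℕ} {a : NamedExpr} (h : a.Good k) {l x : ℕ} (hx : x ∈ a.cls l) : l < k := by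
  induction a generalizing l with
  | leaf i y =>
    rw [cls_leaf] at hx
    split_ifs at hx with hl
    · exact hl ▸ h.1
    · simp at hx
  | union a b iha ihb =>
    rw [cls_union, Finset.mem_union] at hx
    exact hx.elim (iha h.1) (ihb h.2.1)
  | join i j a ih => exact ih h.1 hx
  | relabel i j a ih =>
    obtain ⟨l', h', e⟩ := mem_cls_relabel.1 hx
    split_ifs at e
    · exact e ▸ h.2.2.1
    · exact e ▸ ih h.1 h'
  | skip a ih => exact ih h hx

/-- Every join creates only edges in `J` or of later joins, or only edges that are not. -/
def AllOrNone : NamedExpr → List (ℕ × ℕ) → Prop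
  | leaf _ _, _ => True
  | union a b, J => a.AllOrNone (b.pairs ++ J) ∧ b.AllOrNone J
  | join i j a, J => a.AllOrNone (joinPairs i j a.labels ++ J) ∧
      ((∀ q ∈ joinPairs i j a.labels, q.1 ≠ q.2 → q ∈ J) ∨
        ∀ q ∈ joinPairs i j a.labels, q.1 ≠ q.2 → q ∉ J)
  | relabel _ _ a, J => a.AllOrNone J
  | skip a, J => a.AllOrNone J

/-! ### Cuts -/

/-- The number of elements of `X` on the first side. -/
def _root_.numTrue (X : Finset ℕ) (c : ℕ → Bool) : ℕ := (X.filter fun x => c x = true).card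

/-- The number of elements of `X` on the second side. -/
def _root_.numFalse (X : Finset ℕ) (c : ℕ → Bool) : ℕ := (X.filter fun x => c x = false).card

/-- The number of pairs on different sides that the joins connect, if `χ l x` is the side of the
vertex with name `x` and label `l`. -/
def value : NamedExpr → (ℕ → ℕ → Bool) → ℕ
  | leaf _ _, _ => 0
  | union a b, χ => a.value χ + b.value χ
  | join i j a, χ => a.value χ + (numTrue (a.cls i) (χ i) * numFalse (a.cls j) (χ j) +
      numFalse (a.cls i) (χ i) * numTrue (a.cls j) (χ j))
  | relabel i j a, χ => a.value fun l => χ (if l = i then j else l)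
  | skip a, χ => a.value χ

/-- The pairs in `L` that lead from the first side to the second. -/
def _root_.cutPairs (c : ℕ → Bool) (L : List (ℕ × ℕ)) : Finset (ℕ × ℕ) :=
  L.toFinset.filter fun q => c q.1 = true ∧ c q.2 = false

theorem _root_.mem_cutPairs {c : ℕ → Bool} {L : List (ℕ × ℕ)} {q : ℕ × ℕ} :
    q ∈ cutPairs c L ↔ q ∈ L ∧ c q.1 = true ∧ c q.2 = false := by
  simp [cutPairs]

/-- The cut pairs split into those leading from class `i` to class `j` and those leading back. The
two kinds are disjoint if the classes are; if both classes are `{u}`, there are none of either kind,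
since `u` lies on one side only. -/
theorem card_cutPairs_joinPairs {a : NamedExpr} {i j : ℕ} (h : Separated (a.cls i) (a.cls j))
    (c : ℕ → Bool) : (cutPairs c (joinPairs i j a.labels)).card =
      numTrue (a.cls i) c * numFalse (a.cls j) c + numFalse (a.cls i) c * numTrue (a.cls j) c := by
  have : cutPairs c (joinPairs i j a.labels) =
      ((a.cls i).filter fun x => c x = true) ×ˢ ((a.cls j).filter fun x => c x = false) ∪
      ((a.cls j).filter fun x => c x = true) ×ˢ ((a.cls i).filter fun x => c x = false) := by
    ext ⟨x, y⟩
    simp only [mem_cutPairs, mem_joinPairs_labels, Finset.mem_union, Finset.mem_product,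
      Finset.mem_filter]
    tauto
  rw [this, Finset.card_union_of_disjoint, Finset.card_product, Finset.card_product]
  · simp only [numTrue, numFalse]; ring
  · rw [Finset.disjoint_left]
    rintro ⟨x, y⟩ h1 h2
    simp only [Finset.mem_product, Finset.mem_filter] at h1 h2
    rcases h with h | ⟨u, hi, hj⟩
    · exact Finset.disjoint_left.1 h h1.1.1 h2.1.1
    · rw [hi, Finset.mem_singleton] at h1
      rw [hi, Finset.mem_singleton] at h2
      have := h1.1.2
      rw [h1.1.1, ← h2.2.1, h2.2.2] at this
      simp at this

/-- A pair is counted at the last join that creates it, unless it is in `J`. By `AllOrNone`, a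
surviving join creates no pair of `J` and a deleted one creates only such pairs. Pairs `(x, x)` are
exempt from both conditions but are never cut. -/
theorem value_prune {k : ℕ} {a : NamedExpr} {J : List (ℕ × ℕ)} (hg : a.Good k)
    (h : a.AllOrNone J) (c : ℕ → Bool) :
    (a.prune J).value (fun _ => c) = (cutPairs c a.pairs \ J.toFinset).card := by
  induction a generalizing J with
  | leaf i x => simp [NamedExpr.prune, value, pairs, cutPairs]
  | union a b iha ihb =>
    rw [NamedExpr.prune, value, iha hg.1 h.1, ihb hg.2.1 h.2, ← Finset.card_union_of_disjoint]
    · congr 1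
      ext q
      simp only [Finset.mem_union, Finset.mem_sdiff, mem_cutPairs, List.mem_toFinset, pairs,
        List.mem_append]
      tauto
    · rw [Finset.disjoint_left]
      intro q
      simp only [Finset.mem_sdiff, mem_cutPairs, List.mem_toFinset, List.mem_append]
      tauto
  | join i j a ih =>
    have hne : ∀ q : ℕ × ℕ, c q.1 = true → c q.2 = false → q.1 ≠ q.2 := by
      intro q h1 h2 h3
      rw [h3, h2] at h1
      simp at h1
    rw [NamedExpr.prune]
    cases hr : a.redundant i j J
    · have hP : ∀ q ∈ joinPairs i j a.labels, q.1 ≠ q.2 → q ∉ J := by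
        refine h.2.resolve_left fun hall => ?_
        have : a.redundant i j J = true := by
          simp only [redundant, List.all_eq_true, Bool.or_eq_true, beq_iff_eq, List.any_eq_true,
            exists_eq_right]
          exact fun q hq => or_iff_not_imp_left.2 (hall q hq)
        simp [hr] at this
      rw [cond_false, value, ih hg.1 h.1]
      simp only [cls_prune]
      rw [← card_cutPairs_joinPairs hg.2.2.2, ← Finset.card_union_of_disjoint]
      · congr 1
        ext q
        have := hP q
        have := hne q
        simp only [Finset.mem_union, Finset.mem_sdiff, mem_cutPairs, List.mem_toFinset, pairs,
          List.mem_append]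
        tauto
      · rw [Finset.disjoint_left]
        intro q
        simp only [Finset.mem_sdiff, mem_cutPairs, List.mem_toFinset, List.mem_append]
        tauto
    · rw [cond_true, value, ih hg.1 h.1]
      congr 1
      ext q
      have h1 := hne q
      have h2 : q ∈ joinPairs i j a.labels → q.1 = q.2 ∨ q ∈ J := by
        simp only [redundant, List.all_eq_true, Bool.or_eq_true, beq_iff_eq, List.any_eq_true,
          exists_eq_right] at hr
        exact hr q
      simp only [Finset.mem_sdiff, mem_cutPairs, List.mem_toFinset, pairs, List.mem_append]
      tauto
  | relabel i j a ih => exact ih hg.1 h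
  | skip a ih => exact ih hg h

end NamedExpr

/-! ### Correctness of the dynamic program -/

/-- `r` is an element of `X`, or `0` if `X` is empty. -/
def IsRep (r : ℕ) (X : Finset ℕ) : Prop := (r = 0 ∧ X = ∅) ∨ (r ≠ 0 ∧ r ∈ X)

/-- The entry for the set `X` with the sides given by `c`. -/
def entryOf (r : ℕ) (X : Finset ℕ) (c : ℕ → Bool) : Entry := (r, numTrue X c, numFalse X c)

/-- The representative of a union. -/
def mergeRep (r s : ℕ) : ℕ := if r = 0 then s else r

theorem numTrue_congr {X : Finset ℕ} {c d : ℕ → Bool} (h : ∀ x ∈ X, c x = d x) :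
    numTrue X c = numTrue X d := by
  unfold numTrue
  congr 1
  exact Finset.filter_congr fun x hx => by rw [h x hx]

theorem numFalse_congr {X : Finset ℕ} {c d : ℕ → Bool} (h : ∀ x ∈ X, c x = d x) :
    numFalse X c = numFalse X d := by
  unfold numFalse
  congr 1
  exact Finset.filter_congr fun x hx => by rw [h x hx]

theorem entryOf_congr {r : ℕ} {X : Finset ℕ} {c d : ℕ → Bool} (h : ∀ x ∈ X, c x = d x) :
    entryOf r X c = entryOf r X d := by
  rw [entryOf, numTrue_congr h, numFalse_congr h, entryOf]

theorem IsRep.merge {r s : ℕ} {X Y : Finset ℕ} (hr : IsRep r X) (hs : IsRep s Y) :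
    IsRep (mergeRep r s) (X ∪ Y) := by
  unfold mergeRep
  rcases hr with ⟨rfl, rfl⟩ | ⟨h, hX⟩
  · simpa using hs
  · rw [if_neg h]
    exact .inr ⟨h, by simp [hX]⟩

/-- Representatives tell the two cases of `Separated` apart: for nonempty sets they are different if
the sets are disjoint and equal if both are the same singleton. The numbers are added only in the
first case. -/
theorem mergeEntry_entryOf {r s : ℕ} {X Y : Finset ℕ} (hr : IsRep r X) (hs : IsRep s Y)
    (h : Separated X Y) (c : ℕ → Bool) :
    mergeEntry (entryOf r X c) (entryOf s Y c) = entryOf (mergeRep r s) (X ∪ Y) c := by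
  unfold mergeEntry mergeRep
  rcases hr with ⟨rfl, rfl⟩ | ⟨hr, hX⟩
  · simp [entryOf]
  have hr' : (r == 0) = false := by simpa using hr
  rcases hs with ⟨rfl, rfl⟩ | ⟨hs, hY⟩
  · simp [entryOf, hr, hr']
  have hs' : (s == 0) = false := by simpa using hs
  rcases h with h | ⟨u, rfl, rfl⟩
  · have hne : (r == s) = false := by
      rw [beq_eq_false_iff_ne]
      rintro rfl
      exact Finset.disjoint_left.1 h hX hY
    have h1 : numTrue (X ∪ Y) c = numTrue X c + numTrue Y c := by
      rw [numTrue, Finset.filter_union, Finset.card_union_of_disjoint, numTrue, numTrue]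
      exact Finset.disjoint_filter_filter h
    have h2 : numFalse (X ∪ Y) c = numFalse X c + numFalse Y c := by
      rw [numFalse, Finset.filter_union, Finset.card_union_of_disjoint, numFalse, numFalse]
      exact Finset.disjoint_filter_filter h
    simp [entryOf, hr, hr', hs', hne, h1, h2]
  · rw [Finset.mem_singleton] at hX hY
    subst hX hY
    simp [entryOf, hr', hr]

/-- A common element forces both sets to be the same singleton. Its numbers are `(1, 0)` or `(0, 1)`
and so reveal its side; different sides would have produced the invalid entry. -/
theorem eq_of_mergeEntry_ne {r s : ℕ} {X Y : Finset ℕ} (hr : IsRep r X) (hs : IsRep s Y)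
    (h : Separated X Y) {c d : ℕ → Bool}
    (hm : mergeEntry (entryOf r X c) (entryOf s Y d) ≠ (0, 1, 0)) {x : ℕ} (hx : x ∈ X)
    (hy : x ∈ Y) : c x = d x := by
  rcases h with h | ⟨u, rfl, rfl⟩
  · exact absurd hy (Finset.disjoint_left.1 h hx)
  rcases hr with ⟨rfl, h⟩ | ⟨hr, hX⟩
  · simp at h
  rcases hs with ⟨rfl, h⟩ | ⟨hs, hY⟩
  · simp at h
  rw [Finset.mem_singleton] at hx hX hY
  subst hx
  subst hX
  subst hY
  have hr' : (s == 0) = false := by simpa using hr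
  simp only [mergeEntry, entryOf, hr', cond_false, beq_self_eq_true, cond_true] at hm
  cases hc : c s <;> cases hd : d s <;>
    simp_all [numTrue, numFalse, Finset.filter_singleton]
  all_goals exact hm rfl

namespace NamedExpr

/-- The name of some vertex of label `l`, or `0` if there is none. -/
def rep : NamedExpr → ℕ → ℕ
  | leaf i x, l => if l = i then x else 0
  | union a b, l => mergeRep (a.rep l) (b.rep l)
  | join _ _ a, l => a.rep l
  | relabel i j a, l => if l = i then 0 else if l = j then mergeRep (a.rep j) (a.rep i) else a.rep l
  | skip a, l => a.rep l

theorem Good.isRep {k : ℕ} {a : NamedExpr} (h : a.Good k) (l : ℕ) : IsRep (a.rep l) (a.cls l) := by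
  induction a generalizing l with
  | leaf i x =>
    rw [cls_leaf, rep]
    split_ifs
    · exact .inr ⟨h.2, by simp⟩
    · exact .inl ⟨rfl, rfl⟩
  | union a b iha ihb =>
    rw [cls_union, rep]
    exact (iha h.1 l).merge (ihb h.2.1 l)
  | join i j a ih => exact ih h.1 l
  | relabel i j a ih =>
    rw [cls_relabel h.2.2.2.1, rep]
    split_ifs
    · exact .inl ⟨rfl, rfl⟩
    · exact (ih h.1 j).merge (ih h.1 i)
    · exact ih h.1 l
  | skip a ih => exact ih h l

/-- The entry for label `l`. -/
def entry (a : NamedExpr) (χ : ℕ → ℕ → Bool) (l : ℕ) : Entry := entryOf (a.rep l) (a.cls l) (χ l)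

/-- The partial solution with the sides given by `χ`. -/
def state (k : ℕ) (a : NamedExpr) (χ : ℕ → ℕ → Bool) : CutState :=
  ((List.range k).map (a.entry χ), a.value χ)

theorem value_congr {a : NamedExpr} {χ χ' : ℕ → ℕ → Bool}
    (h : ∀ l, ∀ x ∈ a.cls l, χ l x = χ' l x) : a.value χ = a.value χ' := by
  induction a generalizing χ χ' with
  | leaf i x => rfl
  | union a b iha ihb =>
    simp only [cls_union, Finset.mem_union] at h
    rw [value, value, iha fun l x hx => h l x (.inl hx), ihb fun l x hx => h l x (.inr hx)]
  | join i j a ih =>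
    have h' : ∀ l, ∀ x ∈ a.cls l, χ l x = χ' l x := h
    rw [value, value, ih h', numTrue_congr (h' i), numTrue_congr (h' j), numFalse_congr (h' i),
      numFalse_congr (h' j)]
  | relabel i j a ih =>
    exact ih fun l x hx => h _ x (mem_cls_relabel.2 ⟨l, hx, rfl⟩)
  | skip a ih => exact ih h

theorem state_congr {k : ℕ} {a : NamedExpr} {χ χ' : ℕ → ℕ → Bool}
    (h : ∀ l, ∀ x ∈ a.cls l, χ l x = χ' l x) : a.state k χ = a.state k χ' := by
  unfold state
  rw [value_congr h]
  congr 1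
  exact List.map_congr_left fun l _ => entryOf_congr (h l)

/-- The set of partial solutions in `U`. -/
def table (k : ℕ) (U : List CutState) : NamedExpr → List CutState
  | leaf i x => restrict U (leafTable k i x)
  | union a b => restrict U (unionTable k (a.table k U) (b.table k U))
  | join i j a => restrict U (joinTable i j (a.table k U))
  | relabel i j a => restrict U (relabelTable k i j (a.table k U))
  | skip a => a.table k U

theorem foldl_tableStep (k : ℕ) (U : List CutState) (a : NamedExpr) (S : List (List CutState)) :
    a.code.foldl (tableStep k U) S = a.table k U :: S := by
  induction a generalizing S with
  | leaf i x => simp [code, tableStep, table]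
  | union a b iha ihb => simp [code, iha, ihb, tableStep, table]
  | join i j a ih => simp [code, ih, tableStep, table]
  | relabel i j a ih => simp [code, ih, tableStep, table]
  | skip a ih => simp [code, ih, tableStep, table]

theorem _root_.mem_restrict {U A : List CutState} {s : CutState} :
    s ∈ restrict U A ↔ s ∈ U ∧ s ∈ A := by
  simp [restrict]

theorem getD_map_range {k l : ℕ} (h : l < k) (f : ℕ → Entry) :
    ((List.range k).map f).getD l (0, 0, 0) = f l := by
  simp [List.getD, h]

/-- All partial solutions of subexpressions are in `U`, and no member of `U` has the entry
`(0, 1, 0)`. -/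
structure Complete (k : ℕ) (U : List CutState) (N : Finset ℕ) (m : ℕ) : Prop where
  mem : ∀ a : NamedExpr, a.Good k → (∀ l, a.cls l ⊆ N) → a.code.length ≤ m → ∀ χ, a.state k χ ∈ U
  valid : ∀ s ∈ U, (0, 1, 0) ∉ s.1

theorem mem_leafTable {k i x : ℕ} (s : CutState) :
    s ∈ leafTable k i x ↔ ∃ χ, s = (leaf i x).state k χ := by
  have hs : ∀ χ : ℕ → ℕ → Bool, (leaf i x).state k χ = ((List.range k).map fun l =>
      bif l == i then bif χ i x then (x, 1, 0) else (x, 0, 1) else (0, 0, 0), 0) := by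
    intro χ
    unfold state value
    congr 1
    refine List.map_congr_left fun l _ => ?_
    rw [entry, cls_leaf, rep]
    by_cases hl : l = i
    · subst hl
      cases h : χ l x <;> simp [entryOf, numTrue, numFalse, Finset.filter_singleton, h]
    · have : (l == i) = false := by simpa using hl
      simp [entryOf, numTrue, numFalse, hl, this]
  simp only [hs, leafTable, List.mem_cons, List.not_mem_nil, or_false]
  constructor
  · rintro (rfl | rfl)
    · exact ⟨fun _ _ => true, rfl⟩
    · exact ⟨fun _ _ => false, rfl⟩
  · rintro ⟨χ, rfl⟩
    cases χ i x
    · exact .inr rfl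
    · exact .inl rfl

/-- In one direction, side assignments of the parts are glued; they agree on common names because
members of `U` contain no invalid entry. In the other, an assignment is restricted to the parts, and
`U` loses no state that is realized. Sides are given per label and name, since below the root one
name can occur under several labels. -/
theorem mem_table {k m : ℕ} {U : List CutState} {N : Finset ℕ} (hU : Complete k U N m)
    {a : NamedExpr} (hg : a.Good k) (hN : ∀ l, a.cls l ⊆ N) (hm : a.code.length ≤ m)
    (s : CutState) : s ∈ a.table k U ↔ ∃ χ, s = a.state k χ := by
  induction a generalizing s with
  | leaf i x =>
    rw [table, mem_restrict, mem_leafTable]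
    exact ⟨fun h => h.2, fun ⟨χ, h⟩ => ⟨h ▸ hU.mem _ hg hN hm χ, χ, h⟩⟩
  | union a b iha ihb =>
    have hNa : ∀ l, a.cls l ⊆ N := fun l =>
      (Finset.subset_union_left.trans (cls_union a b l).ge).trans (hN l)
    have hNb : ∀ l, b.cls l ⊆ N := fun l =>
      (Finset.subset_union_right.trans (cls_union a b l).ge).trans (hN l)
    have hm' : a.code.length + b.code.length + 1 ≤ m := by simpa [code, add_assoc] using hm
    have iha := iha hg.1 hNa (by omega)
    have ihb := ihb hg.2.1 hNb (by omega)
    have agree : ∀ χ : ℕ → ℕ → Bool, ((List.range k).map fun l =>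
        mergeEntry ((a.state k χ).1.getD l (0, 0, 0)) ((b.state k χ).1.getD l (0, 0, 0)),
        (a.state k χ).2 + (b.state k χ).2) = (union a b).state k χ := by
      intro χ
      unfold state
      rw [value]
      congr 1
      refine List.map_congr_left fun l hl => ?_
      rw [List.mem_range] at hl
      rw [getD_map_range hl, getD_map_range hl, entry, entry, entry, cls_union, rep]
      exact mergeEntry_entryOf (hg.1.isRep l) (hg.2.1.isRep l) (hg.2.2 l) (χ l)
    simp only [table, mem_restrict, unionTable, List.mem_flatMap, List.mem_map]
    constructor
    · rintro ⟨hs, s₁, h₁, s₂, h₂, rfl⟩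
      obtain ⟨χ₁, rfl⟩ := (iha s₁).1 h₁
      obtain ⟨χ₂, rfl⟩ := (ihb s₂).1 h₂
      -- On names of both parts the choice is immaterial, as `e₂` shows.
      let χ : ℕ → ℕ → Bool := fun l x => if x ∈ a.cls l then χ₁ l x else χ₂ l x
      have e₁ : a.state k χ₁ = a.state k χ := state_congr fun l x hx => by simp [χ, hx]
      have e₂ : b.state k χ₂ = b.state k χ := state_congr fun l x hx => by
        by_cases hxa : x ∈ a.cls l
        · have hl : l < k := hg.2.1.lt hx
          simp only [χ, hxa, if_true]
          refine (eq_of_mergeEntry_ne (hg.1.isRep l) (hg.2.1.isRep l) (hg.2.2 l)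
            (fun h => hU.valid _ hs ?_) hxa hx).symm
          refine List.mem_map.2 ⟨l, List.mem_range.2 hl, ?_⟩
          rw [state, state, getD_map_range hl, getD_map_range hl]
          exact h
        · simp [χ, hxa]
      exact ⟨χ, by rw [e₁, e₂, agree]⟩
    · rintro ⟨χ, rfl⟩
      exact ⟨hU.mem _ hg hN hm χ, _, (iha _).2 ⟨χ, rfl⟩, _, (ihb _).2 ⟨χ, rfl⟩, agree χ⟩
  | join i j a ih =>
    have hm' : a.code.length + 1 ≤ m := by simpa [code] using hm
    have ih := ih hg.1 hN (by omega)
    have agree : ∀ χ : ℕ → ℕ → Bool, ((a.state k χ).1, (a.state k χ).2 +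
        (((a.state k χ).1.getD i (0, 0, 0)).2.1 * ((a.state k χ).1.getD j (0, 0, 0)).2.2 +
        ((a.state k χ).1.getD i (0, 0, 0)).2.2 * ((a.state k χ).1.getD j (0, 0, 0)).2.1)) =
        (join i j a).state k χ := by
      intro χ
      unfold state
      rw [value, getD_map_range hg.2.1, getD_map_range hg.2.2.1]
      rfl
    simp only [table, mem_restrict, joinTable, List.mem_map]
    constructor
    · rintro ⟨hs, s₁, h₁, rfl⟩
      obtain ⟨χ, rfl⟩ := (ih s₁).1 h₁
      exact ⟨χ, agree χ⟩
    · rintro ⟨χ, rfl⟩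
      exact ⟨hU.mem _ hg hN hm χ, _, (ih _).2 ⟨χ, rfl⟩, agree χ⟩
  | relabel i j a ih =>
    have hm' : a.code.length + 1 ≤ m := by simpa [code] using hm
    have hij := hg.2.2.2.1
    have hNa : ∀ l, a.cls l ⊆ N := fun l x hx => hN _ (mem_cls_relabel.2 ⟨l, hx, rfl⟩)
    have ih := ih hg.1 hNa (by omega)
    have agree : ∀ χ : ℕ → ℕ → Bool,
        ((List.range k).map fun l => bif l == i then ((0, 0, 0) : Entry) else
          bif l == j then mergeEntry
            ((a.state k fun l => χ (if l = i then j else l)).1.getD j (0, 0, 0))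
            ((a.state k fun l => χ (if l = i then j else l)).1.getD i (0, 0, 0))
          else (a.state k fun l => χ (if l = i then j else l)).1.getD l (0, 0, 0),
          (a.state k fun l => χ (if l = i then j else l)).2) = (relabel i j a).state k χ := by
      intro χ
      unfold state
      congr 1
      refine List.map_congr_left fun l hl => ?_
      rw [List.mem_range] at hl
      rw [getD_map_range hg.2.1, getD_map_range hg.2.2.1, getD_map_range hl, entry, entry, entry,
        entry, cls_relabel hij, rep]
      simp only [cond_eq_ite, beq_iff_eq]
      split_ifs with h1 h2 h3
      · rfl
      · exact absurd h3 hij.symm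
      · subst h2
        exact mergeEntry_entryOf (hg.1.isRep l) (hg.1.isRep i) hg.2.2.2.2 (χ l)
      · rfl
    simp only [table, mem_restrict, relabelTable, List.mem_map]
    constructor
    · rintro ⟨hs, s₁, h₁, rfl⟩
      obtain ⟨χ₁, rfl⟩ := (ih s₁).1 h₁
      -- Label `j` now collects two classes. A name from both takes its side under `j`, which equals
      -- its side under `i` by validity.
      let χ : ℕ → ℕ → Bool := fun l x =>
        if l = j then if x ∈ a.cls j then χ₁ j x else χ₁ i x else χ₁ l x
      have e₁ : a.state k χ₁ = a.state k fun l => χ (if l = i then j else l) := by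
        refine state_congr fun l x hx => ?_
        by_cases hli : l = i
        · subst hli
          by_cases hxj : x ∈ a.cls j
          · simp only [χ, hxj, if_true]
            refine (eq_of_mergeEntry_ne (hg.1.isRep j) (hg.1.isRep l) hg.2.2.2.2
              (fun h => hU.valid _ hs ?_) hxj hx).symm
            refine List.mem_map.2 ⟨j, List.mem_range.2 hg.2.2.1, ?_⟩
            rw [state, getD_map_range hg.2.1, getD_map_range hg.2.2.1]
            have : (j == l) = false := by simpa using hij.symm
            rw [this, cond_false, beq_self_eq_true, cond_true]
            exact h
          · simp [χ, hxj]
        · by_cases hlj : l = j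
          · subst hlj
            simp [χ, hli, hx]
          · simp [χ, hli, hlj]
      exact ⟨χ, by rw [e₁]; exact agree χ⟩
    · rintro ⟨χ, rfl⟩
      exact ⟨hU.mem _ hg hN hm χ, _, (ih _).2 ⟨_, rfl⟩, agree χ⟩
  | skip a ih =>
    have hm' : a.code.length + 1 ≤ m := by simpa [code] using hm
    exact ih hg hN (by omega) s

/-! ### The universe of partial solutions is complete -/

theorem value_le {a : NamedExpr} {N : Finset ℕ} (hN : ∀ l, a.cls l ⊆ N) (χ : ℕ → ℕ → Bool) :
    a.value χ ≤ a.code.length * (2 * (N.card * N.card)) := by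
  induction a generalizing χ with
  | leaf i x => simp [value]
  | union a b iha ihb =>
    have h1 := iha (fun l => (Finset.subset_union_left.trans (cls_union a b l).ge).trans (hN l)) χ
    have h2 := ihb (fun l => (Finset.subset_union_right.trans (cls_union a b l).ge).trans (hN l)) χ
    simp only [value, code, List.length_append, add_mul]
    omega
  | join i j a ih =>
    have h1 := ih hN χ
    have hT : ∀ l c, numTrue (a.cls l) c ≤ N.card := fun l c =>
      (Finset.card_filter_le _ _).trans (Finset.card_le_card (hN l))
    have hF : ∀ l c, numFalse (a.cls l) c ≤ N.card := fun l c =>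
      (Finset.card_filter_le _ _).trans (Finset.card_le_card (hN l))
    have h2 := Nat.mul_le_mul (hT i (χ i)) (hF j (χ j))
    have h3 := Nat.mul_le_mul (hF i (χ i)) (hT j (χ j))
    simp only [value, code, List.length_append, add_mul, List.length_singleton, one_mul]
    omega
  | relabel i j a ih =>
    have h1 := ih (fun l x hx => hN _ (mem_cls_relabel.2 ⟨l, hx, rfl⟩))
      fun l => χ (if l = i then j else l)
    simp only [value, code, List.length_append, add_mul]
    omega
  | skip a ih =>
    have h1 := ih hN χ
    simp only [value, code, List.length_append, add_mul]
    omega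

theorem _root_.mem_entries {names : List ℕ} (h : names.tail.isEmpty = false) {e : Entry} :
    e ∈ entries names ↔ e = (0, 0, 0) ∨
      (e.1 ∈ names ∧ e.2.1 ≤ names.length ∧ e.2.2 ≤ names.length) := by
  obtain ⟨x, s, f⟩ := e
  simp only [entries, h, cond_false, List.mem_cons, List.mem_flatMap, List.mem_range, List.mem_map,
    Prod.mk.injEq, Nat.lt_succ_iff]
  constructor
  · rintro (h | ⟨x, h1, s, h2, f, h3, rfl, rfl, rfl⟩)
    · exact .inl h
    · exact .inr ⟨h1, h2, h3⟩
  · rintro (h | ⟨h1, h2, h3⟩)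
    · exact .inl h
    · exact .inr ⟨x, h1, s, h2, f, h3, rfl, rfl, rfl⟩

/-- All numbers in realized states are within the enumerated ranges by `value_le` and the sizes of
the classes. The invalid entry `(0, 1, 0)` is not enumerated: its first component is `0`, which is
no name, and only `(0, 0, 0)` may have it. -/
theorem complete_allStates {k : ℕ} {l : List Instr} {names : List ℕ}
    (h : names.tail.isEmpty = false) (hd : names.Nodup) (h0 : 0 ∉ names) :
    Complete k (allStates l names k) names.toFinset l.length := by
  have hcard : names.toFinset.card = names.length := List.toFinset_card_of_nodup hd
  constructor
  · intro a hg hN hm χ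
    simp only [allStates, List.mem_flatMap, List.mem_map, List.mem_range, state, Prod.mk.injEq]
    refine ⟨_, mem_vectors.2 ⟨?_, ?_⟩, a.value χ, ?_, rfl, rfl⟩
    · simp
    · intro e he
      obtain ⟨i, -, rfl⟩ := List.mem_map.1 he
      rw [mem_entries h]
      have hT : numTrue (a.cls i) (χ i) ≤ names.length :=
        (Finset.card_filter_le _ _).trans ((Finset.card_le_card (hN i)).trans hcard.le)
      have hF : numFalse (a.cls i) (χ i) ≤ names.length :=
        (Finset.card_filter_le _ _).trans ((Finset.card_le_card (hN i)).trans hcard.le)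
      rcases hg.isRep i with ⟨h1, h2⟩ | ⟨h1, h2⟩
      · exact .inl (by simp [entry, entryOf, h1, h2, numTrue, numFalse])
      · exact .inr ⟨List.mem_toFinset.1 (hN i h2), hT, hF⟩
    · rw [Nat.lt_succ_iff, cutBound]
      refine (value_le hN χ).trans ?_
      rw [hcard]
      gcongr
  · intro s hs hbad
    simp only [allStates, List.mem_flatMap, List.mem_map] at hs
    obtain ⟨v, hv, w, -, rfl⟩ := hs
    rcases (mem_entries h).1 ((mem_vectors.1 hv).2 _ hbad) with h | h
    · simp at h
    · exact h0 h.1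

/-! ### Vertex names and the final optimum -/

theorem codeNames_spec (l : List Instr) :
    (codeNames l).Nodup ∧ ∀ x, x ∈ codeNames l ↔ ∃ i, (0, i, x) ∈ l := by
  have key : ∀ l : List Instr,
      (l.foldl (fun r c => bif r.any fun x => x == c.2.2 then r else c.2.2 :: r) []).Nodup ∧
      ∀ x, x ∈ l.foldl (fun r c => bif r.any fun x => x == c.2.2 then r else c.2.2 :: r) [] ↔
        ∃ c ∈ l, c.2.2 = x := by
    intro l
    induction l using List.reverseRecOn with
    | nil => simp
    | append_singleton l c ih =>
      rw [List.foldl_append, List.foldl_cons, List.foldl_nil]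
      generalize l.foldl (fun r c => bif r.any fun x => x == c.2.2 then r else c.2.2 :: r) [] = r
        at ih ⊢
      simp only [cond_eq_ite, List.any_eq_true, beq_iff_eq, exists_eq_right]
      split_ifs with h
      · refine ⟨ih.1, fun x => ?_⟩
        rw [ih.2]
        constructor
        · rintro ⟨d, hd, rfl⟩
          exact ⟨d, by simp [hd], rfl⟩
        · rintro ⟨d, hd, rfl⟩
          rcases List.mem_append.1 hd with hd | hd
          · exact ⟨d, hd, rfl⟩
          · rw [List.mem_singleton] at hd
            exact (ih.2 _).1 (hd ▸ h)
      · refine ⟨List.nodup_cons.2 ⟨h, ih.1⟩, fun x => ?_⟩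
        simp only [List.mem_cons, ih.2, List.mem_append, List.not_mem_nil, or_false]
        constructor
        · rintro (rfl | ⟨d, hd, rfl⟩)
          · exact ⟨c, .inr rfl, rfl⟩
          · exact ⟨d, .inl hd, rfl⟩
        · rintro ⟨d, hd | rfl, rfl⟩
          · exact .inr ⟨d, hd, rfl⟩
          · exact .inl rfl
  refine ⟨(key _).1, fun x => ((key _).2 x).trans ?_⟩
  constructor
  · rintro ⟨⟨o, i, y⟩, hc, rfl⟩
    simp only [List.mem_filter, beq_iff_eq] at hc
    obtain ⟨hc, rfl⟩ := hc
    exact ⟨i, hc⟩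
  · rintro ⟨i, h⟩
    exact ⟨(0, i, x), by simp [h], rfl⟩

theorem mem_codeNames {a : NamedExpr} {x : ℕ} : x ∈ codeNames a.code ↔ ∃ l, x ∈ a.cls l := by
  rw [(codeNames_spec _).2]
  induction a with
  | leaf i y => simp [code, mem_cls, labels]
  | union a b iha ihb =>
    simp only [code, cls_union, Finset.mem_union, exists_or, ← iha, ← ihb]
    simp [exists_or]
  | join i j a ih =>
    refine Iff.trans ?_ ih
    simp [code]
  | relabel i j a ih =>
    have : (∃ l, x ∈ (relabel i j a).cls l) ↔ ∃ l, x ∈ a.cls l := by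
      simp only [mem_cls_relabel]
      exact ⟨fun ⟨_, l, h, _⟩ => ⟨l, h⟩, fun ⟨l, h⟩ => ⟨_, l, h, rfl⟩⟩
    rw [this, ← ih]
    simp [code]
  | skip a ih =>
    refine Iff.trans ?_ ih
    simp [code]

theorem Good.ne_zero {k : ℕ} {a : NamedExpr} (h : a.Good k) {l x : ℕ} (hx : x ∈ a.cls l) :
    x ≠ 0 := by
  induction a generalizing l with
  | leaf i y =>
    rw [cls_leaf] at hx
    split_ifs at hx
    · rw [Finset.mem_singleton.1 hx]
      exact h.2
    · simp at hx
  | union a b iha ihb =>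
    rw [cls_union, Finset.mem_union] at hx
    exact hx.elim (iha h.1) (ihb h.2.1)
  | join i j a ih => exact ih h.1 hx
  | relabel i j a ih =>
    obtain ⟨l', h', -⟩ := mem_cls_relabel.1 hx
    exact ih h.1 h'
  | skip a ih => exact ih h hx

theorem _root_.bestValue_spec (A : List CutState) (b : ℕ) (hb : ∀ s ∈ A, s.2 ≤ b) (hA : A ≠ []) :
    IsGreatest {w | ∃ s ∈ A, s.2 = w} (bestValue A b) := by
  -- The candidates are scanned in increasing order, so the last hit is the maximum of those below
  -- `n`.
  have key : ∀ n, (∀ s ∈ A, s.2 < n → s.2 ≤ (List.range n).foldl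
      (fun r w => bif A.any fun s => s.2 == w then w else r) 0) ∧
      ((∃ s ∈ A, s.2 < n) → ∃ s ∈ A, s.2 = (List.range n).foldl
      (fun r w => bif A.any fun s => s.2 == w then w else r) 0) := by
    intro n
    induction n with
    | zero => simp
    | succ n ih =>
      rw [List.range_succ, List.foldl_append, List.foldl_cons, List.foldl_nil]
      generalize (List.range n).foldl (fun r w => bif A.any fun s => s.2 == w then w else r) 0 = r
        at ih ⊢
      simp only [cond_eq_ite, List.any_eq_true, beq_iff_eq]
      split_ifs with h
      · exact ⟨fun s _ hs => by omega, fun _ => h⟩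
      · refine ⟨fun s hs hn => ih.1 s hs ?_, fun ⟨s, hs, hn⟩ => ih.2 ⟨s, hs, ?_⟩⟩ <;>
        · have : s.2 ≠ n := fun e => h ⟨s, hs, e⟩
          omega
  obtain ⟨s, hs⟩ := List.exists_mem_of_ne_nil A hA
  refine ⟨(key (b + 1)).2 ⟨s, hs, Nat.lt_succ_of_le (hb s hs)⟩, ?_⟩
  rintro w ⟨s, hs, rfl⟩
  exact (key (b + 1)).1 s hs (Nat.lt_succ_of_le (hb s hs))

/-- The algorithm computes the maximum number of pairs from the first side to the second. -/
theorem codeMaxCut_spec {k : ℕ} {a : NamedExpr} (hg : a.Good k) (ha : a.AllOrNone [])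
    (hl : ∀ l l' x, x ∈ a.cls l → x ∈ a.cls l' → l = l')
    (hn : 2 ≤ (codeNames a.code).length) :
    IsGreatest (Set.range fun c : ℕ → Bool => (cutPairs c a.pairs).card) (codeMaxCut k a.code) := by
  have hne : (codeNames a.code).tail.isEmpty = false := by
    match h : codeNames a.code with
    | [] => simp [h] at hn
    | [_] => simp [h] at hn
    | _ :: _ :: _ => rfl
  have hU : Complete k (allStates a.code (codeNames a.code) k) (codeNames a.code).toFinset
      a.code.length := complete_allStates hne (codeNames_spec _).1 fun h0 => by
    obtain ⟨l, hl⟩ := mem_codeNames.1 h0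
    exact hg.ne_zero hl rfl
  have hg' := hg.prune []
  have hN : ∀ l, (a.prune []).cls l ⊆ (codeNames a.code).toFinset := fun l x hx => by
    rw [cls_prune] at hx
    exact List.mem_toFinset.2 (mem_codeNames.2 ⟨l, hx⟩)
  have hm := (length_code_prune a []).le
  have htab := mem_table hU hg' hN hm
  have hcut : codeMaxCut k a.code = bestValue ((a.prune []).table k
      (allStates a.code (codeNames a.code) k)) (cutBound a.code (codeNames a.code)) := by
    simp only [codeMaxCut, hne, cond_false, pruneCode_code, foldl_tableStep, List.headD_cons]
  have hb := bestValue_spec ((a.prune []).table k (allStates a.code (codeNames a.code) k))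
    (cutBound a.code (codeNames a.code)) (fun s hs => by
      obtain ⟨χ, rfl⟩ := (htab s).1 hs
      refine (value_le hN χ).trans ?_
      rw [cutBound, length_code_prune, List.toFinset_card_of_nodup (codeNames_spec _).1])
    (List.ne_nil_of_mem ((htab _).2 ⟨fun _ _ => true, rfl⟩))
  rw [hcut]
  convert hb using 1
  ext w
  simp only [Set.mem_range, Set.mem_ofPred_eq]
  have hval : ∀ c : ℕ → Bool, (a.prune []).value (fun _ => c) = (cutPairs c a.pairs).card :=
    fun c => by rw [value_prune hg ha]; simp
  constructor
  · rintro ⟨c, rfl⟩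
    exact ⟨_, (htab _).2 ⟨fun _ => c, rfl⟩, hval c⟩
  · rintro ⟨s, hs, rfl⟩
    obtain ⟨χ, rfl⟩ := (htab s).1 hs
    classical
    -- By `hl` a name has only one label here, so sides per label and name become sides of names.
    let c : ℕ → Bool := fun x => if h : ∃ l, x ∈ a.cls l then χ h.choose x else false
    refine ⟨c, (hval c).symm.trans (value_congr fun l x hx => ?_)⟩
    rw [cls_prune] at hx
    have h : ∃ l, x ∈ a.cls l := ⟨l, hx⟩
    simp only [c, h, dif_pos]
    rw [hl _ _ _ h.choose_spec hx]

end NamedExpr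

/-! ## Correctness of the translation -/

namespace FuseExpr

open NamedExpr

variable {k : ℕ}

theorem newName_le {δ : ℕ → ℕ} {p : ℕ} (hδ : ∀ l, δ l ≤ p) (i : ℕ) : newName δ i p ≤ p + 1 := by
  unfold newName
  split_ifs
  · exact le_rfl
  · exact (hδ i).trans (by omega)

theorem newName_ne_zero (δ : ℕ → ℕ) (i p : ℕ) : newName δ i p ≠ 0 := by
  unfold newName
  split_ifs with h
  · omega
  · exact h

theorem update_newName_le {δ : ℕ → ℕ} {p : ℕ} (hδ : ∀ l, δ l ≤ p) (i : ℕ) (l : ℕ) :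
    Function.update δ i (newName δ i p) l ≤ p + 1 := by
  rw [Function.update_apply]
  split_ifs
  · exact newName_le hδ i
  · exact (hδ l).trans (by omega)

theorem update_label_le {δ : ℕ → ℕ} {p : ℕ} (hδ : ∀ l, δ l ≤ p) (i j : ℕ) (l : ℕ) :
    Function.update δ i (δ j) l ≤ p + 1 := by
  rw [Function.update_apply]
  split_ifs
  · exact (hδ j).trans (by omega)
  · exact (hδ l).trans (by omega)

theorem update_label_apply (δ : ℕ → ℕ) (i j l : ℕ) :
    Function.update δ i (δ j) l = δ (if l = i then j else l) := by
  rw [Function.update_apply]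
  split_ifs <;> rfl

/-- The names of the vertices of label `l`: only `δ l` if `δ l ≠ 0`, and otherwise new names. -/
theorem name_spec (φ : FuseExpr k) {δ : ℕ → ℕ} {p : ℕ} (hδ : ∀ l, δ l ≤ p) {l x : ℕ}
    (hx : x ∈ (φ.toNamed δ p).cls l) :
    (δ l ≠ 0 ∧ x = δ l) ∨ (δ l = 0 ∧ p < x ∧ x ≤ p + φ.size) := by
  induction φ generalizing δ p l with
  | intro i =>
    rw [toNamed, cls_leaf] at hx
    split_ifs at hx with h
    · subst h
      rw [Finset.mem_singleton, newName] at hx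
      split_ifs at hx with h0
      · exact .inr ⟨h0, by simp only [size]; omega⟩
      · exact .inl ⟨h0, hx⟩
    · simp at hx
  | union a b iha ihb =>
    rw [toNamed, cls_union, Finset.mem_union] at hx
    rcases hx with hx | hx
    · rcases iha (fun l => (hδ l).trans (by omega)) hx with h | h
      · exact .inl h
      · exact .inr ⟨h.1, by simp only [size]; omega⟩
    · rcases ihb (fun l => (hδ l).trans (by omega)) hx with h | h
      · exact .inl h
      · exact .inr ⟨h.1, by simp only [size]; omega⟩
  | join i j a ih =>
    rcases ih (fun l => (hδ l).trans (by omega)) hx with h | h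
    · exact .inl h
    · exact .inr ⟨h.1, by simp only [size]; omega⟩
  | relabel i j a ih =>
    obtain ⟨l', h', e⟩ := mem_cls_relabel.1 hx
    have := ih (update_label_le hδ i j) h'
    rw [update_label_apply, e] at this
    rcases this with h | h
    · exact .inl h
    · exact .inr ⟨h.1, by simp only [size]; omega⟩
  | fuse i a ih =>
    have := ih (update_newName_le hδ i) hx
    rw [Function.update_apply] at this
    simp only [size]
    split_ifs at this with hl
    · subst hl
      have hx : x = newName δ i p := (this.resolve_right fun h => newName_ne_zero _ _ _ h.1).2
      rw [newName] at hx
      split_ifs at hx with h0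
      · exact .inr ⟨h0, by omega⟩
      · exact .inl ⟨h0, hx⟩
    · rcases this with h | h
      · exact .inl h
      · exact .inr ⟨h.1, by omega⟩

/-- A new name occurs with only one label. -/
theorem label_unique (φ : FuseExpr k) {δ : ℕ → ℕ} {p : ℕ} (hδ : ∀ l, δ l ≤ p) {l m x : ℕ}
    (hl : δ l = 0) (hx : x ∈ (φ.toNamed δ p).cls l) (hx' : x ∈ (φ.toNamed δ p).cls m) : m = l := by
  induction φ generalizing δ p l m with
  | intro i =>
    rw [toNamed, cls_leaf] at hx hx'
    split_ifs at hx hx' with h1 h2 <;> simp_all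
  | union a b iha ihb =>
    have hδa : ∀ l, δ l ≤ p + 1 + b.size := fun l => (hδ l).trans (by omega)
    have hδb : ∀ l, δ l ≤ p + 1 := fun l => (hδ l).trans (by omega)
    rw [toNamed, cls_union, Finset.mem_union] at hx hx'
    have h1 := hδ m
    rcases hx with hx | hx <;> rcases hx' with hx' | hx'
    · exact iha hδa hl hx hx'
    · have := a.name_spec hδa hx
      have := b.name_spec hδb hx'
      omega
    · have := b.name_spec hδb hx
      have := a.name_spec hδa hx'
      omega
    · exact ihb hδb hl hx hx'
  | join i j a ih => exact ih (fun l => (hδ l).trans (by omega)) hl hx hx'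
  | relabel i j a ih =>
    obtain ⟨l', h', e⟩ := mem_cls_relabel.1 hx
    obtain ⟨m', h'', e'⟩ := mem_cls_relabel.1 hx'
    have := ih (update_label_le hδ i j) (l := l') (by rw [update_label_apply, e, hl]) h' h''
    rw [← e, ← e', this]
  | fuse i a ih =>
    have s1 := a.name_spec (update_newName_le hδ i) hx
    have s2 := a.name_spec (update_newName_le hδ i) hx'
    by_cases h1 : l = i
    · by_cases h2 : m = i
      · rw [h1, h2]
      · subst h1
        rw [Function.update_self] at s1
        rw [Function.update_of_ne h2] at s2
        have := hδ m
        have e : newName δ i p = p + 1 := by rw [newName, if_pos hl]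
        omega
    · exact ih (update_newName_le hδ i) (by rw [Function.update_of_ne h1, hl]) hx hx'

/-- Either the names of label `l` occur under no other label, or there is at most one such name,
namely `δ l`. So two classes that meet are equal. -/
theorem cls_closed (φ : FuseExpr k) {δ : ℕ → ℕ} {p : ℕ} (hδ : ∀ l, δ l ≤ p) {l m x y : ℕ}
    (hx : x ∈ (φ.toNamed δ p).cls l) (hy : y ∈ (φ.toNamed δ p).cls l)
    (hx' : x ∈ (φ.toNamed δ p).cls m) : y ∈ (φ.toNamed δ p).cls m := by
  by_cases h : δ l = 0
  · rwa [label_unique φ hδ h hx hx']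
  · have h1 := φ.name_spec hδ hx
    have h2 := φ.name_spec hδ hy
    have : y = x := by omega
    rwa [this]

theorem separated_of_subsingleton {X Y : Finset ℕ} {u v : ℕ} (hX : ∀ x ∈ X, x = u)
    (hY : ∀ y ∈ Y, y = v) : Separated X Y := by
  by_cases h : Disjoint X Y
  · exact .inl h
  · obtain ⟨x, hx, hy⟩ := Finset.not_disjoint_iff.1 h
    refine .inr ⟨x, ?_, ?_⟩
    · ext z
      rw [Finset.mem_singleton]
      exact ⟨fun hz => (hX z hz).trans (hX x hx).symm, fun hz => hz ▸ hx⟩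
    · ext z
      rw [Finset.mem_singleton]
      exact ⟨fun hz => (hY z hz).trans (hY x hy).symm, fun hz => hz ▸ hy⟩

theorem separated_labels (φ : FuseExpr k) {δ : ℕ → ℕ} {p : ℕ} (hδ : ∀ l, δ l ≤ p) {l m : ℕ}
    (h : l ≠ m) : Separated ((φ.toNamed δ p).cls l) ((φ.toNamed δ p).cls m) := by
  by_cases hl : δ l = 0
  · exact .inl (Finset.disjoint_left.2 fun x hx hx' => h (label_unique φ hδ hl hx hx').symm)
  by_cases hm : δ m = 0
  · exact .inl (Finset.disjoint_left.2 fun x hx hx' => h (label_unique φ hδ hm hx' hx))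
  · exact separated_of_subsingleton
      (fun x hx => ((φ.name_spec hδ hx).resolve_right fun h => hl h.1).2)
      (fun x hx => ((φ.name_spec hδ hx).resolve_right fun h => hm h.1).2)

/-- For a union, new names of `b` are at most `p + 1 + b.size` and new names of `a` are larger, so
for `δ l = 0` the classes are disjoint; otherwise both contain at most `δ l`. Two different labels
of one expression are treated by `separated_labels`. -/
theorem good_toNamed {φ : FuseExpr k} (hφ : φ.WellFormed) {δ : ℕ → ℕ} {p : ℕ} (hδ : ∀ l, δ l ≤ p) :
    (φ.toNamed δ p).Good k := by
  induction φ generalizing δ p with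
  | intro i => exact ⟨i.2, newName_ne_zero _ _ _⟩
  | union a b iha ihb =>
    have hδa : ∀ l, δ l ≤ p + 1 + b.size := fun l => (hδ l).trans (by omega)
    have hδb : ∀ l, δ l ≤ p + 1 := fun l => (hδ l).trans (by omega)
    refine ⟨iha hφ.1 hδa, ihb hφ.2 hδb, fun l => ?_⟩
    by_cases hl : δ l = 0
    · refine .inl (Finset.disjoint_left.2 fun x hx hx' => ?_)
      have := a.name_spec hδa hx
      have := b.name_spec hδb hx'
      omega
    · exact separated_of_subsingleton
        (fun x hx => ((a.name_spec hδa hx).resolve_right fun h => hl h.1).2)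
        (fun x hx => ((b.name_spec hδb hx).resolve_right fun h => hl h.1).2)
  | join i j a ih =>
    have hδa : ∀ l, δ l ≤ p + 1 := fun l => (hδ l).trans (by omega)
    exact ⟨ih hφ.2 hδa, i.2, j.2, separated_labels a hδa (Fin.val_ne_of_ne hφ.1)⟩
  | relabel i j a ih =>
    exact ⟨ih hφ.2 (update_label_le hδ i j), i.2, j.2, Fin.val_ne_of_ne hφ.1,
      separated_labels a (update_label_le hδ i j) (Fin.val_ne_of_ne hφ.1).symm⟩
  | fuse i a ih => exact ih hφ.2 (update_newName_le hδ i)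

theorem exists_mem_cls_of_mem_pairs {a : NamedExpr} {q : ℕ × ℕ} (h : q ∈ a.pairs) :
    (∃ l, q.1 ∈ a.cls l) ∧ ∃ l, q.2 ∈ a.cls l := by
  induction a with
  | leaf i x => simp [pairs] at h
  | union a b iha ihb =>
    simp only [cls_union, Finset.mem_union]
    rcases List.mem_append.1 h with h | h
    · obtain ⟨⟨l, h1⟩, m, h2⟩ := iha h
      exact ⟨⟨l, .inl h1⟩, m, .inl h2⟩
    · obtain ⟨⟨l, h1⟩, m, h2⟩ := ihb h
      exact ⟨⟨l, .inr h1⟩, m, .inr h2⟩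
  | join i j a ih =>
    rcases List.mem_append.1 h with h | h
    · exact ih h
    · rcases mem_joinPairs_labels.1 h with h | h
      · exact ⟨⟨i, h.1⟩, j, h.2⟩
      · exact ⟨⟨j, h.2⟩, i, h.1⟩
  | relabel i j a ih =>
    obtain ⟨⟨l, h1⟩, m, h2⟩ := ih h
    exact ⟨⟨_, mem_cls_relabel.2 ⟨l, h1, rfl⟩⟩, _, mem_cls_relabel.2 ⟨m, h2, rfl⟩⟩
  | skip a ih => exact ih h

theorem pairs_symm {a : NamedExpr} {x y : ℕ} (h : (x, y) ∈ a.pairs) : (y, x) ∈ a.pairs := by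
  induction a with
  | leaf i x => simp [pairs] at h
  | union a b iha ihb =>
    rcases List.mem_append.1 h with h | h
    · exact List.mem_append_left _ (iha h)
    · exact List.mem_append_right _ (ihb h)
  | join i j a ih =>
    rcases List.mem_append.1 h with h | h
    · exact List.mem_append_left _ (ih h)
    · exact List.mem_append_right _ (mem_joinPairs.2 (mem_joinPairs.1 h).symm)
  | relabel i j a ih => exact ih h
  | skip a ih => exact ih h

/-- Whether a pair of different names is in `J` depends only on the labels. -/
def LabelInvariant (a : NamedExpr) (J : List (ℕ × ℕ)) : Prop :=
  ∀ l m x x' y y', x ∈ a.cls l → x' ∈ a.cls l → y ∈ a.cls m → y' ∈ a.cls m → x' ≠ y' →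
    (x, y) ∈ J → (x', y') ∈ J

/-- All pairs of a join have the same two labels, so by `LabelInvariant` and symmetry one pair of
different names in `J` brings all others into `J`. It remains to keep `J` invariant on the way down:
pairs of a join are closed under exchanging names of the same label by `cls_closed`, and pairs from
the other part of a union are harmless by `key`. -/
theorem allOrNone_toNamed (φ : FuseExpr k) {δ : ℕ → ℕ} {p : ℕ} (hδ : ∀ l, δ l ≤ p)
    {J : List (ℕ × ℕ)} (hsymm : ∀ x y, (x, y) ∈ J → (y, x) ∈ J)
    (hJ : LabelInvariant (φ.toNamed δ p) J) : (φ.toNamed δ p).AllOrNone J := by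
  induction φ generalizing δ p J with
  | intro i => trivial
  | union a b iha ihb =>
    have hδa : ∀ l, δ l ≤ p + 1 + b.size := fun l => (hδ l).trans (by omega)
    have hδb : ∀ l, δ l ≤ p + 1 := fun l => (hδ l).trans (by omega)
    have hsub : ∀ l x, x ∈ (a.toNamed δ (p + 1 + b.size)).cls l →
        x ∈ ((union a b).toNamed δ p).cls l := fun l x h => by
      rw [toNamed, cls_union]; exact Finset.mem_union_left _ h
    have hsub' : ∀ l x, x ∈ (b.toNamed δ (p + 1)).cls l →
        x ∈ ((union a b).toNamed δ p).cls l := fun l x h => by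
      rw [toNamed, cls_union]; exact Finset.mem_union_right _ h
    -- A name that occurs in both parts is a value of `δ`, hence alone in its class in `a`.
    have key : ∀ l x x', x ∈ (a.toNamed δ (p + 1 + b.size)).cls l →
        x' ∈ (a.toNamed δ (p + 1 + b.size)).cls l → (∃ m, x ∈ (b.toNamed δ (p + 1)).cls m) →
        x' = x := by
      rintro l x x' hx hx' ⟨m, hm⟩
      have h1 := a.name_spec hδa hx
      have h2 := a.name_spec hδa hx'
      have h3 := b.name_spec hδb hm
      have := hδ m
      omega
    refine ⟨iha hδa ?_ ?_, ihb hδb hsymm ?_⟩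
    · intro x y h
      rcases List.mem_append.1 h with h | h
      · exact List.mem_append_left _ (pairs_symm h)
      · exact List.mem_append_right _ (hsymm x y h)
    · intro l m x x' y y' hx hx' hy hy' hne h
      rcases List.mem_append.1 h with h | h
      · obtain ⟨h1, h2⟩ := exists_mem_cls_of_mem_pairs h
        rw [key l x x' hx hx' h1, key m y y' hy hy' h2]
        exact List.mem_append_left _ h
      · exact List.mem_append_right _ (hJ l m x x' y y' (hsub _ _ hx) (hsub _ _ hx') (hsub _ _ hy)
          (hsub _ _ hy') hne h)
    · intro l m x x' y y' hx hx' hy hy' hne h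
      exact hJ l m x x' y y' (hsub' _ _ hx) (hsub' _ _ hx') (hsub' _ _ hy) (hsub' _ _ hy') hne h
  | join i j a ih =>
    have hδa : ∀ l, δ l ≤ p + 1 := fun l => (hδ l).trans (by omega)
    refine ⟨ih hδa ?_ ?_, ?_⟩
    · intro x y h
      rcases List.mem_append.1 h with h | h
      · exact List.mem_append_left _ (mem_joinPairs.2 (mem_joinPairs.1 h).symm)
      · exact List.mem_append_right _ (hsymm x y h)
    · intro l m x x' y y' hx hx' hy hy' hne h
      rcases List.mem_append.1 h with h | h
      · refine List.mem_append_left _ (mem_joinPairs_labels.2 ?_)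
        rcases mem_joinPairs_labels.1 h with h | h
        · exact .inl ⟨cls_closed a hδa hx hx' h.1, cls_closed a hδa hy hy' h.2⟩
        · exact .inr ⟨cls_closed a hδa hy hy' h.1, cls_closed a hδa hx hx' h.2⟩
      · exact List.mem_append_right _ (hJ l m x x' y y' hx hx' hy hy' hne h)
    · by_cases hex : ∃ q ∈ joinPairs i j (a.toNamed δ (p + 1)).labels, q.1 ≠ q.2 ∧ q ∈ J
      · left
        obtain ⟨⟨x, y⟩, hq, hne, hqJ⟩ := hex
        have : ∃ x y, x ∈ (a.toNamed δ (p + 1)).cls i ∧ y ∈ (a.toNamed δ (p + 1)).cls j ∧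
            (x, y) ∈ J := by
          rcases mem_joinPairs_labels.1 hq with h | h
          · exact ⟨x, y, h.1, h.2, hqJ⟩
          · exact ⟨y, x, h.1, h.2, hsymm _ _ hqJ⟩
        obtain ⟨x, y, hx, hy, hxy⟩ := this
        rintro ⟨x', y'⟩ hq' hne'
        rcases mem_joinPairs_labels.1 hq' with h | h
        · exact hJ i j x x' y y' hx h.1 hy h.2 hne' hxy
        · exact hsymm _ _ (hJ i j x y' y x' hx h.1 hy h.2 (Ne.symm hne') hxy)
      · right
        exact fun q hq hne hqJ => hex ⟨q, hq, hne, hqJ⟩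
  | relabel i j a ih =>
    refine ih (update_label_le hδ i j) hsymm fun l m x x' y y' hx hx' hy hy' hne h => ?_
    exact hJ _ _ x x' y y' (mem_cls_relabel.2 ⟨l, hx, rfl⟩) (mem_cls_relabel.2 ⟨l, hx', rfl⟩)
      (mem_cls_relabel.2 ⟨m, hy, rfl⟩) (mem_cls_relabel.2 ⟨m, hy', rfl⟩) hne h
  | fuse i a ih => exact ih (update_newName_le hδ i) hsymm hJ

/-! ### The named graph is the graph of the expression -/

/-- The name of a vertex. -/
def name : (φ : FuseExpr k) → (ℕ → ℕ) → ℕ → φ.eval.V → ℕ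
  | .intro i, δ, p => fun _ => newName δ i p
  | .union a b, δ, p => Sum.elim (a.name δ (p + 1 + b.size)) (b.name δ (p + 1))
  | .join _ _ a, δ, p => a.name δ (p + 1)
  | .relabel i j a, δ, p => a.name (Function.update δ i (δ j)) (p + 1)
  | .fuse i a, δ, p => Sum.elim
      (fun v => a.name (Function.update δ i (newName δ i p)) (p + 1) v.1) (fun _ => newName δ i p)

/-- For a fusion, all vertices of label `i` below it already carry the name of the fused vertex.
Well-formedness provides at least one of them, so that this name does occur. -/
theorem mem_cls_toNamed {φ : FuseExpr k} (hφ : φ.WellFormed) {δ : ℕ → ℕ} {p : ℕ}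
    (hδ : ∀ l, δ l ≤ p) {l x : ℕ} :
    x ∈ (φ.toNamed δ p).cls l ↔ ∃ v, (φ.eval.lab v : ℕ) = l ∧ φ.name δ p v = x := by
  induction φ generalizing δ p l x with
  | intro i =>
    rw [toNamed, cls_leaf]
    constructor
    · intro h
      split_ifs at h with hl
      · exact ⟨(), hl.symm, (Finset.mem_singleton.1 h).symm⟩
      · simp at h
    · rintro ⟨v, rfl, rfl⟩
      rw [if_pos (by rfl)]
      exact Finset.mem_singleton_self _
  | union a b iha ihb =>
    have hδa : ∀ l, δ l ≤ p + 1 + b.size := fun l => (hδ l).trans (by omega)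
    have hδb : ∀ l, δ l ≤ p + 1 := fun l => (hδ l).trans (by omega)
    rw [toNamed, cls_union, Finset.mem_union, iha hφ.1 hδa, ihb hφ.2 hδb]
    constructor
    · rintro (⟨v, h1, h2⟩ | ⟨v, h1, h2⟩)
      · exact ⟨Sum.inl v, h1, h2⟩
      · exact ⟨Sum.inr v, h1, h2⟩
    · rintro ⟨v | v, h1, h2⟩
      · exact .inl ⟨v, h1, h2⟩
      · exact .inr ⟨v, h1, h2⟩
  | join i j a ih => exact ih hφ.2 fun l => (hδ l).trans (by omega)
  | relabel i j a ih =>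
    rw [toNamed, mem_cls_relabel]
    have hlab : ∀ v : a.eval.V, (((relabel i j a).eval.lab v : Fin k) : ℕ) =
        if (a.eval.lab v : ℕ) = i then (j : ℕ) else a.eval.lab v := by
      intro v
      show ((if a.eval.lab v = i then j else a.eval.lab v : Fin k) : ℕ) = _
      simp only [Fin.ext_iff]
      split_ifs <;> rfl
    constructor
    · rintro ⟨l', h, e⟩
      obtain ⟨v, rfl, h2⟩ := (ih hφ.2 (update_label_le hδ i j)).1 h
      exact ⟨v, (hlab v).trans e, h2⟩
    · rintro ⟨v, h1, h2⟩
      exact ⟨_, (ih hφ.2 (update_label_le hδ i j)).2 ⟨v, rfl, h2⟩, (hlab v).symm.trans h1⟩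
  | fuse i a ih =>
    have ih := @ih hφ.2 _ _ (update_newName_le hδ i)
    refine Iff.trans ih ?_
    constructor
    · rintro ⟨v, h1, h2⟩
      by_cases hv : a.eval.lab v = i
      · refine ⟨Sum.inr (), ?_, ?_⟩
        · rw [← h1, hv]; rfl
        · have := a.name_spec (update_newName_le hδ i) (ih.2 ⟨v, rfl, rfl⟩)
          rw [hv, Function.update_self] at this
          rw [← h2]
          exact (this.resolve_right fun h => newName_ne_zero _ _ _ h.1).2.symm
      · exact ⟨Sum.inl ⟨v, hv⟩, h1, h2⟩
    · rintro ⟨v | v, h1, h2⟩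
      · exact ⟨v.1, h1, h2⟩
      · obtain ⟨w, hw⟩ := hφ.1
        refine ⟨w, by rw [hw]; exact h1, ?_⟩
        have := a.name_spec (update_newName_le hδ i) (ih.2 ⟨w, rfl, rfl⟩)
        rw [hw, Function.update_self] at this
        rw [← h2]
        exact (this.resolve_right fun h => newName_ne_zero _ _ _ h.1).2

/-- Vertices share a name only if they are to be fused later, which is excluded by `δ = 0` at the
label of `v`. At the root `δ` vanishes everywhere, and names are injective. -/
theorem eq_of_name_eq {φ : FuseExpr k} (hφ : φ.WellFormed) {δ : ℕ → ℕ} {p : ℕ}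
    (hδ : ∀ l, δ l ≤ p) {v w : φ.eval.V} (hv : δ (φ.eval.lab v) = 0)
    (h : φ.name δ p v = φ.name δ p w) : v = w := by
  induction φ generalizing δ p with
  | intro i => rfl
  | union a b iha ihb =>
    have hδa : ∀ l, δ l ≤ p + 1 + b.size := fun l => (hδ l).trans (by omega)
    have hδb : ∀ l, δ l ≤ p + 1 := fun l => (hδ l).trans (by omega)
    rcases v with v | v <;> rcases w with w | w
    · exact congrArg Sum.inl (iha hφ.1 hδa hv h)
    · have h1 := a.name_spec hδa ((mem_cls_toNamed hφ.1 hδa).2 ⟨v, rfl, rfl⟩)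
      have h2 := b.name_spec hδb ((mem_cls_toNamed hφ.2 hδb).2 ⟨w, rfl, rfl⟩)
      have hv' : δ (a.eval.lab v) = 0 := hv
      have h' : a.name δ (p + 1 + b.size) v = b.name δ (p + 1) w := h
      have := hδ (b.eval.lab w)
      omega
    · have h1 := b.name_spec hδb ((mem_cls_toNamed hφ.2 hδb).2 ⟨v, rfl, rfl⟩)
      have h2 := a.name_spec hδa ((mem_cls_toNamed hφ.1 hδa).2 ⟨w, rfl, rfl⟩)
      have hv' : δ (b.eval.lab v) = 0 := hv
      have h' : b.name δ (p + 1) v = a.name δ (p + 1 + b.size) w := h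
      have := hδ (a.eval.lab w)
      omega
    · exact congrArg Sum.inr (ihb hφ.2 hδb hv h)
  | join i j a ih => exact ih hφ.2 (fun l => (hδ l).trans (by omega)) hv h
  | relabel i j a ih =>
    refine ih hφ.2 (update_label_le hδ i j) ?_ h
    rw [update_label_apply, ← hv]
    show _ = δ ((if a.eval.lab v = i then j else a.eval.lab v : Fin k) : ℕ)
    simp only [Fin.ext_iff]
    split_ifs <;> rfl
  | fuse i a ih =>
    have hδa := update_newName_le hδ i
    have spec : ∀ v : a.eval.V, a.eval.lab v ≠ i →
        (δ (a.eval.lab v) = 0 ∧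
          p + 1 < a.name (Function.update δ i (newName δ i p)) (p + 1) v) ∨
        (δ (a.eval.lab v) ≠ 0 ∧
          a.name (Function.update δ i (newName δ i p)) (p + 1) v = δ (a.eval.lab v)) := by
      intro v hv
      have := a.name_spec hδa ((mem_cls_toNamed hφ.2 hδa).2 ⟨v, rfl, rfl⟩)
      rw [Function.update_of_ne (Fin.val_ne_of_ne hv)] at this
      tauto
    rcases v with ⟨v, hvi⟩ | v <;> rcases w with ⟨w, hwi⟩ | w
    · have : v = w := ih hφ.2 hδa
        (by rw [Function.update_of_ne (Fin.val_ne_of_ne hvi)]; exact hv) h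
      subst this
      rfl
    · have h1 := spec v hvi
      have hv' : δ (a.eval.lab v) = 0 := hv
      have h' : a.name (Function.update δ i (newName δ i p)) (p + 1) v = newName δ i p := h
      have := newName_le hδ i
      omega
    · have h1 := spec w hwi
      have hv' : δ i = 0 := hv
      have h' : newName δ i p = a.name (Function.update δ i (newName δ i p)) (p + 1) w := h
      have e : newName δ i p = p + 1 := by rw [newName, if_pos hv']
      have := hδ (a.eval.lab w)
      omega
    · rfl

/-- The condition `x ≠ y` is essential: an edge between vertices that are fused later becomes a pair
`(x, x)`, which the fused graph does not have. -/
theorem mem_pairs_toNamed {φ : FuseExpr k} (hφ : φ.WellFormed) {δ : ℕ → ℕ} {p : ℕ}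
    (hδ : ∀ l, δ l ≤ p) {x y : ℕ} (hxy : x ≠ y) :
    (x, y) ∈ (φ.toNamed δ p).pairs ↔
      ∃ v w, φ.name δ p v = x ∧ φ.name δ p w = y ∧ φ.eval.graph.Adj v w := by
  induction φ generalizing δ p with
  | intro i =>
    simp only [toNamed, pairs, List.not_mem_nil, false_iff]
    rintro ⟨v, w, -, -, h⟩
    exact h
  | union a b iha ihb =>
    have hδa : ∀ l, δ l ≤ p + 1 + b.size := fun l => (hδ l).trans (by omega)
    have hδb : ∀ l, δ l ≤ p + 1 := fun l => (hδ l).trans (by omega)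
    rw [toNamed, pairs, List.mem_append, iha hφ.1 hδa, ihb hφ.2 hδb]
    constructor
    · rintro (⟨v, w, h1, h2, h3⟩ | ⟨v, w, h1, h2, h3⟩)
      · exact ⟨Sum.inl v, Sum.inl w, h1, h2, h3⟩
      · exact ⟨Sum.inr v, Sum.inr w, h1, h2, h3⟩
    · rintro ⟨v | v, w | w, h1, h2, h3⟩
      · exact .inl ⟨v, w, h1, h2, h3⟩
      · exact absurd h3 (by simp [eval, LabeledGraph.union])
      · exact absurd h3 (by simp [eval, LabeledGraph.union])
      · exact .inr ⟨v, w, h1, h2, h3⟩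
  | join i j a ih =>
    have hδa : ∀ l, δ l ≤ p + 1 := fun l => (hδ l).trans (by omega)
    rw [toNamed, pairs, List.mem_append, ih hφ.2 hδa, mem_joinPairs_labels,
      mem_cls_toNamed hφ.2 hδa, mem_cls_toNamed hφ.2 hδa, mem_cls_toNamed hφ.2 hδa,
      mem_cls_toNamed hφ.2 hδa]
    have hadj : ∀ v w : a.eval.V, (join i j a).eval.graph.Adj v w ↔ a.eval.graph.Adj v w ∨
        (v ≠ w ∧ ((a.eval.lab v = i ∧ a.eval.lab w = j) ∨
          (a.eval.lab w = i ∧ a.eval.lab v = j))) := fun v w => by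
      simp [eval, LabeledGraph.join]
    constructor
    · rintro (⟨v, w, h1, h2, h3⟩ | ⟨⟨v, h1, h2⟩, w, h3, h4⟩ | ⟨⟨w, h1, h2⟩, v, h3, h4⟩)
      · exact ⟨v, w, h1, h2, (hadj v w).2 (.inl h3)⟩
      · refine ⟨v, w, h2, h4, (hadj v w).2 (.inr ⟨?_, .inl ⟨Fin.ext h1, Fin.ext h3⟩⟩)⟩
        rintro rfl
        exact hxy (h2.symm.trans h4)
      · refine ⟨v, w, h4, h2, (hadj v w).2 (.inr ⟨?_, .inr ⟨Fin.ext h1, Fin.ext h3⟩⟩)⟩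
        rintro rfl
        exact hxy (h4.symm.trans h2)
    · rintro ⟨v, w, h1, h2, h3⟩
      rcases (hadj v w).1 h3 with h3 | ⟨-, ⟨h3, h4⟩ | ⟨h3, h4⟩⟩
      · exact .inl ⟨v, w, h1, h2, h3⟩
      · exact .inr (.inl ⟨⟨v, congrArg Fin.val h3, h1⟩, w, congrArg Fin.val h4, h2⟩)
      · exact .inr (.inr ⟨⟨w, congrArg Fin.val h3, h2⟩, v, congrArg Fin.val h4, h1⟩)
  | relabel i j a ih => exact ih hφ.2 (update_label_le hδ i j)
  | fuse i a ih =>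
    have hδa := update_newName_le hδ i
    refine Iff.trans (ih hφ.2 hδa) ?_
    have hi : ∀ v : a.eval.V, a.eval.lab v = i →
        a.name (Function.update δ i (newName δ i p)) (p + 1) v = newName δ i p := by
      intro v hv
      have := a.name_spec hδa ((mem_cls_toNamed hφ.2 hδa).2 ⟨v, rfl, rfl⟩)
      rw [hv, Function.update_self] at this
      exact (this.resolve_right fun h => newName_ne_zero _ _ _ h.1).2
    constructor
    · rintro ⟨v, w, h1, h2, h3⟩
      by_cases hv : a.eval.lab v = i <;> by_cases hw : a.eval.lab w = i
      · exact absurd (h1.symm.trans ((hi v hv).trans ((hi w hw).symm.trans h2))) hxy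
      · exact ⟨Sum.inr (), Sum.inl ⟨w, hw⟩, (hi v hv).symm.trans h1, h2, v, hv, h3⟩
      · exact ⟨Sum.inl ⟨v, hv⟩, Sum.inr (), h1, (hi w hw).symm.trans h2, w, hw, h3⟩
      · exact ⟨Sum.inl ⟨v, hv⟩, Sum.inl ⟨w, hw⟩, h1, h2, h3⟩
    · rintro ⟨⟨v, hv⟩ | v, ⟨w, hw⟩ | w, h1, h2, h3⟩
      · exact ⟨v, w, h1, h2, h3⟩
      · obtain ⟨u, hu, h3⟩ := h3
        exact ⟨v, u, h1, (hi u hu).trans h2, h3⟩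
      · obtain ⟨u, hu, h3⟩ := h3
        exact ⟨u, w, (hi u hu).trans h1, h2, h3⟩
      · exact h3.elim

end FuseExpr

/-! ## The theorem -/

/-- Every cut edge has exactly one orientation from `S` to its complement, so unordered cut edges
and ordered cut pairs are equally many. -/
theorem cutSize_eq_card_cutPairs {V : Type} {H : SimpleGraph V} {ν : V → ℕ}
    (hν : Function.Injective ν) {L : List (ℕ × ℕ)}
    (hL : ∀ x y, x ≠ y → ((x, y) ∈ L ↔ ∃ v w, ν v = x ∧ ν w = y ∧ H.Adj v w)) {S : Set V}
    {c : ℕ → Bool} (hc : ∀ v, c (ν v) = true ↔ v ∈ S) :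
    cutSize H S = (cutPairs c L).card := by
  set A : Set (V × V) := {q | H.Adj q.1 q.2 ∧ q.1 ∈ S ∧ q.2 ∉ S} with hA
  have h1 : {e | e ∈ H.edgeSet ∧ ∃ u ∈ S, ∃ v ∈ Sᶜ, e = s(u, v)} = (fun q => s(q.1, q.2)) '' A := by
    ext e
    constructor
    · rintro ⟨he, u, hu, v, hv, rfl⟩
      exact ⟨(u, v), ⟨he, hu, hv⟩, rfl⟩
    · rintro ⟨⟨u, v⟩, ⟨h, hu, hv⟩, rfl⟩
      exact ⟨h, u, hu, v, hv, rfl⟩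
  have h2 : (cutPairs c L : Set (ℕ × ℕ)) = Prod.map ν ν '' A := by
    ext ⟨x, y⟩
    rw [Finset.mem_coe, mem_cutPairs]
    constructor
    · rintro ⟨h, hx, hy⟩
      have hxy : x ≠ y := by
        rintro rfl
        simp_all
      obtain ⟨v, w, rfl, rfl, hadj⟩ := (hL x y hxy).1 h
      refine ⟨(v, w), ⟨hadj, (hc v).1 hx, fun hw => ?_⟩, rfl⟩
      have := (hc w).2 hw
      simp_all
    · rintro ⟨⟨v, w⟩, ⟨h, hv, hw⟩, e⟩
      obtain ⟨rfl, rfl⟩ := Prod.mk.inj e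
      refine ⟨(hL _ _ fun e => h.ne (hν e)).2 ⟨v, w, rfl, rfl, h⟩, (hc v).2 hv, ?_⟩
      rw [← Bool.not_eq_true]
      exact fun h => hw ((hc w).1 h)
  rw [cutSize, h1, Set.InjOn.ncard_image, ← Set.ncard_coe_finset, h2,
    Set.ncard_image_of_injective _ (hν.prodMap hν)]
  rintro ⟨u, v⟩ ⟨-, hu, hv⟩ ⟨u', v'⟩ ⟨-, hu', hv'⟩ e
  rcases Sym2.eq_iff.1 e with ⟨rfl, rfl⟩ | ⟨rfl, rfl⟩
  · rfl
  · exact absurd hu hv'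

theorem range_cutSize {V : Type} {H : SimpleGraph V} {ν : V → ℕ} (hν : Function.Injective ν)
    {L : List (ℕ × ℕ)}
    (hL : ∀ x y, x ≠ y → ((x, y) ∈ L ↔ ∃ v w, ν v = x ∧ ν w = y ∧ H.Adj v w)) :
    Set.range (cutSize H) = Set.range fun c : ℕ → Bool => (cutPairs c L).card := by
  classical
  ext r
  constructor
  · rintro ⟨S, rfl⟩
    refine ⟨fun x => decide (∃ v ∈ S, ν v = x), (cutSize_eq_card_cutPairs hν hL fun v => ?_).symm⟩
    rw [decide_eq_true_iff]
    exact ⟨fun ⟨w, hw, e⟩ => hν e ▸ hw, fun hv => ⟨v, hv, rfl⟩⟩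
  · rintro ⟨c, rfl⟩
    exact ⟨{v | c (ν v) = true}, cutSize_eq_card_cutPairs hν hL fun v => Iff.rfl⟩

namespace FuseExpr

variable {k : ℕ}

theorem nonempty_eval (φ : FuseExpr k) : Nonempty φ.eval.V := by
  induction φ with
  | intro i => exact ⟨()⟩
  | union a b iha _ => exact iha.map Sum.inl
  | join i j a ih => exact ih
  | relabel i j a ih => exact ih
  | fuse i a _ => exact ⟨Sum.inr ()⟩

theorem pos_of_expr (φ : FuseExpr k) : 0 < k :=
  let ⟨v⟩ := φ.nonempty_eval
  (φ.eval.lab v).pos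

theorem size_pos (φ : FuseExpr k) : 0 < φ.size := by
  cases φ <;> simp [size]

theorem size_encode_le (φ : FuseExpr k) : φ.encode.size ≤ φ.size * (2 * k + 6) := by
  induction φ with
  | intro i =>
    have := i.2
    simp only [encode, Data.size, Data.size_ofNat, size]
    omega
  | union a b iha ihb =>
    simp only [encode, Data.size, Data.size_ofNat, size, add_mul] at *
    omega
  | join i j a ih =>
    have := i.2
    have := j.2
    simp only [encode, Data.size, Data.size_ofNat, size, add_mul] at *
    omega
  | relabel i j a ih =>
    have := i.2
    have := j.2
    simp only [encode, Data.size, Data.size_ofNat, size, add_mul] at *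
    omega
  | fuse i a ih =>
    have := i.2
    simp only [encode, Data.size, Data.size_ofNat, size, add_mul] at *
    omega

end FuseExpr

namespace MaxCutInstance

/-- The names of the vertices of a graph that the expression of an instance creates. -/
theorem exists_names (a : MaxCutInstance) {V : Type} {H : SimpleGraph V}
    (h : a.expr.IsFuseExprOf H) :
    ∃ ν : V → ℕ, Function.Injective ν ∧ (∀ x, x ∈ codeNames a.named.code ↔ ∃ v, ν v = x) ∧
      ∀ x y, x ≠ y → ((x, y) ∈ a.named.pairs ↔ ∃ v w, ν v = x ∧ ν w = y ∧ H.Adj v w) := by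
  obtain ⟨hwf, ⟨e⟩⟩ := h
  have hδ : ∀ l : ℕ, (fun _ : ℕ => 0) l ≤ 0 := fun _ => le_rfl
  refine ⟨fun v => a.expr.name (fun _ => 0) 0 (e.symm v), fun v w h =>
    e.symm.injective (FuseExpr.eq_of_name_eq hwf hδ rfl h), fun x => ?_, fun x y hxy => ?_⟩
  · rw [NamedExpr.mem_codeNames]
    simp only [named, FuseExpr.mem_cls_toNamed hwf hδ]
    constructor
    · rintro ⟨l, v, -, rfl⟩
      exact ⟨e v, by simp⟩
    · rintro ⟨v, rfl⟩
      exact ⟨_, e.symm v, rfl, rfl⟩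
  · rw [named, FuseExpr.mem_pairs_toNamed hwf hδ hxy]
    constructor
    · rintro ⟨v, w, h1, h2, h3⟩
      exact ⟨e v, e w, by simpa using h1, by simpa using h2, e.map_adj_iff.2 h3⟩
    · rintro ⟨v, w, h1, h2, h3⟩
      exact ⟨e.symm v, e.symm w, h1, h2, e.symm.map_adj_iff.2 h3⟩

theorem length_codeNames (a : MaxCutInstance) {V : Type} [Fintype V] {H : SimpleGraph V}
    (h : a.expr.IsFuseExprOf H) : (codeNames a.named.code).length = Fintype.card V := by
  classical
  obtain ⟨ν, hν, hn, -⟩ := a.exists_names h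
  rw [← List.toFinset_card_of_nodup (NamedExpr.codeNames_spec _).1, ← Finset.card_univ,
    ← Finset.card_image_of_injective _ hν]
  congr 1
  ext x
  simp [hn]

theorem isMaxCut_solve (a : MaxCutInstance) {V : Type} [Fintype V] {H : SimpleGraph V}
    (h : a.expr.IsFuseExprOf H) : IsMaxCut H a.solve := by
  obtain ⟨ν, hν, hn, hL⟩ := a.exists_names h
  have hδ : ∀ l : ℕ, (fun _ : ℕ => 0) l ≤ 0 := fun _ => le_rfl
  by_cases h2 : 2 ≤ (codeNames a.named.code).length
  · rw [IsMaxCut, range_cutSize hν hL]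
    refine NamedExpr.codeMaxCut_spec (FuseExpr.good_toNamed h.1 hδ)
      (FuseExpr.allOrNone_toNamed _ hδ (by simp) ?_) (fun l l' x hx hx' => ?_) h2
    · intro l m x x' y y' _ _ _ _ _ h
      simp at h
    · exact FuseExpr.label_unique a.expr hδ rfl hx' hx
  -- With at most one vertex the dynamic program is bypassed; every cut is empty.
  · have hs : a.solve = 0 := by
      rw [solve, codeMaxCut]
      match hm : codeNames a.named.code with
      | [] => rfl
      | [_] => rfl
      | _ :: _ :: _ => simp [hm] at h2
    have hcard : Fintype.card V ≤ 1 := by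
      rw [← a.length_codeNames h]; omega
    have : Subsingleton V := Fintype.card_le_one_iff_subsingleton.1 hcard
    have h0 : ∀ S, cutSize H S = 0 := by
      intro S
      refine (congrArg Set.ncard (Set.eq_empty_iff_forall_notMem.2 ?_)).trans (Set.ncard_empty _)
      rintro e ⟨-, u, hu, v, hv, -⟩
      exact hv (Subsingleton.elim u v ▸ hu)
    rw [hs]
    refine ⟨⟨∅, h0 ∅⟩, ?_⟩
    rintro _ ⟨S, rfl⟩
    exact (h0 S).le

/-- A program for Max Cut whose running time is polynomial in the size of the expression and
`n ^ k`. -/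
theorem exists_program : ∃ (P : Program) (c : ℕ), ∀ (k : ℕ) (φ : FuseExpr k) (V : Type) [Fintype V]
    (H : SimpleGraph V), φ.IsFuseExprOf H → SolvesMaxCut P φ H
      ((k + φ.encode.size + 1 + Fintype.card V ^ k + 2) ^ c) := by
  obtain ⟨⟨P, T, ⟨c, hT⟩, hP⟩, -⟩ := polyTime_solve
  refine ⟨P, c, fun k φ V _ H h => ?_⟩
  let a : MaxCutInstance := ⟨k, φ⟩
  obtain ⟨t, ht, s, he, h0, -⟩ := hP a (initStore (enc a)) rfl
  refine ⟨t, ht.trans ((hT a).trans ?_), a.solve, ⟨s, he, h0⟩, a.isMaxCut_solve h⟩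
  rw [← a.length_codeNames h]
  exact le_rfl

end MaxCutInstance

/-! ### Estimates of the running time -/

theorem SolvesMaxCut.mono {P : Program} {k : ℕ} {φ : FuseExpr k} {V : Type} {H : SimpleGraph V}
    {t t' : ℕ} (h : SolvesMaxCut P φ H t) (ht : t ≤ t') : SolvesMaxCut P φ H t' :=
  let ⟨u, hu, h⟩ := h
  ⟨u, hu.trans ht, h⟩

theorem add_pow_le_two_pow_mul (a b c : ℕ) : (a + b) ^ c ≤ 2 ^ c * (a ^ c + b ^ c) := by
  rcases le_total a b with h | h
  · calc (a + b) ^ c ≤ (2 * b) ^ c := by gcongr; omega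
      _ = 2 ^ c * b ^ c := mul_pow _ _ _
      _ ≤ _ := by gcongr; omega
  · calc (a + b) ^ c ≤ (2 * a) ^ c := by gcongr; omega
      _ = 2 ^ c * a ^ c := mul_pow _ _ _
      _ ≤ _ := by gcongr; omega

/-- The factor `2 ^ c` comes from separating the two summands under the power, and `6 * c` from the
exponent in `h1`, which uses `s + k ≥ 2`. The one constant `2 ^ c + 6 * c` dominates all factors and
exponents. -/
theorem time_bound {k e s n : ℕ} (c : ℕ) (hk : 1 ≤ k) (hs : 1 ≤ s) (hn : 1 ≤ n)
    (he : e ≤ s * (2 * k + 6)) : (k + e + 1 + n ^ k + 2) ^ c ≤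
      (2 ^ c + 6 * c) * ((s + k) ^ (2 ^ c + 6 * c) + n ^ ((2 ^ c + 6 * c) * k)) := by
  have h1 : k + e + 3 ≤ (s + k) ^ 6 := by
    have a1 : s * (2 * k + 6) ≤ (s + k) * (2 * (s + k) + 6) := by gcongr <;> omega
    have a2 : 2 ≤ s + k := by omega
    have a3 : k ≤ s + k := by omega
    generalize s + k = m at *
    have a4 : m * (2 * m + 6) + m + 3 ≤ m ^ 6 := by
      have b1 : 2 ^ 4 ≤ m ^ 4 := Nat.pow_le_pow_left a2 4
      have b2 : m ^ 2 * 2 ^ 4 ≤ m ^ 2 * m ^ 4 := Nat.mul_le_mul_left _ b1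
      have b3 : m ^ 2 * m ^ 4 = m ^ 6 := by ring
      nlinarith
    omega
  calc (k + e + 1 + n ^ k + 2) ^ c ≤ ((s + k) ^ 6 + n ^ k) ^ c := Nat.pow_le_pow_left (by omega) c
    _ ≤ 2 ^ c * (((s + k) ^ 6) ^ c + (n ^ k) ^ c) := add_pow_le_two_pow_mul _ _ _
    _ = 2 ^ c * ((s + k) ^ (6 * c) + n ^ (c * k)) := by rw [← pow_mul, ← pow_mul, mul_comm k c]
    _ ≤ _ := by
      gcongr
      · exact Nat.le_add_right _ _
      · omega
      · exact Nat.le_add_left _ _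
      · have := Nat.lt_two_pow_self (n := c)
        omega

/-- Since `n ≥ 2`, a constant `m` is at most `n ^ (m * k)`, also `k ≤ n ^ k`, and doubling costs
only one more `k` in the exponent. So everything moves into the exponent: `3 * d` bounds `s`, adding
`k` gives `3 * d + 2`, the last sum contributes the `1`, and the outer factor `c` the final `c`. -/
theorem time_bound_of_polynomial {k s n d : ℕ} (c : ℕ) (hk : 1 ≤ k) (hn : 2 ≤ n)
    (hs : s ≤ d * (n + k) ^ d) :
    c * ((s + k) ^ c + n ^ (c * k)) ≤ n ^ (((3 * d + 3) * c + 1 + c) * k) := by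
  have hle : ∀ m : ℕ, m ≤ n ^ (m * k) := fun m =>
    calc m ≤ 2 ^ m := Nat.lt_two_pow_self.le
      _ ≤ n ^ m := Nat.pow_le_pow_left hn m
      _ ≤ n ^ (m * k) := Nat.pow_le_pow_right (by omega) (Nat.le_mul_of_pos_right m hk)
  have hdouble : ∀ m : ℕ, n ^ (m * k) + n ^ (m * k) ≤ n ^ ((m + 1) * k) := fun m =>
    calc n ^ (m * k) + n ^ (m * k) = n ^ (m * k) * 2 := by ring
      _ ≤ n ^ (m * k) * n ^ k := by
        gcongr
        exact hn.trans (Nat.le_self_pow (by omega) n)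
      _ = n ^ ((m + 1) * k) := by ring
  have hmono : ∀ {m m' : ℕ}, m ≤ m' → n ^ (m * k) ≤ n ^ (m' * k) := fun h =>
    Nat.pow_le_pow_right (by omega) (Nat.mul_le_mul_right k h)
  have hkk : k ≤ n ^ (1 * k) := by
    rw [one_mul]
    exact Nat.lt_two_pow_self.le.trans (Nat.pow_le_pow_left hn k)
  have h1 : n + k ≤ n ^ (2 * k) := by
    have : n ≤ n ^ (1 * k) := by
      rw [one_mul]
      exact Nat.le_self_pow (by omega) n
    have h := hdouble 1
    rw [one_add_one_eq_two] at h
    omega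
  have h2 : s ≤ n ^ (3 * d * k) :=
    calc s ≤ d * (n + k) ^ d := hs
      _ ≤ n ^ (d * k) * (n ^ (2 * k)) ^ d := by
        gcongr
        exact hle d
      _ = n ^ (3 * d * k) := by ring
  have h3 : s + k ≤ n ^ ((3 * d + 2) * k) := by
    have a1 : n ^ (3 * d * k) ≤ n ^ ((3 * d + 1) * k) := hmono (by omega)
    have a2 : n ^ (1 * k) ≤ n ^ ((3 * d + 1) * k) := hmono (by omega)
    have a3 := hdouble (3 * d + 1)
    have a4 : 3 * d + 1 + 1 = 3 * d + 2 := by ring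
    rw [a4] at a3
    omega
  have h4 : (s + k) ^ c ≤ n ^ ((3 * d + 3) * c * k) :=
    calc (s + k) ^ c ≤ (n ^ ((3 * d + 2) * k)) ^ c := Nat.pow_le_pow_left h3 c
      _ = n ^ ((3 * d + 2) * c * k) := by ring
      _ ≤ _ := hmono (Nat.mul_le_mul_right c (by omega))
  have h5 : n ^ (c * k) ≤ n ^ ((3 * d + 3) * c * k) := hmono (by nlinarith)
  calc c * ((s + k) ^ c + n ^ (c * k))
      ≤ n ^ (c * k) * n ^ (((3 * d + 3) * c + 1) * k) :=
        Nat.mul_le_mul (hle c) ((Nat.add_le_add h4 h5).trans (hdouble _))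
    _ = _ := by ring

theorem mainTheorem4 :
    -- one program that solves Max Cut on every fuse-`k`-expression, for every `k`
    (∃ P : While.Program,
      -- in time `poly(|φ| + k) + n ^ O(k)`
      (∃ c : ℕ, ∀ (k : ℕ) (φ : FuseExpr k) (V : Type) [Fintype V] (H : SimpleGraph V),
        φ.IsFuseExprOf H →
          SolvesMaxCut P φ H
            (c * ((φ.size + k) ^ c + Fintype.card V ^ (c * k)))) ∧
      -- hence in time `n ^ O(k)` if the expression has polynomial size
      (∀ d : ℕ, ∃ c : ℕ, ∀ (k : ℕ) (φ : FuseExpr k) (V : Type) [Fintype V] (H : SimpleGraph V),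
        φ.IsFuseExprOf H → 2 ≤ Fintype.card V →
        φ.size ≤ d * (Fintype.card V + k) ^ d →
          SolvesMaxCut P φ H (Fintype.card V ^ (c * k)))) ∧
    -- lower bounds transfer: a time bound that is impossible for `k`-expressions without fuses
    -- is impossible for fuse-`k`-expressions
    (∀ T : ℕ → ℕ → ℕ → ℕ,
      (¬ ∃ P : While.Program, ∀ (k : ℕ) (φ : FuseExpr k) (V : Type) [Fintype V]
        (H : SimpleGraph V), φ.IsCliqueExprOf H →
          SolvesMaxCut P φ H (T φ.size k (Fintype.card V))) →
      ¬ ∃ P : While.Program, ∀ (k : ℕ) (φ : FuseExpr k) (V : Type) [Fintype V]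
        (H : SimpleGraph V), φ.IsFuseExprOf H →
          SolvesMaxCut P φ H (T φ.size k (Fintype.card V))) := by
  obtain ⟨P, c, hP⟩ := MaxCutInstance.exists_program
  have main : ∀ (k : ℕ) (φ : FuseExpr k) (V : Type) [Fintype V] (H : SimpleGraph V),
      φ.IsFuseExprOf H → SolvesMaxCut P φ H
        ((2 ^ c + 6 * c) * ((φ.size + k) ^ (2 ^ c + 6 * c) +
          Fintype.card V ^ ((2 ^ c + 6 * c) * k))) := by
    intro k φ V _ H h
    have : Nonempty V := by
      obtain ⟨-, ⟨e⟩⟩ := h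
      exact φ.nonempty_eval.map e
    exact (hP k φ V H h).mono
      (time_bound c φ.pos_of_expr φ.size_pos Fintype.card_pos φ.size_encode_le)
  refine ⟨⟨P, ⟨_, main⟩, fun d => ⟨_, fun k φ V _ H h hn hs => (main k φ V H h).mono
    (time_bound_of_polynomial _ φ.pos_of_expr hn hs)⟩⟩, ?_⟩
  -- A `k`-expression is a fuse-`k`-expression with the same parameters, so `Q` itself contradicts
  -- the lower bound.
  rintro T hT ⟨Q, hQ⟩
  exact hT ⟨Q, fun k φ V _ H h => hQ k φ V H h.2⟩
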